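/- **Transversality of small-amplitude shock profiles of the isothermal Navier–Stokes–Poisson system.** Fix constants $T,\nu,\varepsilon>0$, $v_->0$ and $u_-\in\mathbb R$. There is $\delta_1>0$ such that the following holds for all $(v_+,u_+,s)$ with $s>0$, $v_+>v_-$, $|v_+-v_-|<\delta_1$ and $$-s(v_+-v_-)-(u_+-u_-)=0,\qquad -s(u_+-u_-)+(T+1)\Big(\frac1{v_+}-\frac1{v_-}\Big)=0,$$ and every shock profile $(\bar v,\bar u,\bar\phi)$ connecting the two states, that is, every triple of smooth functions on $\mathbb R$ with $\bar v>0$, $$-s\bar v'-\bar u'=0,\qquad -s\bar u'+\Big(\frac T{\bar v}\Big)'=\Big(\frac{\nu\bar u'}{\bar v}\Big)'-\frac{\bar\phi'}{\bar v},\qquad -\varepsilon^2\Big(\frac{\bar\phi'}{\bar v}\Big)'=1-\bar v e^{\bar\phi},$$ $(\bar v,\bar u,\bar\phi)(x)\to(v_\pm,u_\pm,-\ln v_\pm)$ as $x\to\pm\infty$, $s\bar v'=-\bar u'>0$, and $\underline C\,\bar u'\le\bar\phi'\le\overline C\,\bar u'$ for some constants $\underline C,\overline C>0$. *Notation.* Let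 $$b_1=\frac{\varepsilon^2\bar\phi'}{\bar v^3},\quad b_2=\frac{\nu}{\bar v},\quad D_{21}=\frac{\varepsilon^2\bar\phi'}{\bar v^2}+\frac{\varepsilon^2\bar v'}{\bar v^3},\quad E_{21}=-\frac{\varepsilon^2}{\bar v^2},$$ $$A_{21}=\frac{T+1}{\bar v^2}-\frac{\nu\bar u'}{\bar v^2}-\frac{\varepsilon^2\bar\phi'^2}{\bar v^3}+\frac{\varepsilon^2}{\bar v}\Big(\frac{\bar\phi'}{\bar v^2}\Big)'+\frac{\varepsilon^2}{\bar v^2}\Big(\frac{\bar\phi'}{\bar v}\Big)'.$$ The eigenvalue equation at $\lambda=0$ of the linearization about the profile is the first-order system for $W=(v,u,\tilde u',\phi,\phi')^{\mathrm{tr}}:\mathbb R\to\mathbb C^5$, $\tilde u=b_1v+b_2u$, defined by $$v'=-\tfrac1s u',\qquad u'=\tfrac1{b_2}\big(\tilde u'-b_1'v-b_1v'-b_2'u\big),\qquad \tilde u''=\big((b_1'-A_{21})v+(b_2'-s)u-D_{21}\phi'-E_{21}\phi''\big)',$$ $$\phi''=\Big(\frac{\bar\phi''}{\bar v}-\frac{2\bar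 v'\bar\phi'}{\bar v^2}+\frac{\bar ve^{\bar\phi}}{\varepsilon^2}\Big)v+\frac{\bar\phi'}{\bar v}v'+\frac{\bar v^2e^{\bar\phi}}{\varepsilon^2}\phi+\frac{\bar v'}{\bar v}\phi'.\qquad(\ast)$$ Let $\mathcal F_+$ and $\mathcal F_-$ be the sets of its solutions that decay exponentially as $x\to+\infty$ and as $x\to-\infty$, respectively, and let $W_0=(\bar v',\bar u',(b_1\bar v'+b_2\bar u')',\bar\phi',\bar\phi'')^{\mathrm{tr}}$. Put $$R=\begin{pmatrix} b_1&b_2&0&0&0\\ s&1&0&0&0\\ A_{21}-b_1'&s-b_2'&1&0&0\\0&0&0&1&0\\0&0&0&0&1\end{pmatrix},\qquad a_2^-=s+\sqrt{\frac{T+1}{v_-^2}} .$$ For $\varphi_2^+$ such that $\{W_0,\varphi_2^+\}$ is a basis of $\mathcal F_+$ and $\varphi_4^-$ such that $\{W_0,\varphi_4^-\}$ is a basis of $\mathcal F_-$, the transversality coefficient is, with $\zeta_2^+=R\varphi_2^+$, $\zeta_0=RW_0$, $\zeta_4^-=R\varphi_4^-$ and second indices denoting components, $$\Gamma=\frac{a_2^-}{\det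 R(0)}\det\begin{pmatrix}\zeta_{2,1}^+&\zeta_{0,1}&\zeta_{4,1}^-\\ \zeta_{2,4}^+&\zeta_{0,4}&\zeta_{4,4}^-\\ \zeta_{2,5}^+&\zeta_{0,5}&\zeta_{4,5}^-\end{pmatrix}\Bigg|_{x=0}.$$ The reduced variational equation is the three-dimensional linear system for $V=(u,\phi,\phi')^{\mathrm{tr}}:\mathbb R\to\mathbb C^3$ obtained from the equations for $u'$ and $\phi''$ in $(\ast)$ by substituting $v=-\tfrac1su$ and $\tilde u'=(b_1'-A_{21})v+(b_2'-s)u-D_{21}\phi'-E_{21}\phi''$. *Claim.* 1. Such $\varphi_2^+$ and $\varphi_4^-$ exist (so $\mathcal F_\pm$ are two-dimensional linear spaces containing $W_0$), and for every choice of them $\Gamma\neq0$. 2. The solutions of the reduced variational equation that are bounded on $\mathbb R$ form a one-dimensional space, spanned by $\bar V'=(\bar u',\bar\phi',\bar\phi'')^{\mathrm{tr}}\not\equiv0$. -/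

import Mathlib

noncomputable section

namespace NSP

/-- The parameters of the Navier-Stokes-Poisson system (temperature `T`, viscosity `ν`, Debye
length `ε`), a wave speed `s`, and three functions `v`, `u`, `φ` of the travelling-wave variable
(specific volume, velocity, electric potential). This is bare data; the laws are stated by
`IsShockProfile`. -/
structure Wave where
  T : ℝ
  ν : ℝ
  ε : ℝ
  s : ℝ
  v : ℝ → ℝ
  u : ℝ → ℝ
  φ : ℝ → ℝ

/-- `(v, u, φ)` is a smooth travelling-wave profile with speed `s`, connecting
`(vm, um, -log vm)` at `-∞` to `(vp, up, -log vp)` at `+∞`, with the monotonicity properties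
`s v' = -u' > 0` and `c u' ≤ φ' ≤ C u'` for some positive constants `c`, `C`. -/
structure IsShockProfile (P : Wave) (vm um vp up : ℝ) : Prop where
  smooth_v : ContDiff ℝ (⊤ : ℕ∞) P.v
  smooth_u : ContDiff ℝ (⊤ : ℕ∞) P.u
  smooth_φ : ContDiff ℝ (⊤ : ℕ∞) P.φ
  v_pos : ∀ x, 0 < P.v x
  mass : ∀ x, -P.s * deriv P.v x - deriv P.u x = 0
  momentum : ∀ x, -P.s * deriv P.u x + deriv (fun y => P.T / P.v y) x
    = deriv (fun y => P.ν * deriv P.u y / P.v y) x - deriv P.φ x / P.v x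
  poisson : ∀ x, -P.ε ^ 2 * deriv (fun y => deriv P.φ y / P.v y) x
    = 1 - P.v x * Real.exp (P.φ x)
  v_atBot : Filter.Tendsto P.v Filter.atBot (nhds vm)
  u_atBot : Filter.Tendsto P.u Filter.atBot (nhds um)
  φ_atBot : Filter.Tendsto P.φ Filter.atBot (nhds (-Real.log vm))
  v_atTop : Filter.Tendsto P.v Filter.atTop (nhds vp)
  u_atTop : Filter.Tendsto P.u Filter.atTop (nhds up)
  φ_atTop : Filter.Tendsto P.φ Filter.atTop (nhds (-Real.log vp))
  monotone_v : ∀ x, P.s * deriv P.v x = -deriv P.u x ∧ 0 < -deriv P.u x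
  monotone_φ : ∃ c C : ℝ, 0 < c ∧ 0 < C ∧
    ∀ x, c * deriv P.u x ≤ deriv P.φ x ∧ deriv P.φ x ≤ C * deriv P.u x

namespace Wave

variable (P : Wave)

/-! ### Coefficients of the linearized operator
`L U = (A U)_x + (B U_x)_x + (D Φ_x)_x + (E Φ_xx)_x`, `U = (v, u)`, where `Φ = (φ, 0)` and `φ`
solves the linearized Poisson equation with right-hand side given by `v`. -/

/-- The matrix `A(x)`. -/
def A (x : ℝ) : Matrix (Fin 2) (Fin 2) ℝ :=
  !![P.s, 1;
     (P.T + 1) / P.v x ^ 2 - P.ν * deriv P.u x / P.v x ^ 2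
        - P.ε ^ 2 * deriv P.φ x ^ 2 / P.v x ^ 3
        + P.ε ^ 2 / P.v x * deriv (fun y => deriv P.φ y / P.v y ^ 2) x
        + P.ε ^ 2 / P.v x ^ 2 * deriv (fun y => deriv P.φ y / P.v y) x, P.s]

/-- The matrix `B(x)`. -/
def B (x : ℝ) : Matrix (Fin 2) (Fin 2) ℝ :=
  !![0, 0; P.ε ^ 2 * deriv P.φ x / P.v x ^ 3, P.ν / P.v x]

/-- The matrix `D(x)`. -/
def D (x : ℝ) : Matrix (Fin 2) (Fin 2) ℝ :=
  !![0, 0;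
     P.ε ^ 2 * deriv P.φ x / P.v x ^ 2 + P.ε ^ 2 * deriv P.v x / P.v x ^ 3, 0]

/-- The matrix `E(x)`. -/
def E (x : ℝ) : Matrix (Fin 2) (Fin 2) ℝ :=
  !![0, 0; -P.ε ^ 2 / P.v x ^ 2, 0]

/-- `b₁`, the `(2,1)` entry of `B`. -/
def b1 (x : ℝ) : ℝ := P.B x 1 0

/-- `b₂`, the `(2,2)` entry of `B`. -/
def b2 (x : ℝ) : ℝ := P.B x 1 1

/-- `A₂₁`. -/
def A21 (x : ℝ) : ℝ := P.A x 1 0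

/-- `D₂₁`. -/
def D21 (x : ℝ) : ℝ := P.D x 1 0

/-- `E₂₁`. -/
def E21 (x : ℝ) : ℝ := P.E x 1 0

/-- The coefficient of the perturbation `v` in the linearized Poisson equation solved for the
second derivative of the perturbation `φ`. -/
def poissonCoeff (x : ℝ) : ℝ :=
  deriv (deriv P.φ) x / P.v x - 2 * deriv P.v x * deriv P.φ x / P.v x ^ 2
    + P.v x * Real.exp (P.φ x) / P.ε ^ 2

/-- The eigenvalue equation `L U = lam U` as a first-order system in the coordinates
`W = (v, u, ũ', φ, φ')`, `ũ = b₁ v + b₂ u`, given by its defining relations.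
(The third relation also says that the expression under the derivative is differentiable.) -/
structure IsModeSolution (lam : ℂ) (W : ℝ → Fin 5 → ℂ) : Prop where
  differentiable : Differentiable ℝ W
  eq_v : ∀ x, deriv W x 0 = lam / P.s * W x 0 - 1 / P.s * deriv W x 1
  eq_u : ∀ x, deriv W x 1 = 1 / P.b2 x * (W x 2 - deriv P.b1 x * W x 0
    - P.b1 x * deriv W x 0 - deriv P.b2 x * W x 1)
  eq_ut : ∀ x, HasDerivAt
    (fun y => ((deriv P.b1 y - P.A21 y : ℝ) : ℂ) * W y 0 + ((deriv P.b2 y - P.s : ℝ) : ℂ) * W y 1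
      - P.D21 y * W y 4 - P.E21 y * deriv W y 4)
    (deriv W x 2 - lam * W x 1) x
  eq_φ : ∀ x, deriv W x 3 = W x 4
  eq_φ' : ∀ x, deriv W x 4 = P.poissonCoeff x * W x 0
    + ((deriv P.φ x / P.v x : ℝ) : ℂ) * deriv W x 0
    + ((P.v x ^ 2 * Real.exp (P.φ x) / P.ε ^ 2 : ℝ) : ℂ) * W x 3
    + ((deriv P.v x / P.v x : ℝ) : ℂ) * W x 4

/-- The derivative of the profile in the coordinates of the first-order system. -/
def W0 (x : ℝ) : Fin 5 → ℂ :=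
  fun i => ((![deriv P.v x, deriv P.u x,
    deriv (fun y => P.b1 y * deriv P.v y + P.b2 y * deriv P.u y) x,
    deriv P.φ x, deriv (deriv P.φ) x] i : ℝ) : ℂ)

/-- The solutions at spectral parameter zero that decay exponentially as `x → +∞`
(the span of the fast decaying modes there). -/
def fastPlus : Set (ℝ → Fin 5 → ℂ) :=
  {W | P.IsModeSolution 0 W ∧
    ∃ C θ : ℝ, 0 < θ ∧ ∀ x, 0 ≤ x → ‖W x‖ ≤ C * Real.exp (-θ * x)}

/-- The solutions at spectral parameter zero that decay exponentially as `x → -∞`. -/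
def fastMinus : Set (ℝ → Fin 5 → ℂ) :=
  {W | P.IsModeSolution 0 W ∧
    ∃ C θ : ℝ, 0 < θ ∧ ∀ x, x ≤ 0 → ‖W x‖ ≤ C * Real.exp (θ * x)}

/-- `W₀, w` form a basis of the set of solutions `S` (in particular `S` is a linear space of
dimension two containing the profile derivative `W₀`). -/
def CompletesBasis (S : Set (ℝ → Fin 5 → ℂ)) (w : ℝ → Fin 5 → ℂ) : Prop :=
  LinearIndependent ℂ ![P.W0, w] ∧ (Submodule.span ℂ {P.W0, w} : Set (ℝ → Fin 5 → ℂ)) = S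

/-- The change of coordinates `R(x)`, with `R W = (ũ, B U' + A U, φ, φ')`. -/
def R (x : ℝ) : Matrix (Fin 5) (Fin 5) ℝ :=
  !![P.b1 x, P.b2 x, 0, 0, 0;
     P.A x 0 0, P.A x 0 1, 0, 0, 0;
     P.A x 1 0 - deriv P.b1 x, P.A x 1 1 - deriv P.b2 x, 1, 0, 0;
     0, 0, 0, 1, 0;
     0, 0, 0, 0, 1]

/-- `ζ = R(0) W(0)`. -/
def zeta (W : ℝ → Fin 5 → ℂ) : Fin 5 → ℂ :=
  ((P.R 0).map (fun r : ℝ => (r : ℂ))).mulVec (W 0)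

/-- The transversality coefficient `Γ` formed with the fast modes `φ2` (at `+∞`) and `φ4`
(at `-∞`) complementing `W₀`. The prefactor is `a₂⁻ / det R(0)`, where
`a₂⁻ = s + √((T+1)/vm²)` is the larger eigenvalue of the limit of `A` at `-∞`. -/
def Gam (vm : ℝ) (φ2 φ4 : ℝ → Fin 5 → ℂ) : ℂ :=
  ((P.s + Real.sqrt ((P.T + 1) / vm ^ 2) : ℝ) : ℂ) / (((P.R 0).det : ℝ) : ℂ) *
    Matrix.det !![P.zeta φ2 0, P.zeta P.W0 0, P.zeta φ4 0;
                  P.zeta φ2 3, P.zeta P.W0 3, P.zeta φ4 3;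
                  P.zeta φ2 4, P.zeta P.W0 4, P.zeta φ4 4]

/-- The reduced three-dimensional variational equation for `V = (u, φ, φ')`: the relations
of the first-order system at spectral parameter zero, in which `v` is replaced by `-u/s` and
`ũ'` by `(b₁' - A₂₁) v + (b₂' - s) u - D₂₁ φ' - E₂₁ φ''`. -/
structure IsReducedSolution (V : ℝ → Fin 3 → ℂ) : Prop where
  differentiable : Differentiable ℝ V
  eq_u : ∀ x, deriv V x 0 = 1 / P.b2 x *
    ((((deriv P.b1 x - P.A21 x : ℝ) : ℂ) * (-1 / P.s * V x 0)
        + ((deriv P.b2 x - P.s : ℝ) : ℂ) * V x 0 - P.D21 x * V x 2 - P.E21 x * deriv V x 2)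
      - deriv P.b1 x * (-1 / P.s * V x 0) - P.b1 x * (-1 / P.s * deriv V x 0)
      - deriv P.b2 x * V x 0)
  eq_φ : ∀ x, deriv V x 1 = V x 2
  eq_φ' : ∀ x, deriv V x 2 = P.poissonCoeff x * (-1 / P.s * V x 0)
    + ((deriv P.φ x / P.v x : ℝ) : ℂ) * (-1 / P.s * deriv V x 0)
    + ((P.v x ^ 2 * Real.exp (P.φ x) / P.ε ^ 2 : ℝ) : ℂ) * V x 1
    + ((deriv P.v x / P.v x : ℝ) : ℂ) * V x 2

/-- The solutions of the reduced variational equation that are bounded on `ℝ`. -/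
def boundedReduced : Set (ℝ → Fin 3 → ℂ) :=
  {V | P.IsReducedSolution V ∧ ∃ C : ℝ, ∀ x, ‖V x‖ ≤ C}

/-- The profile derivative `(u', φ', φ'')`. -/
def V0 (x : ℝ) : Fin 3 → ℂ :=
  fun i => ((![deriv P.u x, deriv P.φ x, deriv (deriv P.φ) x] i : ℝ) : ℂ)

end Wave

end NSP

end

noncomputable section

open Filter Topology Asymptotics

/-! ### Linear equations with bounded coefficients on the whole line. -/

namespace LinODE

variable {E : Type*} [NormedAddCommGroup E] [NormedSpace ℂ E]

/-! The profile equations integrate once: by Poisson's law `φ' / v` is the derivative of `exp φ - ε²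
y² / 2`, where `y = φ' / v` is the field. The profile is therefore an orbit of a three-dimensional
system in `(log v, φ, y)`. Its linearization `Z' = linGen Z`, with `Z = (m, f, Y)`, contains the
whole problem. The reduced variational equation is the same equation in other variables. The
five-dimensional system at spectral parameter zero has two first integrals, which vanish on every
solution tending to `0` at one end, so its fast modes are exactly the images under `toMode` of the
solutions bounded at that end.

Let `A` and `B` be the spaces of solutions bounded at `+∞` and at `-∞`, and let `C ⊆ B` be the space
of those that are `O(exp (η x))` at `-∞`. If `A` and `B` are planes, `C` is a line and `A ∩ C = 0`,
then `A ∩ B` has dimension at most one. It contains the profile derivative, so it is spanned by it,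
and `A + B` is the full three-dimensional solution space (`inf_eq_span_and_finrank_sup`). The first
fact is the statement on bounded solutions. The second says that the three modes in `Γ` have
independent values at `0`, which is `Γ ≠ 0` (`Gam_toMode_ne_zero`).

These four facts come from indefinite quadratic forms which grow at a rate at least `c |Z|²` along
solutions. The values of bounded solutions form a space whose dimension is that of a maximal
nonpositive subspace (`Expands.finrank_boundedAlong`), and bounded solutions decay exponentially.
One family, `form ε b σ`, suffices. With `r = m + f` and `z = m + b ε² Y`, its quadratic form is `r
Y + b ε² Y² / 2 - σ z²`. The part without `z` controls the two fast directions. The quantity `z` is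
conserved by the frozen equation at a sonic state and evolves by `z' = γ m` near it, so the sign `σ`
has to oppose that of the slow rate `γ`: `σ = 1` at `+∞` and `σ = -1` at `-∞`.

The weight `exp (-η x)` with fixed `η > 0` makes the slow direction decay, so that `σ = 1` then
works at the sonic state itself. Since a weak profile remains near that state, it works on the
entire line, and this yields both `dim C = 1` and `A ∩ C = 0` (`finrank_fastAtBot_eq_one`,
`disjoint_fastAtBot`). -/

/-- `Z` solves the linear equation `Z' = M Z` on the whole line. -/
def IsSol (M : ℝ → E →L[ℂ] E) (Z : ℝ → E) : Prop := ∀ x, HasDerivAt Z (M x (Z x)) x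

/-- The linear space of solutions of `Z' = M Z`. -/
def Sol (M : ℝ → E →L[ℂ] E) : Submodule ℂ (ℝ → E) where
  carrier := {Z | IsSol M Z}
  add_mem' {a b} ha hb := fun x => by simpa using (ha x).add (hb x)
  zero_mem' := fun x => by simp
  smul_mem' c a ha := fun x => by simpa using (ha x).const_smul c

/-- Integrating the weight `cosh (L t)` gains a factor `1 / L`, because `|sinh| ≤ cosh`. This gain
makes the Picard operator a contraction on all of `ℝ` at once. -/
theorem norm_integral_cosh_le {F : ℝ → E} {L C : ℝ} (hL : 0 < L) (hC : 0 ≤ C)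
    (h : ∀ t, ‖F t‖ ≤ C * Real.cosh (L * t)) (x : ℝ) :
    ‖∫ t in (0 : ℝ)..x, F t‖ ≤ C / L * Real.cosh (L * x) := by
  have hd : ∀ t, HasDerivAt (fun t => C / L * Real.sinh (L * t)) (C * Real.cosh (L * t)) t := by
    intro t
    have h1 : HasDerivAt (fun t : ℝ => L * t) L t := by
      simpa using (hasDerivAt_id t).const_mul L
    have h2 := (h1.sinh).const_mul (C / L)
    have h3 : C / L * (Real.cosh (L * t) * L) = C * Real.cosh (L * t) := by field_simp
    rwa [h3] at h2
  have hc : Continuous fun t : ℝ => C * Real.cosh (L * t) := by fun_prop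
  have h1 : ‖∫ t in (0 : ℝ)..x, F t‖ ≤ |∫ t in (0 : ℝ)..x, C * Real.cosh (L * t)| :=
    intervalIntegral.norm_integral_le_abs_of_norm_le (Eventually.of_forall h)
      (hc.intervalIntegrable _ _)
  rw [intervalIntegral.integral_eq_sub_of_hasDerivAt (fun t _ => hd t)
    (hc.intervalIntegrable _ _)] at h1
  refine h1.trans ?_
  have h3 : |Real.sinh (L * x)| ≤ Real.cosh (L * x) := by
    rw [abs_le]
    constructor
    · have := Real.exp_pos (L * x)
      have h := Real.cosh_add_sinh (L * x)
      linarith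
    · exact (Real.sinh_lt_cosh _).le
  simp only [mul_zero, Real.sinh_zero, sub_zero, abs_mul, abs_of_nonneg (div_nonneg hC hL.le)]
  gcongr

theorem IsSol.ext {M : ℝ → E →L[ℂ] E} {K : ℝ} (hK : ∀ x, ‖M x‖ ≤ K) {Y Z : ℝ → E}
    (hY : IsSol M Y) (hZ : IsSol M Z) {t : ℝ} (h : Y t = Z t) : Y = Z := by
  have hK0 : 0 ≤ K := (norm_nonneg _).trans (hK 0)
  refine ODE_solution_unique_univ (v := fun x y => M x y) (s := fun _ => Set.univ)
    (K := ⟨K, hK0⟩) (t₀ := t) ?_ (fun x => ⟨hY x, trivial⟩) (fun x => ⟨hZ x, trivial⟩) h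
  intro x
  refine LipschitzWith.lipschitzOnWith ?_
  exact (M x).lipschitz.weaken (hK x)

theorem IsSol.comp_add {M : ℝ → E →L[ℂ] E} {Z : ℝ → E} (h : IsSol M Z) (a : ℝ) :
    IsSol (fun x => M (x + a)) (fun x => Z (x + a)) := fun x => (h (x + a)).comp_add_const x a

variable [FiniteDimensional ℂ E]

/-- Picard iteration in a sup norm weighted by `cosh (L x)` contracts globally, so no local
solutions have to be glued. The unknown `g` of the fixed-point problem is the solution divided by
the weight. -/
theorem exists_isSol {M : ℝ → E →L[ℂ] E} (hM : Continuous M) {K : ℝ} (hK : ∀ x, ‖M x‖ ≤ K)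
    (z : E) : ∃ Z, Z 0 = z ∧ IsSol M Z := by
  have : CompleteSpace E := FiniteDimensional.complete ℂ E
  have hK0 : 0 ≤ K := (norm_nonneg _).trans (hK 0)
  -- The Lipschitz constant of the weighted operator is `K / L`, which is at most `1 / 2` for this
  -- `L`; the `+ 1` keeps `L` positive when `K = 0`.
  set L : ℝ := 2 * K + 1 with hL
  have hL0 : 0 < L := by positivity
  let w : ℝ → ℝ := fun x => Real.cosh (L * x)
  have hw : ∀ x, 1 ≤ w x := fun x => Real.one_le_cosh _
  have hw0 : ∀ x, 0 < w x := fun x => Real.cosh_pos _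
  have hwc : Continuous w := by fun_prop
  let F : BoundedContinuousFunction ℝ E → ℝ → E := fun g t => (w t) • M t (g t)
  have hFc : ∀ g, Continuous (F g) := fun g => hwc.smul (hM.clm_apply g.continuous)
  have hFd : ∀ g h t, ‖F g t - F h t‖ ≤ K * dist g h * Real.cosh (L * t) := by
    intro g h t
    have h1 : F g t - F h t = w t • M t (g t - h t) := by simp [F, smul_sub]
    rw [h1, norm_smul, Real.norm_of_nonneg (hw0 t).le, mul_comm]
    refine mul_le_mul_of_nonneg_right ?_ (hw0 t).le
    refine ((M t).le_opNorm _).trans ?_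
    refine mul_le_mul (hK t) ?_ (norm_nonneg _) hK0
    rw [← dist_eq_norm]
    exact BoundedContinuousFunction.dist_coe_le_dist t
  have hF0 : F 0 = 0 := by ext t; simp [F]
  have hFb : ∀ g t, ‖F g t‖ ≤ K * ‖g‖ * Real.cosh (L * t) := by
    intro g t
    simpa [hF0] using hFd g 0 t
  have hint : ∀ g, Continuous fun x => ∫ t in (0 : ℝ)..x, F g t := fun g =>
    intervalIntegral.continuous_primitive (fun a b => (hFc g).intervalIntegrable a b) 0
  let T : BoundedContinuousFunction ℝ E → BoundedContinuousFunction ℝ E := fun g =>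
    BoundedContinuousFunction.ofNormedAddCommGroup
      (fun x => (w x)⁻¹ • (z + ∫ t in (0 : ℝ)..x, F g t))
      ((hwc.inv₀ fun x => (hw0 x).ne').smul (continuous_const.add (hint g)))
      (‖z‖ + K * ‖g‖ / L) (by
        intro x
        rw [norm_smul, norm_inv, Real.norm_of_nonneg (hw0 x).le, inv_mul_le_iff₀ (hw0 x)]
        refine (norm_add_le _ _).trans ?_
        have h1 := norm_integral_cosh_le hL0 (by positivity) (hFb g) x
        have h2 := le_mul_of_one_le_right (norm_nonneg z) (hw x)
        have : w x = Real.cosh (L * x) := rfl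
        rw [this] at *
        linarith)
  have hT : ContractingWith (1 / 2) T := by
    refine ⟨by rw [← NNReal.coe_lt_coe]; norm_num, LipschitzWith.of_dist_le_mul fun g h => ?_⟩
    refine (BoundedContinuousFunction.dist_le (by positivity)).2 fun x => ?_
    rw [dist_eq_norm]
    have h1 : T g x - T h x = (w x)⁻¹ • ∫ t in (0 : ℝ)..x, (F g t - F h t) := by
      rw [intervalIntegral.integral_sub ((hFc g).intervalIntegrable _ _)
        ((hFc h).intervalIntegrable _ _)]
      simp only [T, BoundedContinuousFunction.coe_ofNormedAddCommGroup]
      rw [← smul_sub]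
      congr 1
      abel
    rw [h1, norm_smul, norm_inv, Real.norm_of_nonneg (hw0 x).le, inv_mul_le_iff₀ (hw0 x)]
    refine (norm_integral_cosh_le hL0 (by positivity) (hFd g h) x).trans ?_
    rw [mul_comm]
    refine mul_le_mul_of_nonneg_left ?_ (hw0 x).le
    rw [div_le_iff₀ hL0]
    have := dist_nonneg (x := g) (y := h)
    simp only [NNReal.coe_div, NNReal.coe_one, NNReal.coe_ofNat]
    nlinarith
  have hfix := hT.fixedPoint_isFixedPt
  set g := ContractingWith.fixedPoint T hT
  have hg : ∀ x, w x • g x = z + ∫ t in (0 : ℝ)..x, F g t := by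
    intro x
    have : T g x = g x := by rw [hfix]
    rw [← this]
    simp only [T, BoundedContinuousFunction.coe_ofNormedAddCommGroup]
    rw [smul_smul, mul_inv_cancel₀ (hw0 x).ne', one_smul]
  refine ⟨fun x => w x • g x, by simp [hg], fun x => ?_⟩
  have h1 : (fun x => w x • g x) = fun x => z + ∫ t in (0 : ℝ)..x, F g t := funext hg
  have h2 : M x (w x • g x) = F g x := by simp [F]
  simp only [h2]
  rw [h1]
  exact ((hFc g).integral_hasStrictDerivAt 0 x).hasDerivAt.const_add z

theorem exists_isSol_at {M : ℝ → E →L[ℂ] E} (hM : Continuous M) {K : ℝ} (hK : ∀ x, ‖M x‖ ≤ K)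
    (a : ℝ) (z : E) : ∃ Z, Z a = z ∧ IsSol M Z := by
  obtain ⟨Z, hZ, hs⟩ := exists_isSol (M := fun x => M (x + a)) (by fun_prop) (fun x => hK _) z
  refine ⟨fun x => Z (x + (-a)), by simpa using hZ, ?_⟩
  simpa using hs.comp_add (-a)

/-- Evaluation at a point identifies the solution space with the phase space. -/
def evalEquiv {M : ℝ → E →L[ℂ] E} (hM : Continuous M) {K : ℝ} (hK : ∀ x, ‖M x‖ ≤ K) (a : ℝ) :
    Sol M ≃ₗ[ℂ] E :=
  LinearEquiv.ofBijective ((LinearMap.proj (R := ℂ) a).comp (Sol M).subtype) <| by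
    constructor
    · intro Y Z h
      exact Subtype.ext (IsSol.ext hK Y.2 Z.2 h)
    · intro z
      obtain ⟨Z, hZ, hs⟩ := exists_isSol_at hM hK a z
      exact ⟨⟨Z, hs⟩, hZ⟩

theorem evalEquiv_apply {M : ℝ → E →L[ℂ] E} (hM : Continuous M) {K : ℝ} (hK : ∀ x, ‖M x‖ ≤ K)
    (a : ℝ) (Z : Sol M) : evalEquiv hM hK a Z = (Z : ℝ → E) a := rfl

end LinODE

/-! ### Quadratic forms that grow along solutions. -/

namespace LinODE

theorem tendsto_atTop_of_deriv_ge {f f' : ℝ → ℝ} (hf : ∀ x, HasDerivAt f (f' x) x) {N d : ℝ}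
    (hd : 0 < d) (h : ∀ x, N ≤ x → d ≤ f' x) : Tendsto f atTop atTop := by
  have h1 : ∀ x, N ≤ x → f N + d * (x - N) ≤ f x := by
    intro x hx
    have := (convex_Ici N).mul_sub_le_image_sub_of_le_deriv (f := f) (C := d)
      (fun x _ => (hf x).continuousAt.continuousWithinAt)
      (fun x _ => (hf x).differentiableAt.differentiableWithinAt)
      (fun x hx => by
        rw [interior_Ici] at hx
        rw [(hf x).deriv]
        exact h x (le_of_lt hx)) N Set.self_mem_Ici x hx hx
    linarith
  refine tendsto_atTop_mono' atTop (eventually_atTop.2 ⟨N, h1⟩) ?_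
  refine tendsto_atTop_add_const_left _ _ (Tendsto.const_mul_atTop hd ?_)
  exact tendsto_atTop_add_const_right _ _ tendsto_id

theorem monotoneOn_Ici_of_deriv_nonneg {f f' : ℝ → ℝ} (hf : ∀ x, HasDerivAt f (f' x) x) {N : ℝ}
    (h : ∀ x, N ≤ x → 0 ≤ f' x) : MonotoneOn f (Set.Ici N) := by
  refine monotoneOn_of_deriv_nonneg (convex_Ici N)
    (fun x _ => (hf x).continuousAt.continuousWithinAt)
    (fun x _ => (hf x).differentiableAt.differentiableWithinAt) fun x hx => ?_
  rw [interior_Ici] at hx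
  rw [(hf x).deriv]
  exact h x (le_of_lt hx)

variable {E : Type*} [NormedAddCommGroup E] [NormedSpace ℂ E]

theorem IsSol.hasDerivAt_form {M : ℝ → E →L[ℂ] E} {Z : ℝ → E} (hZ : IsSol M Z)
    {B : E →L[ℝ] E →L[ℝ] ℝ} (hB : ∀ v w, B v w = B w v) (x : ℝ) :
    HasDerivAt (fun x => B (Z x) (Z x)) (2 * B (Z x) (M x (Z x))) x := by
  have h1 : HasDerivAt (fun x => B (Z x)) (B (M x (Z x))) x :=
    B.hasFDerivAt.comp_hasDerivAt x (hZ x)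
  have h2 := h1.clm_apply (hZ x)
  rw [hB (M x (Z x)) (Z x), ← two_mul] at h2
  exact h2

theorem form_le_norm_sq (B : E →L[ℝ] E →L[ℝ] ℝ) (v w : E) : |B v w| ≤ ‖B‖ * ‖v‖ * ‖w‖ :=
  B.le_opNorm₂ v w

/-- The `+ 1` leaves a positive constant to divide by even if `B = 0`. -/
theorem form_self_le (B : E →L[ℝ] E →L[ℝ] ℝ) (v : E) : |B v v| ≤ (‖B‖ + 1) * ‖v‖ ^ 2 := by
  refine (form_le_norm_sq B v v).trans ?_
  nlinarith [sq_nonneg ‖v‖]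

/-- The quadratic form `B` increases at a quadratic rate along `Z' = M Z` on `[N, ∞)`. -/
def Expands (M : ℝ → E →L[ℂ] E) (B : E →L[ℝ] E →L[ℝ] ℝ) (c N : ℝ) : Prop :=
  ∀ x, N ≤ x → ∀ v, c * ‖v‖ ^ 2 ≤ B v (M x v)

theorem Expands.monotoneOn {M : ℝ → E →L[ℂ] E} {B : E →L[ℝ] E →L[ℝ] ℝ} {c N : ℝ}
    (h : Expands M B c N) (hc : 0 ≤ c) (hB : ∀ v w, B v w = B w v) {Z : ℝ → E} (hZ : IsSol M Z) :
    MonotoneOn (fun x => B (Z x) (Z x)) (Set.Ici N) :=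
  monotoneOn_Ici_of_deriv_nonneg (hZ.hasDerivAt_form hB) fun x hx => by
    have := h x hx (Z x)
    have : 0 ≤ c * ‖Z x‖ ^ 2 := by positivity
    linarith

/-- A solution that stays away from `0` drives the form up at least linearly, which is incompatible
with an upper bound on the form. -/
theorem Expands.not_bddBelow_norm {M : ℝ → E →L[ℂ] E} {B : E →L[ℝ] E →L[ℝ] ℝ} {c N : ℝ}
    (h : Expands M B c N) (hc : 0 < c) (hB : ∀ v w, B v w = B w v) {Z : ℝ → E} (hZ : IsSol M Z)
    {C : ℝ} (hC : ∀ᶠ x in atTop, B (Z x) (Z x) ≤ C) {N' ρ : ℝ} (hN : N ≤ N') (hρ : 0 < ρ)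
    (h' : ∀ x, N' ≤ x → ρ ≤ ‖Z x‖ ^ 2) : False := by
  have h1 := tendsto_atTop_of_deriv_ge (hZ.hasDerivAt_form hB) (N := N') (d := 2 * (c * ρ))
    (by positivity) fun x hx => by
      have h2 := h x (hN.trans hx) (Z x)
      have h3 := mul_le_mul_of_nonneg_left (h' x hx) hc.le
      linarith
  obtain ⟨x, hx1, hx2⟩ := (hC.and (h1.eventually_gt_atTop C)).exists
  exact absurd hx1 (not_le.2 hx2)

/-- Once the form is positive it stays above that value, so the solution stays away from `0` and the
form tends to infinity; a bounded solution does not allow this. -/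
theorem Expands.form_nonpos_of_isBigO {M : ℝ → E →L[ℂ] E} {B : E →L[ℝ] E →L[ℝ] ℝ} {c N : ℝ}
    (h : Expands M B c N) (hc : 0 < c) (hB : ∀ v w, B v w = B w v) {Z : ℝ → E} (hZ : IsSol M Z)
    (hb : Z =O[atTop] (fun _ => (1 : ℝ))) (x : ℝ) (hx : N ≤ x) : B (Z x) (Z x) ≤ 0 := by
  by_contra! hq
  obtain ⟨C, hC⟩ := hb.bound
  refine h.not_bddBelow_norm hc hB hZ (C := (‖B‖ + 1) * C ^ 2) ?_ hx
    (ρ := B (Z x) (Z x) / (‖B‖ + 1)) (by positivity) ?_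
  · filter_upwards [hC] with y hy
    have h1 := (le_abs_self _).trans (form_self_le B (Z y))
    simp only [norm_one, mul_one] at hy
    refine h1.trans ?_
    gcongr
  · intro y hy
    have h1 := h.monotoneOn hc.le hB hZ (Set.mem_Ici.2 hx) (Set.mem_Ici.2 (hx.trans hy)) hy
    have h2 := (le_abs_self _).trans (form_self_le B (Z y))
    rw [div_le_iff₀ (by positivity)]
    simp only at h1
    linarith

variable [FiniteDimensional ℂ E]

/-- A finite-dimensional space carries a continuous symmetric form dominating the norm. -/
theorem exists_form_ge_norm (E : Type*) [NormedAddCommGroup E] [NormedSpace ℂ E]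
    [FiniteDimensional ℂ E] :
    ∃ B : E →L[ℝ] E →L[ℝ] ℝ, (∀ v w, B v w = B w v) ∧ ∀ v, ‖v‖ ^ 2 ≤ B v v := by
  have : FiniteDimensional ℝ E := FiniteDimensional.complexToReal E
  let e := toEuclidean (E := E)
  let B0 : E →L[ℝ] E →L[ℝ] ℝ := (innerSL ℝ).bilinearComp e.toContinuousLinearMap e.toContinuousLinearMap
  let k : ℝ := ‖e.symm.toContinuousLinearMap‖ ^ 2
  have hB0 : ∀ v w, B0 v w = inner ℝ (e v) (e w) := fun v w => rfl
  refine ⟨k • B0, fun v w => ?_, fun v => ?_⟩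
  · simp only [smul_apply, hB0, real_inner_comm]
  · simp only [smul_apply, hB0, real_inner_self_eq_norm_sq, smul_eq_mul, k]
    have h1 := e.symm.toContinuousLinearMap.le_opNorm (e v)
    simp only [ContinuousLinearEquiv.coe_coe, ContinuousLinearEquiv.symm_apply_apply] at h1
    rw [← mul_pow]
    gcongr

/-- Expansion is an open condition, so `B` may be replaced by `B + κ B0` with `B0` positive definite
and still be nondecreasing. If the perturbed form became positive while `B ≤ 0`, then `B0`, and with
it the norm, would stay bounded below. Hence the perturbed form is nonpositive as well, which is the
coercive bound. -/
theorem Expands.exists_norm_sq_le {M : ℝ → E →L[ℂ] E} {K : ℝ} (hK : ∀ x, ‖M x‖ ≤ K)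
    {B : E →L[ℝ] E →L[ℝ] ℝ} {c N : ℝ} (h : Expands M B c N) (hc : 0 < c)
    (hB : ∀ v w, B v w = B w v) : ∃ κ > 0, ∀ Z : ℝ → E, IsSol M Z →
      (∀ x, N ≤ x → B (Z x) (Z x) ≤ 0) → ∀ x, N ≤ x → κ * ‖Z x‖ ^ 2 ≤ -B (Z x) (Z x) := by
  obtain ⟨B0, hs0, hB0⟩ := exists_form_ge_norm E
  have hK0 : 0 ≤ K := (norm_nonneg _).trans (hK 0)
  -- This is the size at which the rate of change of `κ B0` is at most the full gain `c ‖v‖²`;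
  -- monotonicity with constant `0` is all that is needed afterwards.
  set κ : ℝ := c / ((‖B0‖ + 1) * (K + 1)) with hκ
  have hκ0 : 0 < κ := by positivity
  have hB1 : ∀ v w, (B + κ • B0) v w = (B + κ • B0) w v := fun v w => by simp [hB v w, hs0 v w]
  have hE : Expands M (B + κ • B0) 0 N := by
    intro x hx v
    have h1 := h x hx v
    have h2 := form_le_norm_sq B0 v (M x v)
    have h3 : ‖M x v‖ ≤ K * ‖v‖ := ((M x).le_opNorm v).trans (by gcongr; exact hK x)
    have h4 : ‖B0‖ * ‖v‖ * ‖M x v‖ ≤ (‖B0‖ + 1) * ‖v‖ * ((K + 1) * ‖v‖) := by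
      refine mul_le_mul (by gcongr; linarith) (h3.trans (by gcongr; linarith)) (by positivity)
        (by positivity)
    have h5 : κ * ((‖B0‖ + 1) * ‖v‖ * ((K + 1) * ‖v‖)) = c * ‖v‖ ^ 2 := by
      rw [hκ]; field_simp
    have h6 : -(B0 v (M x v)) ≤ (‖B0‖ + 1) * ‖v‖ * ((K + 1) * ‖v‖) :=
      (neg_le_abs _).trans (h2.trans h4)
    have h7 := mul_le_mul_of_nonneg_left h6 hκ0.le
    simp only [add_apply, smul_apply, smul_eq_mul]
    linarith
  refine ⟨κ, hκ0, fun Z hZ hneg x hx => ?_⟩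
  have key : (B + κ • B0) (Z x) (Z x) ≤ 0 := by
    by_contra! hq
    refine h.not_bddBelow_norm hc hB hZ (C := 0) (eventually_atTop.2 ⟨N, hneg⟩) hx
      (ρ := (B + κ • B0) (Z x) (Z x) / (κ * (‖B0‖ + 1))) (by positivity) fun y hy => ?_
    have h1 := hE.monotoneOn le_rfl hB1 hZ (Set.mem_Ici.2 hx) (Set.mem_Ici.2 (hx.trans hy)) hy
    have h2 := (le_abs_self _).trans (form_self_le B0 (Z y))
    have h3 := hneg y (hx.trans hy)
    have h4 := mul_le_mul_of_nonneg_left h2 hκ0.le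
    rw [div_le_iff₀ (by positivity)]
    simp only [add_apply, smul_apply, smul_eq_mul]
      at h1 ⊢
    linarith
  have h1 := mul_le_mul_of_nonneg_left (hB0 (Z x)) hκ0.le
  simp only [add_apply, smul_apply, smul_eq_mul] at key
  linarith

/-- The quadratic gain dominates a multiple of `|B|`, so `B` times a growing exponential is still
nondecreasing and `-B` decays exponentially. Coercivity of `-B` transfers the decay to the norm. -/
theorem Expands.exp_decay {M : ℝ → E →L[ℂ] E} {K : ℝ} (hK : ∀ x, ‖M x‖ ≤ K)
    {B : E →L[ℝ] E →L[ℝ] ℝ} {c N : ℝ} (h : Expands M B c N) (hc : 0 < c)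
    (hB : ∀ v w, B v w = B w v) : ∃ θ > 0, ∀ Z : ℝ → E, IsSol M Z →
      (∀ x, N ≤ x → B (Z x) (Z x) ≤ 0) → Z =O[atTop] (fun x => Real.exp (-θ * x)) := by
  obtain ⟨κ, hκ, hle⟩ := h.exists_norm_sq_le hK hc hB
  -- With this rate `θ |B(v, v)| ≤ c ‖v‖²`, so the weighted form has nonnegative derivative.
  set θ : ℝ := c / (‖B‖ + 1) with hθ
  have hθ0 : 0 < θ := by positivity
  refine ⟨θ, hθ0, fun Z hZ hneg => ?_⟩
  have hd : ∀ x, HasDerivAt (fun x => B (Z x) (Z x) * Real.exp (2 * θ * x))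
      (2 * B (Z x) (M x (Z x)) * Real.exp (2 * θ * x)
        + B (Z x) (Z x) * (Real.exp (2 * θ * x) * (2 * θ))) x := fun x =>
    (hZ.hasDerivAt_form hB x).mul (by
      simpa using ((hasDerivAt_id x).const_mul (2 * θ)).exp)
  have hmono := monotoneOn_Ici_of_deriv_nonneg hd (N := N) fun x hx => by
    have h1 := h x hx (Z x)
    have h2 := (neg_le_abs _).trans (form_self_le B (Z x))
    have h3 := mul_le_mul_of_nonneg_left h2 hθ0.le
    have h4 : θ * ((‖B‖ + 1) * ‖Z x‖ ^ 2) = c * ‖Z x‖ ^ 2 := by rw [hθ]; field_simp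
    have h5 : 0 ≤ B (Z x) (M x (Z x)) + B (Z x) (Z x) * θ := by linarith
    have h6 := Real.exp_pos (2 * θ * x)
    have := mul_nonneg h5 h6.le
    linarith
  set q : ℝ := -(B (Z N) (Z N) * Real.exp (2 * θ * N)) with hq
  refine IsBigO.of_bound (Real.sqrt (q / κ)) (eventually_atTop.2 ⟨N, fun x hx => ?_⟩)
  have h1 := hmono (Set.mem_Ici.2 le_rfl) (Set.mem_Ici.2 hx) hx
  simp only at h1
  have h2 := hle Z hZ hneg x hx
  have h3 : ‖Z x‖ ^ 2 ≤ q / κ * Real.exp (-θ * x) ^ 2 := by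
    have h4 : Real.exp (-θ * x) ^ 2 * Real.exp (2 * θ * x) = 1 := by
      rw [← Real.exp_nat_mul, ← Real.exp_add]; simp; ring
    have h5 := Real.exp_pos (2 * θ * x)
    have h6 : κ * ‖Z x‖ ^ 2 * Real.exp (2 * θ * x) ≤ q := by
      have := mul_le_mul_of_nonneg_right h2 h5.le
      linarith
    rw [← mul_le_mul_iff_of_pos_right h5, mul_assoc (q / κ), h4, mul_one, le_div_iff₀ hκ]
    linarith
  rw [Real.norm_of_nonneg (Real.exp_pos _).le]
  have h7 : 0 ≤ q / κ := by
    have := hneg N le_rfl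
    have h5 := Real.exp_pos (2 * θ * N)
    have : 0 ≤ q := by rw [hq]; nlinarith
    positivity
  refine le_of_sq_le_sq ?_ (by positivity)
  rwa [mul_pow, Real.sq_sqrt h7]

end LinODE

/-! ### Spaces of bounded solutions, and their dimensions. -/

namespace LinODE

variable {E : Type*} [NormedAddCommGroup E] [NormedSpace ℂ E]

/-- The solutions of `Z' = M Z` which are bounded along the filter `l`. -/
def boundedAlong (l : Filter ℝ) (M : ℝ → E →L[ℂ] E) : Submodule ℂ (ℝ → E) where
  carrier := {Z | IsSol M Z ∧ Z =O[l] (fun _ => (1 : ℝ))}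
  add_mem' ha hb := ⟨(Sol M).add_mem ha.1 hb.1, ha.2.add hb.2⟩
  zero_mem' := ⟨(Sol M).zero_mem, isBigO_zero _ _⟩
  smul_mem' c _ ha := ⟨(Sol M).smul_mem c ha.1, ha.2.const_smul_left c⟩

theorem boundedAlong_le_Sol (l : Filter ℝ) (M : ℝ → E →L[ℂ] E) : boundedAlong l M ≤ Sol M :=
  fun _ h => h.1

/-! ### Reflection and exponential weights -/

/-- The generator of the equation satisfied by `x ↦ Z (-x)`. -/
def reflect (M : ℝ → E →L[ℂ] E) : ℝ → E →L[ℂ] E := fun x => -M (-x)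

/-- The generator of the equation satisfied by `x ↦ exp (-η x) Z x`. -/
def weight (η : ℝ) (M : ℝ → E →L[ℂ] E) : ℝ → E →L[ℂ] E := fun x =>
  M x - (η : ℂ) • ContinuousLinearMap.id ℂ E

theorem IsSol.reflect {M : ℝ → E →L[ℂ] E} {Z : ℝ → E} (h : IsSol M Z) :
    IsSol (reflect M) (fun x => Z (-x)) := fun x => by
  simpa [LinODE.reflect, Function.comp_def] using (h (-x)).scomp x (hasDerivAt_neg x)

theorem reflect_reflect (M : ℝ → E →L[ℂ] E) : reflect (reflect M) = M := by
  ext x v; simp [reflect]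

theorem isSol_reflect_iff {M : ℝ → E →L[ℂ] E} {Z : ℝ → E} :
    IsSol (reflect M) (fun x => Z (-x)) ↔ IsSol M Z := by
  refine ⟨fun h => ?_, IsSol.reflect⟩
  simpa [reflect_reflect] using h.reflect

theorem mem_boundedAlong_reflect_iff {M : ℝ → E →L[ℂ] E} {Z : ℝ → E} :
    (fun x => Z (-x)) ∈ boundedAlong atTop (reflect M) ↔ Z ∈ boundedAlong atBot M := by
  refine and_congr isSol_reflect_iff ⟨fun h => ?_, fun h => ?_⟩
  · simpa [Function.comp_def] using h.comp_tendsto tendsto_neg_atBot_atTop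
  · exact h.comp_tendsto tendsto_neg_atTop_atBot

theorem finrank_boundedAlong_reflect (M : ℝ → E →L[ℂ] E) :
    Module.finrank ℂ (boundedAlong atTop (reflect M)) =
      Module.finrank ℂ (boundedAlong atBot M) := by
  let e : (ℝ → E) ≃ₗ[ℂ] (ℝ → E) := LinearEquiv.funCongrLeft ℂ E (Equiv.neg ℝ)
  have he : boundedAlong atTop (reflect M) = (boundedAlong atBot M).map (e : _ →ₗ[ℂ] _) := by
    ext Z
    rw [Submodule.mem_map_equiv, ← mem_boundedAlong_reflect_iff]
    have : (fun x => e.symm Z (-x)) = Z := by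
      ext x
      change Z (- -x) = Z x
      rw [neg_neg]
    rw [this]
  rw [he, LinearEquiv.finrank_map_eq]

theorem continuous_reflect {M : ℝ → E →L[ℂ] E} (hM : Continuous M) : Continuous (reflect M) :=
  (hM.comp continuous_neg).neg

theorem norm_reflect_le {M : ℝ → E →L[ℂ] E} {K : ℝ} (hK : ∀ x, ‖M x‖ ≤ K) (x : ℝ) :
    ‖reflect M x‖ ≤ K := by
  rw [reflect, norm_neg]; exact hK _

theorem continuous_weight {M : ℝ → E →L[ℂ] E} (hM : Continuous M) (η : ℝ) :
    Continuous (weight η M) := hM.sub continuous_const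

theorem norm_weight_le {M : ℝ → E →L[ℂ] E} {K : ℝ} (hK : ∀ x, ‖M x‖ ≤ K) (η x : ℝ) :
    ‖weight η M x‖ ≤ K + ‖(η : ℂ) • ContinuousLinearMap.id ℂ E‖ :=
  (norm_sub_le _ _).trans (by gcongr; exact hK x)

theorem IsSol.weight {M : ℝ → E →L[ℂ] E} {Z : ℝ → E} (h : IsSol M Z) (η : ℝ) :
    IsSol (weight η M) (fun x => (Real.exp (-η * x) : ℂ) • Z x) := fun x => by
  have h1 : HasDerivAt (fun x : ℝ => (Real.exp (-η * x) : ℂ))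
      ((Real.exp (-η * x) * (-η) : ℝ) : ℂ) x := by
    refine HasDerivAt.ofReal_comp ?_
    simpa using ((hasDerivAt_id x).const_mul (-η)).exp
  refine (h1.smul (h x)).congr_deriv ?_
  simp only [LinODE.weight, sub_apply, map_smul, smul_apply, ContinuousLinearMap.id_apply]
  push_cast
  module

theorem weight_weight (M : ℝ → E →L[ℂ] E) (η : ℝ) : weight (-η) (weight η M) = M := by
  ext x v; simp [weight]

theorem isSol_weight_iff {M : ℝ → E →L[ℂ] E} {Z : ℝ → E} (η : ℝ) :
    IsSol (weight η M) (fun x => (Real.exp (-η * x) : ℂ) • Z x) ↔ IsSol M Z := by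
  refine ⟨fun h => ?_, fun h => h.weight η⟩
  have h1 := h.weight (-η)
  rw [weight_weight] at h1
  convert h1 using 2 with x
  rw [smul_smul, ← Complex.ofReal_mul, ← Real.exp_add]
  simp

/-- The solutions of `Z' = M Z` which are `O(exp (η x))` at `-∞`. -/
def fastAtBot (η : ℝ) (M : ℝ → E →L[ℂ] E) : Submodule ℂ (ℝ → E) where
  carrier := {Z | (fun x => (Real.exp (-η * x) : ℂ) • Z x) ∈ boundedAlong atBot (weight η M)}
  add_mem' {a b} ha hb := by
    have := (boundedAlong atBot (weight η M)).add_mem ha hb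
    simpa [Pi.add_def] using this
  zero_mem' := by
    have := (boundedAlong atBot (weight η M)).zero_mem
    simpa [Pi.zero_def] using this
  smul_mem' c a ha := by
    have := (boundedAlong atBot (weight η M)).smul_mem c ha
    simp only [Pi.smul_def, smul_comm c] at this
    exact this

theorem finrank_fastAtBot (η : ℝ) (M : ℝ → E →L[ℂ] E) :
    Module.finrank ℂ (fastAtBot η M) =
      Module.finrank ℂ (boundedAlong atBot (weight η M)) := by
  let e : (ℝ → E) ≃ₗ[ℂ] (ℝ → E) := LinearEquiv.piCongrRight fun x =>
    LinearEquiv.smulOfNeZero ℂ E (Real.exp (-η * x) : ℂ)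
      (Complex.ofReal_ne_zero.2 (Real.exp_pos _).ne')
  have he : fastAtBot η M = (boundedAlong atBot (weight η M)).comap (e : _ →ₗ[ℂ] _) := by
    ext Z; rfl
  rw [he, ← LinearEquiv.finrank_map_eq e,
    Submodule.map_comap_eq_of_surjective (f := (e : (ℝ → E) →ₗ[ℂ] (ℝ → E))) e.surjective]

theorem fastAtBot_le {η : ℝ} (hη : 0 ≤ η) (M : ℝ → E →L[ℂ] E) :
    fastAtBot η M ≤ boundedAlong atBot M := by
  rintro Z ⟨h1, h2⟩
  refine ⟨(isSol_weight_iff η).1 h1, IsBigO.trans (IsBigO.of_bound 1 ?_) h2⟩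
  filter_upwards [eventually_le_atBot 0] with x hx
  rw [norm_smul, one_mul, Complex.norm_real, Real.norm_of_nonneg (Real.exp_pos _).le]
  refine le_mul_of_one_le_left (norm_nonneg _) (Real.one_le_exp (by nlinarith))

/-- A common element, multiplied by `exp (-η x)`, is bounded at both ends. Boundedness at `+∞`
forces the form to be nonpositive everywhere and boundedness at `-∞` forces it to be nonnegative
everywhere. It is therefore constant, and the lower bound on its derivative leaves only the zero
solution. -/
theorem disjoint_fastAtBot {M : ℝ → E →L[ℂ] E} {B : E →L[ℝ] E →L[ℝ] ℝ} {c η : ℝ} (hη : 0 ≤ η)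
    (h : ∀ x v, c * ‖v‖ ^ 2 ≤ B v (weight η M x v)) (hc : 0 < c)
    (hB : ∀ v w, B v w = B w v) : Disjoint (boundedAlong atTop M) (fastAtBot η M) := by
  rw [Submodule.disjoint_def]
  rintro Z ⟨hZ, hZt⟩ hZb
  set Y : ℝ → E := fun x => (Real.exp (-η * x) : ℂ) • Z x with hY
  have hYs : IsSol (weight η M) Y := hZb.1
  have hYt : Y =O[atTop] (fun _ => (1 : ℝ)) := by
    refine IsBigO.trans (IsBigO.of_bound 1 ?_) hZt
    filter_upwards [eventually_ge_atTop 0] with x hx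
    rw [norm_smul, Complex.norm_real, Real.norm_of_nonneg (Real.exp_pos _).le]
    gcongr
    exact Real.exp_le_one_iff.2 (by nlinarith)
  have h1 : ∀ x, B (Y x) (Y x) ≤ 0 := fun x =>
    Expands.form_nonpos_of_isBigO (N := x) (fun y _ v => h y v) hc hB hYs hYt x le_rfl
  have h2 : ∀ x, 0 ≤ B (Y x) (Y x) := fun x => by
    have hr := mem_boundedAlong_reflect_iff.2 hZb
    have := Expands.form_nonpos_of_isBigO (M := reflect (weight η M)) (B := -B) (N := -x)
      (fun y _ v => by simpa [reflect] using h (-y) v) hc (fun v w => by simp [hB v w])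
      hr.1 hr.2 (-x) le_rfl
    simpa [hY] using this
  have h3 : (fun x => B (Y x) (Y x)) = fun _ => 0 := funext fun x => le_antisymm (h1 x) (h2 x)
  have h4 : ∀ x, Y x = 0 := fun x => by
    have h5 := hYs.hasDerivAt_form hB x
    rw [h3] at h5
    have h6 := h5.unique (hasDerivAt_const x 0)
    have h7 := h x (Y x)
    have h8 : ‖Y x‖ ^ 2 ≤ 0 := by
      by_contra! h9
      have := mul_pos hc h9
      linarith
    have h9 : ‖Y x‖ ^ 2 = 0 := le_antisymm h8 (sq_nonneg _)
    simpa using h9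
  funext x
  have := h4 x
  simpa [hY] using this

/-! ### The dimension of the space of bounded solutions -/

variable [FiniteDimensional ℂ E]

/-- The values at `N` of the solutions which are bounded along `l`. -/
def boundedValues (l : Filter ℝ) {M : ℝ → E →L[ℂ] E} (hM : Continuous M) {K : ℝ}
    (hK : ∀ x, ‖M x‖ ≤ K) (N : ℝ) : Submodule ℂ E :=
  ((boundedAlong l M).comap (Sol M).subtype).map (evalEquiv hM hK N : Sol M →ₗ[ℂ] E)

theorem finrank_boundedValues (l : Filter ℝ) {M : ℝ → E →L[ℂ] E} (hM : Continuous M) {K : ℝ}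
    (hK : ∀ x, ‖M x‖ ≤ K) (N : ℝ) :
    Module.finrank ℂ (boundedValues l hM hK N) = Module.finrank ℂ (boundedAlong l M) := by
  rw [boundedValues, LinearEquiv.finrank_map_eq]
  exact (Submodule.comapSubtypeEquivOfLe (boundedAlong_le_Sol l M)).finrank_eq

/-- If a quadratic form expands along `Z' = M Z` near `+∞`, the dimension of the space of solutions
bounded at `+∞` is the dimension of a maximal nonpositive subspace of the form. -/
theorem Expands.finrank_boundedAlong {M : ℝ → E →L[ℂ] E} (hM : Continuous M) {K : ℝ}
    (hK : ∀ x, ‖M x‖ ≤ K) {B : E →L[ℝ] E →L[ℝ] ℝ} {c N : ℝ} (h : Expands M B c N) (hc : 0 < c)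
    (hB : ∀ v w, B v w = B w v) {P P' : Submodule ℂ E} (hP : ∀ v ∈ P, B v v ≤ 0)
    (hP' : ∀ v ∈ P', v ≠ 0 → 0 < B v v)
    (hd : Module.finrank ℂ P + Module.finrank ℂ P' = Module.finrank ℂ E) :
    Module.finrank ℂ (boundedAlong atTop M) = Module.finrank ℂ P := by
  rw [← finrank_boundedValues atTop hM hK N]
  set S := boundedValues atTop hM hK N with hS
  have hS1 : ∀ v ∈ S, B v v ≤ 0 := by
    rintro v ⟨Z, hZ, rfl⟩
    exact h.form_nonpos_of_isBigO hc hB hZ.1 hZ.2 N le_rfl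
  refine le_antisymm ?_ ?_
  -- Upper bound: the form is nonpositive on `S` and positive on `P'` away from `0`, so the two meet
  -- trivially.
  · have hdis : Disjoint S P' := by
      rw [Submodule.disjoint_def]
      intro v hv hv'
      by_contra hne
      exact absurd (hS1 v hv) (not_le.2 (hP' v hv' hne))
    have := Submodule.finrank_add_finrank_le_of_disjoint hdis
    omega
  by_contra! hlt
  -- Lower bound: if `S` were too small, its complement `T` would have to contain a unit vector
  -- whose solution keeps the form nonpositive for all time. Such a solution decays, which would put
  -- the vector in `S`.
  obtain ⟨T, hT⟩ := S.exists_isCompl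
  have hTd := Submodule.finrank_add_eq_of_isCompl hT
  let Φ : ℝ → E ≃ₗ[ℂ] E := fun t => (evalEquiv hM hK N).symm.trans (evalEquiv hM hK t)
  have hΦc : ∀ t, Continuous (Φ t) := fun t =>
    LinearMap.continuous_of_finiteDimensional (Φ t : E →ₗ[ℂ] E)
  have hsol : ∀ v, ∃ Z : Sol M, ∀ t, Φ t v = (Z : ℝ → E) t := fun v =>
    ⟨(evalEquiv hM hK N).symm v, fun t => rfl⟩
  -- Unit vectors of `T` whose solution has nonpositive form at time `N + n`. Monotonicity of the
  -- form makes these compact sets nested, and a point of their intersection has nonpositive form at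
  -- all later times.
  let C : ℕ → Set E := fun n =>
    {v | v ∈ T} ∩ Metric.sphere 0 1 ∩ {v | B (Φ (N + n) v) (Φ (N + n) v) ≤ 0}
  have hTc : IsClosed {v | v ∈ T} := T.closed_of_finiteDimensional
  have hprop : ProperSpace E := FiniteDimensional.proper ℂ E
  have hQc : ∀ n : ℕ, Continuous fun v => B (Φ (N + n) v) (Φ (N + n) v) := fun n =>
    (B.continuous.comp (hΦc _)).clm_apply (hΦc _)
  have hCc : ∀ n, IsCompact (C n) := fun n =>
    (((isCompact_sphere 0 1).inter_left hTc)).inter_right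
      (isClosed_le (hQc n) continuous_const)
  have hmono : ∀ (v : E) (t t' : ℝ), N ≤ t → t ≤ t' →
      B (Φ t v) (Φ t v) ≤ B (Φ t' v) (Φ t' v) := by
    intro v t t' ht htt
    obtain ⟨Z, hZ⟩ := hsol v
    rw [hZ, hZ]
    exact h.monotoneOn hc.le hB Z.2 (Set.mem_Ici.2 ht) (Set.mem_Ici.2 (ht.trans htt)) htt
  have hne : ∀ n, (C n).Nonempty := by
    intro n
    -- Pulling `P` back along the flow from time `N + n` preserves its dimension, and `dim T + dim P
    -- > dim E` forces an intersection.
    have hnd : ¬ Disjoint T (P.map ((Φ (N + n)).symm : E →ₗ[ℂ] E)) := by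
      intro hdis
      have h1 := Submodule.finrank_add_finrank_le_of_disjoint hdis
      rw [LinearEquiv.finrank_map_eq] at h1
      omega
    rw [Submodule.disjoint_def] at hnd
    push Not at hnd
    obtain ⟨v, hvT, ⟨p, hp, hpv⟩, hv0⟩ := hnd
    have hΦp : Φ (N + n) v = p := by rw [← hpv]; exact (Φ (N + n)).apply_symm_apply p
    have hn0 : (‖v‖ : ℂ) ≠ 0 := by simpa using hv0
    refine ⟨(‖v‖ : ℂ)⁻¹ • v, ⟨T.smul_mem _ hvT, ?_⟩, ?_⟩
    · simp [norm_smul, hv0]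
    · simp only [Set.mem_ofPred_eq, map_smul, hΦp]
      exact hP _ (P.smul_mem _ hp)
  have hdec : ∀ n, C (n + 1) ⊆ C n := by
    rintro n v ⟨h1, h2⟩
    refine ⟨h1, le_trans (hmono v _ _ (by simp) ?_) h2⟩
    push_cast
    linarith
  obtain ⟨v, hv⟩ := IsCompact.nonempty_iInter_of_sequence_nonempty_isCompact_isClosed C hdec hne
    (hCc 0) fun n => (hCc n).isClosed
  simp only [Set.mem_iInter] at hv
  have hvS : v ∈ S := by
    obtain ⟨Z, hZ⟩ := hsol v
    have hneg : ∀ x, N ≤ x → B ((Z : ℝ → E) x) ((Z : ℝ → E) x) ≤ 0 := by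
      intro x hx
      obtain ⟨n, hn⟩ := exists_nat_ge (x - N)
      rw [← hZ]
      exact (hmono v x (N + n) hx (by linarith)).trans (hv n).2
    obtain ⟨θ, hθ, hdecay⟩ := h.exp_decay hK hc hB
    refine ⟨Z, ⟨Z.2, (hdecay Z Z.2 hneg).trans ?_⟩, ?_⟩
    · refine IsBigO.of_bound 1 (eventually_atTop.2 ⟨0, fun x hx => ?_⟩)
      rw [Real.norm_of_nonneg (Real.exp_pos _).le]
      simp only [norm_one, mul_one]
      exact Real.exp_le_one_iff.2 (by nlinarith)
    · have := hZ N
      rw [← evalEquiv_apply hM hK N Z] at this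
      simpa [Φ] using this.symm
  have hv1 : ‖v‖ = 1 := by simpa using (hv 0).1.2
  have h0 := (Submodule.disjoint_def.1 hT.disjoint) v hvS (hv 0).1.1
  rw [h0] at hv1
  simp at hv1

/-- Linear algebra of two planes in a three-dimensional space, one of which contains a line
disjoint from the other. -/
theorem inf_eq_span_and_finrank_sup {V : Type*} [AddCommGroup V] [Module ℂ V]
    {A B C : Submodule ℂ V} (hA : Module.finrank ℂ A = 2) (hB : Module.finrank ℂ B = 2)
    (hC : Module.finrank ℂ C = 1) (hCB : C ≤ B) (hAC : Disjoint A C) {z : V} (hz : z ≠ 0)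
    (hzA : z ∈ A) (hzB : z ∈ B) :
    A ⊓ B = Submodule.span ℂ {z} ∧ Module.finrank ℂ (A ⊔ B : Submodule ℂ V) = 3 := by
  have : FiniteDimensional ℂ A := Module.finite_of_finrank_pos (by omega)
  have : FiniteDimensional ℂ B := Module.finite_of_finrank_pos (by omega)
  have : FiniteDimensional ℂ C := Module.finite_of_finrank_pos (by omega)
  have h1 : Submodule.span ℂ {z} ≤ A ⊓ B := by
    rw [Submodule.span_singleton_le_iff_mem]; exact ⟨hzA, hzB⟩
  -- Inside the plane `B`, the intersection `A ⊓ B` misses the line `C`, so it has dimension at most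
  -- one.
  have h2 : Module.finrank ℂ (A ⊓ B : Submodule ℂ V) ≤ 1 := by
    have h3 := Submodule.finrank_sup_add_finrank_inf_eq (A ⊓ B) C
    have h4 : (A ⊓ B) ⊓ C = ⊥ := (hAC.mono_left inf_le_left).eq_bot
    rw [h4, finrank_bot] at h3
    have h5 : Module.finrank ℂ ((A ⊓ B) ⊔ C : Submodule ℂ V) ≤ Module.finrank ℂ B :=
      Submodule.finrank_mono (sup_le inf_le_right hCB)
    omega
  have h3 : Module.finrank ℂ (Submodule.span ℂ {z}) = 1 := finrank_span_singleton hz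
  have h4 := Submodule.eq_of_le_of_finrank_le h1 (by omega)
  refine ⟨h4.symm, ?_⟩
  have h5 := Submodule.finrank_sup_add_finrank_inf_eq A B
  rw [← h4] at h5
  omega

end LinODE

namespace LinODE

/-! ### Perturbation of expanding forms -/

/-- Compactness of the unit sphere turns positivity into a uniform constant, half of which absorbs a
small change of the generator. So it is enough to check expansion for a single limiting generator.
-/
theorem exists_eventually_form_ge {E : Type*} [NormedAddCommGroup E] [NormedSpace ℂ E]
    [FiniteDimensional ℂ E] {B : E →L[ℝ] E →L[ℝ] ℝ} {M₀ : E →L[ℂ] E}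
    (h : ∀ v, v ≠ 0 → 0 < B v (M₀ v)) :
    ∃ c > 0, ∀ᶠ M in 𝓝 M₀, ∀ v, c * ‖v‖ ^ 2 ≤ B v (M v) := by
  have hprop : ProperSpace E := FiniteDimensional.proper ℂ E
  obtain ⟨d, hd, hd'⟩ : ∃ d > 0, ∀ v, d * ‖v‖ ^ 2 ≤ B v (M₀ v) := by
    have hunit : ∃ d > 0, ∀ v ∈ Metric.sphere (0 : E) 1, d ≤ B v (M₀ v) := by
      rcases (Metric.sphere (0 : E) 1).eq_empty_or_nonempty with he | hne
      · exact ⟨1, one_pos, by simp [he]⟩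
      · obtain ⟨w, hw, hmin⟩ := (isCompact_sphere (0 : E) 1).exists_isMinOn hne
          (f := fun v => B v (M₀ v))
          ((B.continuous.clm_apply M₀.continuous).continuousOn)
        refine ⟨B w (M₀ w), h w ?_, fun v hv => hmin hv⟩
        rintro rfl
        simp at hw
    obtain ⟨d, hd, hle⟩ := hunit
    refine ⟨d, hd, fun v => ?_⟩
    rcases eq_or_ne v 0 with rfl | hv
    · simp
    have hn : 0 < ‖v‖ := norm_pos_iff.2 hv
    have h1 := hle ((‖v‖⁻¹ : ℝ) • v) (by simp [norm_smul, hn.ne'])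
    have h2 : M₀ ((‖v‖⁻¹ : ℝ) • v) = (‖v‖⁻¹ : ℝ) • M₀ v :=
      (M₀.restrictScalars ℝ).map_smul _ _
    rw [h2] at h1
    simp only [map_smul, smul_apply, smul_eq_mul] at h1
    have h3 : ‖v‖⁻¹ * (‖v‖⁻¹ * B v (M₀ v)) * ‖v‖ ^ 2 = B v (M₀ v) := by field_simp
    rw [← h3]
    gcongr
  refine ⟨d / 2, by positivity, ?_⟩
  filter_upwards [Metric.ball_mem_nhds M₀ (show 0 < d / (2 * (‖B‖ + 1)) by positivity)]
    with M hM v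
  rw [mem_ball_iff_norm, lt_div_iff₀ (by positivity)] at hM
  have h1 := hd' v
  have h2 := (neg_le_abs _).trans (form_le_norm_sq B v ((M - M₀) v))
  have h3 := (M - M₀).le_opNorm v
  have h4 : ‖B‖ * ‖v‖ * ‖(M - M₀) v‖ ≤ (‖B‖ + 1) * ‖v‖ * (‖M - M₀‖ * ‖v‖) := by
    gcongr
    linarith
  have h5 : (‖B‖ + 1) * ‖v‖ * (‖M - M₀‖ * ‖v‖) ≤ d / 2 * ‖v‖ ^ 2 := by
    nlinarith [sq_nonneg ‖v‖]
  simp only [sub_apply, map_sub] at h2 h4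
  linarith

theorem boundedAlong_atTop_exp_decay {E : Type*} [NormedAddCommGroup E] [NormedSpace ℂ E]
    [FiniteDimensional ℂ E] {M : ℝ → E →L[ℂ] E} {K : ℝ} (hK : ∀ x, ‖M x‖ ≤ K)
    {B : E →L[ℝ] E →L[ℝ] ℝ} {c N : ℝ} (h : Expands M B c N) (hc : 0 < c)
    (hB : ∀ v w, B v w = B w v) :
    ∃ θ > 0, ∀ Z ∈ boundedAlong atTop M, Z =O[atTop] (fun x => Real.exp (-θ * x)) := by
  obtain ⟨θ, hθ, h1⟩ := h.exp_decay hK hc hB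
  exact ⟨θ, hθ, fun Z hZ => h1 Z hZ.1 fun x hx => h.form_nonpos_of_isBigO hc hB hZ.1 hZ.2 x hx⟩

/-! ### The model form in dimension three -/

/-- The phase space of the reduced equation. -/
abbrev Phase := Fin 3 → ℂ

/-- The Hermitian form with quadratic form `Re (r ȳ) + (bε²/2) |y|² - σ |z|²`, where
`r = V₀ + V₁`, `y = V₂`, `z = V₀ + bε² V₂`. -/
def form (ε b σ : ℝ) : Phase →L[ℝ] Phase →L[ℝ] ℝ :=
  let p : Fin 3 → Phase →L[ℝ] ℂ := fun i => ContinuousLinearMap.proj i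
  let r := p 0 + p 1
  let z := p 0 + (b * ε ^ 2) • p 2
  let I : ℂ →L[ℝ] ℂ →L[ℝ] ℝ := innerSL ℝ
  (1 / 2 : ℝ) • (I.bilinearComp r (p 2) + I.bilinearComp (p 2) r)
    + (b * ε ^ 2 / 2) • I.bilinearComp (p 2) (p 2) - σ • I.bilinearComp z z

theorem form_apply (ε b σ : ℝ) (V W : Phase) :
    form ε b σ V W =
      1 / 2 * (((V 0).re + (V 1).re) * (W 2).re + ((V 0).im + (V 1).im) * (W 2).im
        + ((V 2).re * ((W 0).re + (W 1).re) + (V 2).im * ((W 0).im + (W 1).im)))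
      + b * ε ^ 2 / 2 * ((V 2).re * (W 2).re + (V 2).im * (W 2).im)
      - σ * (((V 0).re + b * ε ^ 2 * (V 2).re) * ((W 0).re + b * ε ^ 2 * (W 2).re)
        + ((V 0).im + b * ε ^ 2 * (V 2).im) * ((W 0).im + b * ε ^ 2 * (W 2).im)) := by
  have hI : ∀ a c : ℂ, (innerSL ℝ a) c = a.re * c.re + a.im * c.im := fun a c => by
    rw [innerSL_apply_apply, Complex.inner]; simp [mul_comm]
  simp only [form, sub_apply, add_apply, smul_apply, ContinuousLinearMap.bilinearComp_apply, hI,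
    ContinuousLinearMap.proj_apply, smul_eq_mul, Complex.add_re, Complex.add_im, Complex.smul_re,
    Complex.smul_im]

theorem form_symm (ε b σ : ℝ) (V W : Phase) : form ε b σ V W = form ε b σ W V := by
  rw [form_apply, form_apply]; ring

/-- The matrix of the linearized profile equation in the variables
`(v / v̄, φ, (φ'/v)·)`, for the values `v`, `e`, `y` of `v̄`, `exp φ̄`, `φ̄' / v̄`. -/
def genMatrix (T ν ε : ℝ) (q : ℝ × ℝ × ℝ × ℝ) : Matrix (Fin 3) (Fin 3) ℝ :=
  !![(T / q.2.1 - q.1 ^ 2 * q.2.1) / (q.1 * ν), -q.2.2.1 / (q.1 * ν),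
      ε ^ 2 * q.2.2.2 / (q.1 * ν);
    q.2.1 * q.2.2.2, 0, q.2.1;
    q.2.1 * q.2.2.1 / ε ^ 2, q.2.1 * q.2.2.1 / ε ^ 2, 0]

/-- Complex `3 × 3` matrices as continuous linear maps. -/
def matrixToCLM : Matrix (Fin 3) (Fin 3) ℂ →ₗ[ℂ] (Phase →L[ℂ] Phase) :=
  (LinearMap.toContinuousLinearMap.toLinearMap).comp
    (Matrix.toLin' (R := ℂ) (m := Fin 3) (n := Fin 3)).toLinearMap

/-- The generator with matrix `genMatrix`, as a function of `q = (s, v, e, y)`. -/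
def gen (T ν ε : ℝ) (q : ℝ × ℝ × ℝ × ℝ) : Phase →L[ℂ] Phase :=
  matrixToCLM ((genMatrix T ν ε q).map (fun r : ℝ => (r : ℂ)))

theorem gen_apply (T ν ε s v e y : ℝ) (V : Phase) :
    gen T ν ε (s, v, e, y) V =
      ![((T / v - s ^ 2 * v) / (s * ν) : ℝ) * V 0 + (-e / (s * ν) : ℝ) * V 1
          + (ε ^ 2 * y / (s * ν) : ℝ) * V 2,
        (v * y : ℝ) * V 0 + (v : ℝ) * V 2,
        (v * e / ε ^ 2 : ℝ) * V 0 + (v * e / ε ^ 2 : ℝ) * V 1] := by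
  have h : gen T ν ε (s, v, e, y) V =
      ((genMatrix T ν ε (s, v, e, y)).map (fun r : ℝ => (r : ℂ))).mulVec V := rfl
  rw [h]
  ext i
  fin_cases i <;> simp [genMatrix, Matrix.mulVec, dotProduct, Fin.sum_univ_three]

theorem continuousAt_gen (T : ℝ) {ν ε s v e y : ℝ} (hν : ν ≠ 0) (hε : ε ≠ 0) (hs : s ≠ 0)
    (hv : v ≠ 0) : ContinuousAt (gen T ν ε) (s, v, e, y) := by
  have h1 : Continuous matrixToCLM := LinearMap.continuous_of_finiteDimensional _
  refine h1.continuousAt.comp (f := fun q => (genMatrix T ν ε q).map (fun r : ℝ => (r : ℂ))) ?_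
  refine continuousAt_pi.2 fun i => continuousAt_pi.2 fun j => ?_
  simp only [Matrix.map_apply]
  refine Complex.continuous_ofReal.continuousAt.comp (f := fun q => genMatrix T ν ε q i j) ?_
  fin_cases i <;> fin_cases j <;> simp [genMatrix] <;>
    fun_prop (disch := simp [hs, hν, hε])

/-! ### Positivity of the rate of change of the model form. -/

/-- With `m = z - β y`, `β = b ε²` and `G = -σ γ = |γ|`, the terms other than the square of `m + f`
form a binary quadratic form in `(y, z)` with leading coefficients close to `v` and equal to `2 G`.
The cross term is only `O(G)`, so the form is positive definite when `G` is small compared with `v`;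
`hsm` is the resulting discriminant condition. -/
theorem quadratic_end_pos {ε b v γ σ m f y : ℝ} (hε : 0 < ε) (hb : 0 < b)
    (hσ : σ ^ 2 = 1) (hγ : σ * γ < 0)
    (hsm : -(σ * γ) * ((1 + 2 * (b * ε ^ 2)) ^ 2 + 8 * (b * ε ^ 2)) < 8 * v)
    (hne : m ≠ 0 ∨ f ≠ 0 ∨ y ≠ 0) :
    0 < (m + f) ^ 2 / ε ^ 2 + v * y ^ 2 + γ * m * y - 2 * σ * γ * (m + b * ε ^ 2 * y) * m := by
  obtain ⟨G, hG⟩ : ∃ G, G = -(σ * γ) := ⟨_, rfl⟩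
  obtain ⟨β, hβ⟩ : ∃ β, β = b * ε ^ 2 := ⟨_, rfl⟩
  have hβ0 : 0 < β := by rw [hβ]; positivity
  have hG0 : 0 < G := by linarith
  have hGγ : γ ^ 2 = G ^ 2 := by rw [hG]; linear_combination -γ ^ 2 * hσ
  have hγle : γ ≤ G := le_of_sq_le_sq hGγ.le hG0.le
  have hγge : -G ≤ γ := by nlinarith
  rw [← hβ, ← hG] at hsm
  have h2 : 2 * σ * γ = -(2 * G) := by rw [hG]; ring
  rw [h2, ← hβ]
  set z := m + β * y with hz
  have hm : m = z - β * y := by rw [hz]; ring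
  set k := γ - 2 * G * β with hk
  set A := v - γ * β with hA
  have hexp : (m + f) ^ 2 / ε ^ 2 + v * y ^ 2 + γ * m * y - -(2 * G) * z * m
      = (m + f) ^ 2 / ε ^ 2 + (A * y ^ 2 + k * z * y + 2 * G * z ^ 2) := by
    rw [hk, hA]
    have : γ * m * y - -(2 * G) * z * m = (γ * y + 2 * G * z) * (z - β * y) := by
      rw [← hm]; ring
    linear_combination this
  have hkk : k ^ 2 ≤ G ^ 2 * (1 + 2 * β) ^ 2 := by
    have h1 : |k| ≤ G * (1 + 2 * β) := by
      rw [abs_le, hk]; constructor <;> nlinarith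
    have := pow_le_pow_left₀ (abs_nonneg k) h1 2
    rw [sq_abs] at this
    linarith [mul_pow G (1 + 2 * β) 2]
  have hAA : v - G * β ≤ A := by rw [hA]; nlinarith
  -- From `A ≥ v - G β` and `k² ≤ G² (1 + 2β)²`, the discriminant is at least `G` times the
  -- difference of the two sides of `hsm`.
  have hdisc : 0 < 8 * G * A - k ^ 2 := by nlinarith
  have hq : 0 ≤ A * y ^ 2 + k * z * y + 2 * G * z ^ 2 := by
    have : 0 ≤ 8 * G * (A * y ^ 2 + k * z * y + 2 * G * z ^ 2) := by
      nlinarith [sq_nonneg (4 * G * z + k * y), mul_nonneg hdisc.le (sq_nonneg y)]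
    exact nonneg_of_mul_nonneg_right this (by positivity)
  rw [hexp]
  by_contra! hle
  have h3 : 0 ≤ (m + f) ^ 2 / ε ^ 2 := by positivity
  have h4 : (m + f) ^ 2 / ε ^ 2 = 0 := by linarith
  have h5 : A * y ^ 2 + k * z * y + 2 * G * z ^ 2 = 0 := by linarith
  have h6 : m + f = 0 := by
    rcases div_eq_zero_iff.1 h4 with h | h
    · exact pow_eq_zero_iff two_ne_zero |>.1 h
    · exact absurd h (by positivity)
  have h7 : (8 * G * A - k ^ 2) * y ^ 2 ≤ 0 := by nlinarith [sq_nonneg (4 * G * z + k * y)]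
  have h8 : y = 0 := by
    have : y ^ 2 ≤ 0 := by
      by_contra! h9
      nlinarith [mul_pos hdisc h9]
    exact pow_eq_zero_iff two_ne_zero |>.1 (le_antisymm this (sq_nonneg y))
  rw [h8] at h5
  have h9 : z = 0 := by
    have : z ^ 2 = 0 := by
      have : 2 * G * z ^ 2 = 0 := by linarith
      simpa [hG0.ne'] using this
    exact pow_eq_zero_iff two_ne_zero |>.1 this
  have h10 : m = 0 := by rw [hm, h9, h8]; ring
  rcases hne with h | h | h
  · exact h h10
  · exact h (by linarith)
  · exact h h8

theorem phase_ne_zero {V : Phase} (h : V ≠ 0) :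
    ((V 0).re ≠ 0 ∨ (V 1).re ≠ 0 ∨ (V 2).re ≠ 0) ∨
      ((V 0).im ≠ 0 ∨ (V 1).im ≠ 0 ∨ (V 2).im ≠ 0) := by
  by_contra! hc
  apply h
  ext i
  fin_cases i <;> apply Complex.ext <;> simp [hc]

/-- The generators have real coefficients, so the Hermitian forms split into the same real form
evaluated on real and imaginary parts. -/
theorem add_pos_of_quadratic {F : ℝ → ℝ → ℝ → ℝ} (h0 : F 0 0 0 = 0)
    (h : ∀ m f y, m ≠ 0 ∨ f ≠ 0 ∨ y ≠ 0 → 0 < F m f y) {V : Phase} (hV : V ≠ 0) :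
    0 < F (V 0).re (V 1).re (V 2).re + F (V 0).im (V 1).im (V 2).im := by
  have h1 : ∀ m f y, 0 ≤ F m f y := by
    intro m f y
    by_cases hc : m ≠ 0 ∨ f ≠ 0 ∨ y ≠ 0
    · exact (h m f y hc).le
    · push Not at hc
      rw [hc.1, hc.2.1, hc.2.2, h0]
  rcases phase_ne_zero hV with hc | hc
  · exact add_pos_of_pos_of_nonneg (h _ _ _ hc) (h1 _ _ _)
  · exact add_pos_of_nonneg_of_pos (h1 _ _ _) (h _ _ _ hc)

/-- At an end state the equation reads `m' = γ m - b (m + f)`, `f' = v y`, `y' = (m + f) / ε²`. The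
coefficient `b ε²` in the form is chosen so that the terms `b (m + f) y` cancel and `z' = γ m`. What
remains is twice the claimed quantity and is covered by `quadratic_end_pos`. -/
theorem form_gen_end_pos {T ν ε s v b γ σ : ℝ} (hν : 0 < ν) (hε : 0 < ε) (hs : 0 < s)
    (hv : 0 < v) (hb : b = 1 / (v * s * ν)) (hγ : γ = (T + 1 - s ^ 2 * v ^ 2) / (v * s * ν))
    (hσ : σ ^ 2 = 1) (hσγ : σ * γ < 0)
    (hsm : -(σ * γ) * ((1 + 2 * (b * ε ^ 2)) ^ 2 + 8 * (b * ε ^ 2)) < 8 * v) (V : Phase)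
    (hV : V ≠ 0) : 0 < form ε b σ V (gen T ν ε (s, v, 1 / v, 0) V) := by
  have hb0 : 0 < b := by rw [hb]; positivity
  have h := add_pos_of_quadratic (F := fun m f y => (m + f) ^ 2 / ε ^ 2 + v * y ^ 2 + γ * m * y
    - 2 * σ * γ * (m + b * ε ^ 2 * y) * m) (by simp)
    (fun m f y hne => quadratic_end_pos hε hb0 hσ hσγ hsm hne) hV
  have h1 : (T / v - s ^ 2 * v) / (s * ν) = γ - b := by rw [hγ, hb]; field_simp; ring
  have h2 : -(1 / v) / (s * ν) = -b := by rw [hb]; field_simp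
  have h3 : v * (1 / v) / ε ^ 2 = 1 / ε ^ 2 := by field_simp
  rw [form_apply, gen_apply, h1, h2, h3]
  have hε2 : ε ^ 2 ≠ 0 := by positivity
  simp only [Matrix.cons_val, Complex.add_re, Complex.add_im, Complex.re_ofReal_mul,
    Complex.im_ofReal_mul]
  have h4 := half_pos h
  refine lt_of_lt_of_eq h4 ?_
  field_simp
  ring

/-- At the sonic state `γ = 0`, so `z` is conserved and the unweighted form gives no control of it.
The weight contributes `-2η` times the form, hence `2 η z²`, and completing the square in `m + f`
leaves `v - η b ε² - η² ε²` in front of `y²`. -/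
theorem form_weight_gen_pos {T ν ε s v b η : ℝ} (hν : 0 < ν) (hε : 0 < ε) (hs : 0 < s)
    (hv : 0 < v) (hb : b = 1 / (v * s * ν)) (hsv : s ^ 2 * v ^ 2 = T + 1) (hη : 0 < η)
    (hηv : η * (b * ε ^ 2) + η ^ 2 * ε ^ 2 < v) (V : Phase) (hV : V ≠ 0) :
    0 < form ε b 1 V ((gen T ν ε (s, v, 1 / v, 0) - (η : ℂ) • ContinuousLinearMap.id ℂ Phase) V)
    := by
  have hb0 : 0 < b := by rw [hb]; positivity
  have hε2 : ε ^ 2 ≠ 0 := by positivity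
  have h := add_pos_of_quadratic (F := fun m f y => ((m + f) / ε - η * ε * y) ^ 2
    + (v - η * (b * ε ^ 2) - η ^ 2 * ε ^ 2) * y ^ 2 + 2 * η * (m + b * ε ^ 2 * y) ^ 2) (by simp)
    (fun m f y hne => by
      by_contra! hle
      have hA : 0 < v - η * (b * ε ^ 2) - η ^ 2 * ε ^ 2 := by linarith
      have t1 := sq_nonneg ((m + f) / ε - η * ε * y)
      have t2 := mul_nonneg hA.le (sq_nonneg y)
      have t3 := mul_nonneg hη.le (sq_nonneg (m + b * ε ^ 2 * y))
      have h2 : y ^ 2 = 0 := by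
        have : (v - η * (b * ε ^ 2) - η ^ 2 * ε ^ 2) * y ^ 2 = 0 := by linarith
        rcases mul_eq_zero.1 this with h | h
        · exact absurd h hA.ne'
        · exact h
      have h3 : (m + b * ε ^ 2 * y) ^ 2 = 0 := by
        have : η * (m + b * ε ^ 2 * y) ^ 2 = 0 := by linarith
        rcases mul_eq_zero.1 this with h | h
        · exact absurd h hη.ne'
        · exact h
      have h1 : ((m + f) / ε - η * ε * y) ^ 2 = 0 := by linarith
      rw [pow_eq_zero_iff two_ne_zero] at h1 h2 h3
      rw [h2] at h1 h3
      have hm : m = 0 := by linarith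
      have hf : f = 0 := by
        rw [hm] at h1
        simpa [hε.ne'] using h1
      simp [hm, hf, h2] at hne) hV
  have h1 : (T / v - s ^ 2 * v) / (s * ν) = - b := by
    rw [hb]; field_simp; linear_combination -hsv
  have h2 : -(1 / v) / (s * ν) = -b := by rw [hb]; field_simp
  have h3 : v * (1 / v) / ε ^ 2 = 1 / ε ^ 2 := by field_simp
  rw [form_apply]
  simp only [sub_apply, smul_apply, ContinuousLinearMap.id_apply, Pi.sub_apply, Pi.smul_apply,
    smul_eq_mul]
  rw [gen_apply, h1, h2, h3]
  simp only [Matrix.cons_val, Complex.add_re, Complex.add_im, Complex.re_ofReal_mul,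
    Complex.im_ofReal_mul, Complex.sub_re, Complex.sub_im]
  have h4 := half_pos h
  refine lt_of_lt_of_eq h4 ?_
  field_simp
  ring

/-! ### Definite subspaces of the model form -/

theorem finrank_ker_phase {l : Phase →ₗ[ℂ] ℂ} (hl : l ≠ 0) :
    Module.finrank ℂ (LinearMap.ker l) = 2 := by
  have := Module.Dual.finrank_ker_add_one_of_ne_zero (f := l) hl
  simpa using this

/-- The functional `a V₀ + b V₁ + c V₂`. -/
def functional (a b c : ℝ) : Phase →ₗ[ℂ] ℂ :=
  (a : ℂ) • LinearMap.proj 0 + (b : ℂ) • LinearMap.proj 1 + (c : ℂ) • LinearMap.proj 2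

theorem functional_apply (a b c : ℝ) (V : Phase) :
    functional a b c V = a * V 0 + b * V 1 + c * V 2 := by simp [functional]

theorem functional_ne_zero {a b c : ℝ} (h : c ≠ 0) : functional a b c ≠ 0 := fun h0 => by
  have := LinearMap.congr_fun h0 ![0, 0, 1]
  rw [functional_apply] at this
  simp [h] at this

theorem form_smul_self (ε b σ : ℝ) (a : ℂ) (V : Phase) :
    form ε b σ (a • V) (a • V) = ‖a‖ ^ 2 * form ε b σ V V := by
  rw [form_apply, form_apply, ← Complex.normSq_eq_norm_sq, Complex.normSq_apply]
  simp only [Pi.smul_apply, smul_eq_mul, Complex.mul_re, Complex.mul_im]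
  ring

end LinODE

/-! ### Dimension counts for the three spaces of solutions. -/

namespace LinODE

theorem finrank_boundedAlong_atTop {M : ℝ → Phase →L[ℂ] Phase} (hM : Continuous M) {K : ℝ}
    (hK : ∀ x, ‖M x‖ ≤ K) {M₀ : Phase →L[ℂ] Phase} (hlim : Tendsto M atTop (𝓝 M₀)) {ε b : ℝ}
    (hb : 0 < b) (hε : 0 < ε) (h : ∀ V, V ≠ 0 → 0 < form ε b 1 V (M₀ V)) :
    Module.finrank ℂ (boundedAlong atTop M) = 2 ∧
      ∃ θ > 0, ∀ Z ∈ boundedAlong atTop M, Z =O[atTop] (fun x => Real.exp (-θ * x)) := by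
  obtain ⟨c, hc, hev⟩ := exists_eventually_form_ge h
  obtain ⟨N, hN⟩ := eventually_atTop.1 (hlim.eventually hev)
  have hE : Expands M (form ε b 1) c N := fun x hx v => hN x hx v
  refine ⟨?_, boundedAlong_atTop_exp_decay hK hE hc (form_symm ε b 1)⟩
  have hP : Module.finrank ℂ (LinearMap.ker (functional 0 0 1)) = 2 :=
    finrank_ker_phase (functional_ne_zero one_ne_zero)
  -- The vector with `z = 0` and `r = y = 1`, on which the form is `1 + b ε² / 2`. On the plane `y =
  -- 0` only `-|z|²` remains.
  set w : Phase := ![((-(b * ε ^ 2) : ℝ) : ℂ), ((1 + b * ε ^ 2 : ℝ) : ℂ), 1] with hw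
  have hw0 : w ≠ 0 := fun h => by simpa [hw] using congrFun h 2
  rw [hE.finrank_boundedAlong hM hK hc (form_symm ε b 1)
    (P := LinearMap.ker (functional 0 0 1)) (P' := Submodule.span ℂ {w}), hP]
  · intro V hV
    rw [LinearMap.mem_ker, functional_apply] at hV
    have hV2 : V 2 = 0 := by simpa using hV
    rw [form_apply, hV2]
    simp only [Complex.zero_re, Complex.zero_im]
    nlinarith [sq_nonneg (V 0).re, sq_nonneg (V 0).im]
  · intro V hV hne
    obtain ⟨a, rfl⟩ := Submodule.mem_span_singleton.1 hV
    have ha : a ≠ 0 := by rintro rfl; simp at hne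
    rw [form_smul_self]
    refine mul_pos (by positivity) ?_
    rw [form_apply]
    simp only [hw, Matrix.cons_val, Complex.ofReal_re, Complex.ofReal_im, Complex.one_re,
      Complex.one_im]
    have : 0 < b * ε ^ 2 := by positivity
    linarith
  · rw [hP, finrank_span_singleton hw0]; simp

theorem expands_reflect {M : ℝ → Phase →L[ℂ] Phase} {B : Phase →L[ℝ] Phase →L[ℝ] ℝ} {c N : ℝ}
    (h : ∀ x, x ≤ N → ∀ v, c * ‖v‖ ^ 2 ≤ B v (M x v)) : Expands (reflect M) (-B) c (-N) :=
  fun x hx v => by simpa [reflect] using h (-x) (by linarith) v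

/-- Reflection turns `-∞` into `+∞` and reverses the sign of the generator, so the expanding form is
`-form`. With `σ = -1` the slow variable enters `-form` as `-|z|²`, so the maximal nonpositive
subspace is again a plane. -/
theorem finrank_boundedAlong_atBot {M : ℝ → Phase →L[ℂ] Phase} (hM : Continuous M) {K : ℝ}
    (hK : ∀ x, ‖M x‖ ≤ K) {M₀ : Phase →L[ℂ] Phase} (hlim : Tendsto M atBot (𝓝 M₀)) {ε b : ℝ}
    (hb : 0 < b) (hε : 0 < ε) (h : ∀ V, V ≠ 0 → 0 < form ε b (-1) V (M₀ V)) :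
    Module.finrank ℂ (boundedAlong atBot M) = 2 ∧
      ∃ θ > 0, ∀ Z ∈ boundedAlong atBot M, Z =O[atBot] (fun x => Real.exp (θ * x)) := by
  obtain ⟨c, hc, hev⟩ := exists_eventually_form_ge h
  obtain ⟨N, hN⟩ := eventually_atBot.1 (hlim.eventually hev)
  have hE : Expands (reflect M) (-form ε b (-1)) c (-N) := expands_reflect hN
  have hsymm : ∀ v w, (-form ε b (-1)) v w = (-form ε b (-1)) w v := fun v w => by
    simp [form_symm ε b (-1) v w]
  have hbε : 0 < b * ε ^ 2 := by positivity
  constructor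
  -- On the plane `r = y` the form is `(1 + b ε² / 2) |y|² + |z|²`; the complementary vector `w` has
  -- `z = 0`, `y = 1` and `r = -(1 + b ε²)`.
  · have hP : Module.finrank ℂ (LinearMap.ker (functional 1 1 (-1))) = 2 :=
      finrank_ker_phase (functional_ne_zero (by norm_num))
    set w : Phase := ![((-(b * ε ^ 2) : ℝ) : ℂ), ((-1 : ℝ) : ℂ), 1] with hw
    have hw0 : w ≠ 0 := fun h => by simpa [hw] using congrFun h 2
    rw [← finrank_boundedAlong_reflect, hE.finrank_boundedAlong (continuous_reflect hM)
      (norm_reflect_le hK) hc hsymm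
      (P := LinearMap.ker (functional 1 1 (-1))) (P' := Submodule.span ℂ {w}), hP]
    · intro V hV
      rw [LinearMap.mem_ker, functional_apply] at hV
      have hV2 : V 2 = V 0 + V 1 := by
        push_cast at hV
        linear_combination -hV
      simp only [neg_apply]
      rw [form_apply, hV2]
      simp only [Complex.add_re, Complex.add_im]
      nlinarith [sq_nonneg ((V 0).re + (V 1).re), sq_nonneg ((V 0).im + (V 1).im),
        sq_nonneg ((V 0).re + b * ε ^ 2 * ((V 0).re + (V 1).re)),
        sq_nonneg ((V 0).im + b * ε ^ 2 * ((V 0).im + (V 1).im)),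
        mul_nonneg hbε.le (sq_nonneg ((V 0).re + (V 1).re)),
        mul_nonneg hbε.le (sq_nonneg ((V 0).im + (V 1).im))]
    · intro V hV hne
      obtain ⟨a, rfl⟩ := Submodule.mem_span_singleton.1 hV
      have ha : a ≠ 0 := by rintro rfl; simp at hne
      simp only [neg_apply]
      rw [form_smul_self, ← mul_neg]
      refine mul_pos (by positivity) ?_
      rw [form_apply]
      simp only [hw, Matrix.cons_val, Complex.ofReal_re, Complex.ofReal_im, Complex.one_re,
        Complex.one_im]
      linarith
    · rw [hP, finrank_span_singleton hw0]; simp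
  · obtain ⟨θ, hθ, hdec⟩ := boundedAlong_atTop_exp_decay (norm_reflect_le hK) hE hc hsymm
    refine ⟨θ, hθ, fun Z hZ => ?_⟩
    have h1 := (hdec _ (mem_boundedAlong_reflect_iff.2 hZ)).comp_tendsto tendsto_neg_atBot_atTop
    simpa [Function.comp_def] using h1

/-- With the weight the sign `σ = 1` is used at `-∞` as well. After reflection the slow variable
counts as `+|z|²`, so one direction moves from the nonpositive to the positive part and only a line
of solutions remains. -/
theorem finrank_fastAtBot_eq_one {M : ℝ → Phase →L[ℂ] Phase} (hM : Continuous M) {K : ℝ}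
    (hK : ∀ x, ‖M x‖ ≤ K) {ε b c η : ℝ} (hb : 0 < b) (hε : 0 < ε) (hc : 0 < c)
    (h : ∀ x V, c * ‖V‖ ^ 2 ≤ form ε b 1 V (weight η M x V)) :
    Module.finrank ℂ (fastAtBot η M) = 1 := by
  have hE : Expands (reflect (weight η M)) (-form ε b 1) c (-0) :=
    expands_reflect fun x _ => h x
  have hsymm : ∀ v w, (-form ε b 1) v w = (-form ε b 1) w v := fun v w => by
    simp [form_symm ε b 1 v w]
  have hbε : 0 < b * ε ^ 2 := by positivity
  have hP : Module.finrank ℂ (LinearMap.ker (functional 1 1 (1 + b * ε ^ 2))) = 2 :=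
    finrank_ker_phase (functional_ne_zero (by positivity))
  set w : Phase := ![((-(b * ε ^ 2) : ℝ) : ℂ), ((1 + b * ε ^ 2 : ℝ) : ℂ), 1] with hw
  have hw0 : w ≠ 0 := fun h => by simpa [hw] using congrFun h 2
  rw [finrank_fastAtBot, ← finrank_boundedAlong_reflect,
    hE.finrank_boundedAlong (continuous_reflect (continuous_weight hM η))
      (norm_reflect_le (norm_weight_le hK η)) hc hsymm (P := Submodule.span ℂ {w})
      (P' := LinearMap.ker (functional 1 1 (1 + b * ε ^ 2))), finrank_span_singleton hw0]
  · intro V hV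
    obtain ⟨a, rfl⟩ := Submodule.mem_span_singleton.1 hV
    simp only [neg_apply]
    rw [form_smul_self, ← mul_neg]
    refine mul_nonpos_of_nonneg_of_nonpos (by positivity) ?_
    rw [form_apply]
    simp only [hw, Matrix.cons_val, Complex.ofReal_re, Complex.ofReal_im, Complex.one_re,
      Complex.one_im]
    linarith
  · intro V hV hne
    rw [LinearMap.mem_ker, functional_apply] at hV
    have hV1 : V 1 = -V 0 - ((1 + b * ε ^ 2 : ℝ) : ℂ) * V 2 := by
      simp only [Complex.ofReal_one, one_mul] at hV
      linear_combination hV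
    -- The first square vanishes on the kernel; it is added to make the expression definite on the
    -- whole phase space.
    have hpos := add_pos_of_quadratic (F := fun m f y => (m + f + (1 + b * ε ^ 2) * y) ^ 2 +
      (1 + b * ε ^ 2 / 2) * y ^ 2 + (m + b * ε ^ 2 * y) ^ 2) (by simp) (fun m f y h => by
        by_contra! hle
        have t1 := sq_nonneg (m + f + (1 + b * ε ^ 2) * y)
        have t2 : 0 ≤ (1 + b * ε ^ 2 / 2) * y ^ 2 := by positivity
        have t3 := sq_nonneg (m + b * ε ^ 2 * y)
        have h1 : (m + f + (1 + b * ε ^ 2) * y) ^ 2 = 0 := by linarith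
        have h2 : (m + b * ε ^ 2 * y) ^ 2 = 0 := by linarith
        have h3 : y = 0 := by
          have h4 : (1 + b * ε ^ 2 / 2) * y ^ 2 = 0 := by linarith
          rcases mul_eq_zero.1 h4 with h5 | h5
          · exact absurd h5 (by positivity)
          · exact pow_eq_zero_iff two_ne_zero |>.1 h5
        rw [pow_eq_zero_iff two_ne_zero] at h1 h2
        rw [h3] at h1 h2
        have hm : m = 0 := by linarith
        have hf : f = 0 := by linarith
        simp [hm, hf, h3] at h) hne
    simp only [neg_apply]
    rw [form_apply]
    rw [hV1] at hpos ⊢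
    simp only [Complex.sub_re, Complex.sub_im, Complex.neg_re, Complex.neg_im,
      Complex.re_ofReal_mul, Complex.im_ofReal_mul] at hpos ⊢
    refine lt_of_lt_of_eq hpos ?_
    ring
  · rw [hP, finrank_span_singleton hw0]; simp

end LinODE

/-! ### Limits of derivatives of convergent functions. -/

namespace LinODE

/-- A filter on the line is stable under moving points to the right by at most one. -/
def ShiftStable (l : Filter ℝ) : Prop :=
  ∀ f : ℝ → ℝ, (∀ x, x ≤ f x ∧ f x ≤ x + 1) → Tendsto f l l

theorem shiftStable_atTop : ShiftStable atTop := fun _ hf =>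
  tendsto_atTop_mono (fun x => (hf x).1) tendsto_id

theorem shiftStable_atBot : ShiftStable atBot := fun _ hf =>
  tendsto_atBot_mono (fun x => (hf x).2) (tendsto_atBot_add_const_right _ _ tendsto_id)

/-- By the mean value theorem on `[x, x + 1]`, a convergent function has small slope somewhere in
each unit interval far out. -/
theorem exists_tendsto_deriv {l : Filter ℝ} (hl : ShiftStable l) {f f' : ℝ → ℝ}
    (hf : ∀ x, HasDerivAt f (f' x) x) {a : ℝ} (ha : Tendsto f l (𝓝 a)) :
    ∃ ξ : ℝ → ℝ, (∀ x, x ≤ ξ x ∧ ξ x ≤ x + 1) ∧ Tendsto (fun x => f' (ξ x)) l (𝓝 0) := by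
  have h1 : ∀ x, ∃ ξ ∈ Set.Ioo x (x + 1), f' ξ = (f (x + 1) - f x) / (x + 1 - x) := fun x =>
    exists_hasDerivAt_eq_slope f f' (by linarith)
      (fun y _ => (hf y).continuousAt.continuousWithinAt) fun y _ => hf y
  choose ξ hξ hξ' using h1
  refine ⟨ξ, fun x => ⟨(hξ x).1.le, (hξ x).2.le⟩, ?_⟩
  have h2 : (fun x => f' (ξ x)) = fun x => f (x + 1) - f x := by
    funext x; rw [hξ']; simp
  rw [h2]
  have h3 := (ha.comp (hl (fun x => x + 1) fun x => ⟨by linarith, le_rfl⟩)).sub ha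
  simpa [Function.comp_def] using h3

/-- A function whose derivative tends to `0` hardly varies over unit intervals, so smallness at one
point of each interval spreads to all points. -/
theorem tendsto_zero_of_tendsto_shift {l : Filter ℝ} (hl : ShiftStable l) {g g' : ℝ → ℝ}
    (hg : ∀ x, HasDerivAt g (g' x) x) (hg' : Tendsto g' l (𝓝 0)) {ξ : ℝ → ℝ}
    (hξ : ∀ x, x ≤ ξ x ∧ ξ x ≤ x + 1) (h : Tendsto (fun x => g (ξ x)) l (𝓝 0)) :
    Tendsto g l (𝓝 0) := by
  have h1 : ∀ x, ∃ ζ, (x ≤ ζ ∧ ζ ≤ x + 1) ∧ g (ξ x) - g x = g' ζ * (ξ x - x) := by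
    intro x
    rcases eq_or_lt_of_le (hξ x).1 with he | hlt
    · exact ⟨x, ⟨le_rfl, by linarith⟩, by simp [← he]⟩
    · obtain ⟨ζ, hζ, h2⟩ := exists_hasDerivAt_eq_slope g g' hlt
        (fun y _ => (hg y).continuousAt.continuousWithinAt) fun y _ => hg y
      refine ⟨ζ, ⟨hζ.1.le, hζ.2.le.trans (hξ x).2⟩, ?_⟩
      rw [h2, div_mul_cancel₀ _ (by linarith)]
  choose ζ hζ hζ' using h1
  have h2 : Tendsto (fun x => g' (ζ x) * (ξ x - x)) l (𝓝 0) := by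
    refine squeeze_zero_norm (a := fun x => |g' (ζ x)|) (fun x => ?_) ?_
    · rw [norm_mul, Real.norm_eq_abs, Real.norm_eq_abs]
      refine mul_le_of_le_one_right (abs_nonneg _) ?_
      rw [abs_le]
      constructor <;> linarith [(hξ x).1, (hξ x).2]
    · simpa using (hg'.comp (hl ζ hζ)).abs
  have h3 : g = fun x => g (ξ x) - g' (ζ x) * (ξ x - x) := by
    funext x; rw [← hζ']; ring
  rw [h3]
  simpa using h.sub h2

end LinODE

/-! ### The profile: integrated equations, limits and bounds. -/

namespace NSP

open LinODE

namespace Wave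

/-- The Lagrangian electric field `φ' / v`. -/
def field (P : Wave) (x : ℝ) : ℝ := deriv P.φ x / P.v x

/-- The generator of the linearized profile equation. -/
def linGen (P : Wave) (x : ℝ) : Phase →L[ℂ] Phase :=
  gen P.T P.ν P.ε (P.s, P.v x, Real.exp (P.φ x), P.field x)

/-- The derivative of the profile in the variables of the linearized profile equation. -/
def profileMode (P : Wave) (x : ℝ) : Phase :=
  fun i => ((![deriv P.v x / P.v x, deriv P.φ x,
    (P.v x * Real.exp (P.φ x) - 1) / P.ε ^ 2] i : ℝ) : ℂ)

end Wave

namespace IsShockProfile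

variable {P : Wave} {vm um vp up : ℝ}

theorem smooth_deriv {f : ℝ → ℝ} (h : ContDiff ℝ (⊤ : ℕ∞) f) : ContDiff ℝ (⊤ : ℕ∞) (deriv f) :=
  (contDiff_infty_iff_deriv.1 h).2

theorem smooth_hasDerivAt {f : ℝ → ℝ} (h : ContDiff ℝ (⊤ : ℕ∞) f) (x : ℝ) :
    HasDerivAt f (deriv f x) x :=
  ((contDiff_infty_iff_deriv.1 h).1 x).hasDerivAt

theorem smooth_field (h : IsShockProfile P vm um vp up) : ContDiff ℝ (⊤ : ℕ∞) P.field :=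
  (smooth_deriv h.smooth_φ).div h.smooth_v fun x => (h.v_pos x).ne'

theorem deriv_u (h : IsShockProfile P vm um vp up) (x : ℝ) :
    deriv P.u x = -P.s * deriv P.v x := by linarith [h.mass x]

theorem deriv_u_neg (h : IsShockProfile P vm um vp up) (x : ℝ) : deriv P.u x < 0 := by
  linarith [(h.monotone_v x).2]

theorem deriv_v_pos (h : IsShockProfile P vm um vp up) (hs : 0 < P.s) (x : ℝ) :
    0 < deriv P.v x := by
  have h1 := h.monotone_v x
  have h2 : 0 < P.s * deriv P.v x := by linarith
  exact pos_of_mul_pos_right h2 hs.le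

theorem deriv_φ_neg (h : IsShockProfile P vm um vp up) (x : ℝ) : deriv P.φ x < 0 := by
  obtain ⟨c, C, hc, hC, hle⟩ := h.monotone_φ
  have := mul_neg_of_pos_of_neg hC (h.deriv_u_neg x)
  linarith [(hle x).2]

theorem deriv_φ (h : IsShockProfile P vm um vp up) (x : ℝ) :
    deriv P.φ x = P.v x * P.field x := by
  have := (h.v_pos x).ne'
  rw [Wave.field]; field_simp

theorem deriv_field (h : IsShockProfile P vm um vp up) (hε : 0 < P.ε) (x : ℝ) :
    deriv P.field x = (P.v x * Real.exp (P.φ x) - 1) / P.ε ^ 2 := by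
  have h1 := h.poisson x
  have h2 : (fun y => deriv P.φ y / P.v y) = P.field := rfl
  rw [h2] at h1
  have := hε.ne'
  field_simp
  linarith

theorem hasDerivAt_field (h : IsShockProfile P vm um vp up) (hε : 0 < P.ε) (x : ℝ) :
    HasDerivAt P.field ((P.v x * Real.exp (P.φ x) - 1) / P.ε ^ 2) x := by
  rw [← h.deriv_field hε]
  exact smooth_hasDerivAt h.smooth_field x

theorem monotone (h : IsShockProfile P vm um vp up) (hs : 0 < P.s) : Monotone P.v :=
  monotone_of_deriv_nonneg (fun x => (smooth_hasDerivAt h.smooth_v x).differentiableAt)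
    fun x => (h.deriv_v_pos hs x).le

theorem antitone (h : IsShockProfile P vm um vp up) : Antitone P.φ :=
  antitone_of_deriv_nonpos (fun x => (smooth_hasDerivAt h.smooth_φ x).differentiableAt)
    fun x => (h.deriv_φ_neg x).le

theorem v_mem (h : IsShockProfile P vm um vp up) (hs : 0 < P.s) (x : ℝ) :
    vm ≤ P.v x ∧ P.v x ≤ vp :=
  ⟨(h.monotone hs).le_of_tendsto h.v_atBot x, (h.monotone hs).ge_of_tendsto h.v_atTop x⟩

theorem φ_mem (h : IsShockProfile P vm um vp up) (x : ℝ) :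
    -Real.log vp ≤ P.φ x ∧ P.φ x ≤ -Real.log vm :=
  ⟨h.antitone.le_of_tendsto h.φ_atTop x, h.antitone.ge_of_tendsto h.φ_atBot x⟩

theorem exp_mem (h : IsShockProfile P vm um vp up) (hvm : 0 < vm) (hvp : 0 < vp) (x : ℝ) :
    1 / vp ≤ Real.exp (P.φ x) ∧ Real.exp (P.φ x) ≤ 1 / vm := by
  have h1 := h.φ_mem x
  have h2 : 1 / vp = Real.exp (-Real.log vp) := by rw [Real.exp_neg, Real.exp_log hvp, one_div]
  have h3 : 1 / vm = Real.exp (-Real.log vm) := by rw [Real.exp_neg, Real.exp_log hvm, one_div]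
  rw [h2, h3, Real.exp_le_exp, Real.exp_le_exp]
  exact h1

/-- The integrated momentum equation. -/
theorem exists_flux (h : IsShockProfile P vm um vp up) (hε : 0 < P.ε) :
    ∃ J : ℝ, ∀ x, P.ν * deriv P.u x / P.v x =
      -P.s * P.u x + P.T / P.v x + Real.exp (P.φ x) - P.ε ^ 2 / 2 * P.field x ^ 2 - J := by
  -- The force `φ' / v = y` is an exact derivative: `(exp φ)' = v y exp φ`, and Poisson's law gives
  -- `(ε² y² / 2)' = y (v exp φ - 1)`.
  set F : ℝ → ℝ := fun x => -P.s * P.u x + P.T / P.v x + Real.exp (P.φ x)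
    - P.ε ^ 2 / 2 * P.field x ^ 2 - P.ν * deriv P.u x / P.v x with hF
  have hv0 : ∀ x, P.v x ≠ 0 := fun x => (h.v_pos x).ne'
  have hd1 : Differentiable ℝ fun y => P.T / P.v y := by
    have := h.smooth_v.differentiable (by simp)
    fun_prop (disch := simp [hv0])
  have hd2 : Differentiable ℝ fun y => P.ν * deriv P.u y / P.v y := by
    have h1 := h.smooth_v.differentiable (by simp)
    have h2 := (smooth_deriv h.smooth_u).differentiable (by simp)
    fun_prop (disch := simp [hv0])
  have hF0 : ∀ x, HasDerivAt F 0 x := by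
    intro x
    have h1 := (smooth_hasDerivAt h.smooth_u x).const_mul (-P.s)
    have h2 := (hd1 x).hasDerivAt
    have h3 := (smooth_hasDerivAt h.smooth_φ x).exp
    have h4 := ((h.hasDerivAt_field hε x).pow 2).const_mul (P.ε ^ 2 / 2)
    have h5 := (hd2 x).hasDerivAt
    refine ((((h1.add h2).add h3).sub h4).sub h5).congr_deriv ?_
    have h6 := h.momentum x
    have h7 : deriv P.φ x / P.v x = P.field x := rfl
    rw [h7] at h6
    rw [h.deriv_φ x]
    have h8 : P.ε ^ 2 * ((P.v x * Real.exp (P.φ x) - 1) / P.ε ^ 2)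
        = P.v x * Real.exp (P.φ x) - 1 := by
      have := hε.ne'
      field_simp
    simp only [Nat.cast_ofNat]
    linear_combination h6 - P.field x * h8
  have hconst := is_const_of_deriv_eq_zero (fun x => (hF0 x).differentiableAt)
    fun x => (hF0 x).deriv
  refine ⟨F 0, fun x => ?_⟩
  rw [← hconst x 0, hF]
  ring

/-- Translation invariance: the derivative of an orbit of the autonomous system for `(log v, φ, φ' /
v)` solves its linearization along that orbit. -/
theorem isSol_profileMode (h : IsShockProfile P vm um vp up) (hs : 0 < P.s) (hν : 0 < P.ν)
    (hε : 0 < P.ε) : IsSol P.linGen P.profileMode := by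
  intro x
  have hv0 : ∀ x, P.v x ≠ 0 := fun x => (h.v_pos x).ne'
  have hs0 := hs.ne'
  have hν0 := hν.ne'
  have hε0 := hε.ne'
  obtain ⟨J, hJ⟩ := h.exists_flux hε
  have hv := smooth_hasDerivAt h.smooth_v x
  have hφ := smooth_hasDerivAt h.smooth_φ x
  have hu := smooth_hasDerivAt h.smooth_u x
  have hf := h.hasDerivAt_field hε x
  have h0 : HasDerivAt (fun x => deriv P.v x / P.v x)
      ((P.T / P.v x - P.s ^ 2 * P.v x) / (P.s * P.ν) * (deriv P.v x / P.v x)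
        + -Real.exp (P.φ x) / (P.s * P.ν) * deriv P.φ x
        + P.ε ^ 2 * P.field x / (P.s * P.ν) *
          ((P.v x * Real.exp (P.φ x) - 1) / P.ε ^ 2)) x := by
    have he : (fun x => deriv P.v x / P.v x) = fun x => -(1 / (P.s * P.ν)) *
        (-P.s * P.u x + P.T * (P.v x)⁻¹ + Real.exp (P.φ x) - P.ε ^ 2 / 2 * P.field x ^ 2 - J) := by
      funext z
      have h1 := hJ z
      rw [h.deriv_u z] at h1
      rw [← div_eq_mul_inv, ← h1]
      field_simp [hv0 z]
    rw [he]
    refine (((((hu.const_mul (-P.s)).add ((hv.inv (hv0 x)).const_mul P.T)).add hφ.exp).sub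
      ((hf.pow 2).const_mul (P.ε ^ 2 / 2))).sub_const J |>.const_mul
        (-(1 / (P.s * P.ν)))).congr_deriv ?_
    rw [h.deriv_u x]
    have := hv0 x
    field_simp
    simp only [Nat.cast_ofNat]
    ring
  have h1 : HasDerivAt (fun x => deriv P.φ x)
      (P.v x * P.field x * (deriv P.v x / P.v x)
        + P.v x * ((P.v x * Real.exp (P.φ x) - 1) / P.ε ^ 2)) x := by
    have he : (fun x => deriv P.φ x) = fun x => P.v x * P.field x := funext h.deriv_φ
    rw [he]
    refine (hv.mul hf).congr_deriv ?_
    have := hv0 x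
    field_simp
  have h2 : HasDerivAt (fun x => (P.v x * Real.exp (P.φ x) - 1) / P.ε ^ 2)
      (P.v x * Real.exp (P.φ x) / P.ε ^ 2 * (deriv P.v x / P.v x)
        + P.v x * Real.exp (P.φ x) / P.ε ^ 2 * deriv P.φ x) x := by
    refine (((hv.mul hφ.exp).sub_const 1).div_const (P.ε ^ 2)).congr_deriv ?_
    have := hv0 x
    field_simp
  rw [hasDerivAt_pi]
  intro i
  rw [Wave.linGen, gen_apply]
  fin_cases i
  · simpa [Wave.profileMode] using h0.ofReal_comp
  · simpa [Wave.profileMode] using h1.ofReal_comp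
  · simpa [Wave.profileMode] using h2.ofReal_comp

/-! ### Limits of the profile -/

/-- The end states of the profile along a filter: limits of `v`, `u` and `φ`. -/
def EndState (P : Wave) (l : Filter ℝ) (v₀ : ℝ) : Prop :=
  ShiftStable l ∧ 0 < v₀ ∧ Tendsto P.v l (𝓝 v₀) ∧ (∃ u₀, Tendsto P.u l (𝓝 u₀)) ∧
    Tendsto P.φ l (𝓝 (-Real.log v₀))

theorem endState_atTop (h : IsShockProfile P vm um vp up) (hvp : 0 < vp) :
    EndState P atTop vp := ⟨shiftStable_atTop, hvp, h.v_atTop, ⟨up, h.u_atTop⟩, h.φ_atTop⟩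

theorem endState_atBot (h : IsShockProfile P vm um vp up) (hvm : 0 < vm) :
    EndState P atBot vm := ⟨shiftStable_atBot, hvm, h.v_atBot, ⟨um, h.u_atBot⟩, h.φ_atBot⟩

variable {l : Filter ℝ} {v₀ : ℝ}

theorem tendsto_exp (he : EndState P l v₀) :
    Tendsto (fun x => Real.exp (P.φ x)) l (𝓝 (1 / v₀)) := by
  have := (Real.continuous_exp.tendsto _).comp he.2.2.2.2
  rw [Real.exp_neg, Real.exp_log he.2.1, ← one_div] at this
  exact this

theorem tendsto_poisson (he : EndState P l v₀) :
    Tendsto (fun x => (P.v x * Real.exp (P.φ x) - 1) / P.ε ^ 2) l (𝓝 0) := by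
  have h1 := ((he.2.2.1.mul (tendsto_exp he)).sub_const 1).div_const (P.ε ^ 2)
  have h2 : v₀ * (1 / v₀) = 1 := mul_one_div_cancel he.2.1.ne'
  rw [h2, sub_self, zero_div] at h1
  exact h1

/-- Poisson's law and the end-state relation `v exp φ → 1` make the derivative of the field tend to
`0`, while convergence of `φ` makes the field small at some point of each unit interval. -/
theorem tendsto_field (h : IsShockProfile P vm um vp up) (hε : 0 < P.ε)
    (he : EndState P l v₀) : Tendsto P.field l (𝓝 0) := by
  obtain ⟨ξ, hξ, h1⟩ := exists_tendsto_deriv he.1 (smooth_hasDerivAt h.smooth_φ) he.2.2.2.2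
  refine tendsto_zero_of_tendsto_shift he.1 (h.hasDerivAt_field hε) (tendsto_poisson he) hξ ?_
  have h2 := h1.div (he.2.2.1.comp (he.1 ξ hξ)) he.2.1.ne'
  rw [zero_div] at h2
  exact h2

/-- The flux relation shows that `u'` has a limit, and convergence of `u` leaves `0` as the only
possibility. -/
theorem tendsto_deriv_u [l.NeBot] (h : IsShockProfile P vm um vp up) (hν : 0 < P.ν)
    (hε : 0 < P.ε) (he : EndState P l v₀) : Tendsto (deriv P.u) l (𝓝 0) := by
  obtain ⟨u₀, hu₀⟩ := he.2.2.2.1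
  obtain ⟨J, hJ⟩ := h.exists_flux hε
  have h1 : deriv P.u = fun x => P.v x / P.ν * (-P.s * P.u x + P.T / P.v x + Real.exp (P.φ x)
      - P.ε ^ 2 / 2 * P.field x ^ 2 - J) := by
    funext x
    rw [← hJ]
    have := (h.v_pos x).ne'
    field_simp
  obtain ⟨a, ha⟩ : ∃ a, Tendsto (deriv P.u) l (𝓝 a) := by
    rw [h1]
    exact ⟨_, (he.2.2.1.div_const P.ν).mul (((((hu₀.const_mul (-P.s)).add
      (tendsto_const_nhds.div he.2.2.1 he.2.1.ne')).add (tendsto_exp he)).sub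
      (((h.tendsto_field hε he).pow 2).const_mul _)).sub_const J)⟩
  obtain ⟨ξ, hξ, h2⟩ := exists_tendsto_deriv he.1 (smooth_hasDerivAt h.smooth_u) hu₀
  have h3 : Tendsto (fun x => deriv P.u (ξ x)) l (𝓝 a) := ha.comp (he.1 ξ hξ)
  rwa [tendsto_nhds_unique h3 h2] at ha

theorem tendsto_deriv_v [l.NeBot] (h : IsShockProfile P vm um vp up) (hs : 0 < P.s)
    (hν : 0 < P.ν) (hε : 0 < P.ε) (he : EndState P l v₀) : Tendsto (deriv P.v) l (𝓝 0) := by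
  have h1 : deriv P.v = fun x => deriv P.u x / -P.s := by
    funext x; rw [h.deriv_u]; field_simp [hs.ne']
  rw [h1]
  simpa using (h.tendsto_deriv_u hν hε he).div_const (-P.s)

theorem tendsto_deriv_φ (h : IsShockProfile P vm um vp up) (hε : 0 < P.ε)
    (he : EndState P l v₀) : Tendsto (deriv P.φ) l (𝓝 0) := by
  have h1 : deriv P.φ = fun x => P.v x * P.field x := funext h.deriv_φ
  rw [h1]
  simpa using he.2.2.1.mul (h.tendsto_field hε he)

theorem deriv_deriv_φ (h : IsShockProfile P vm um vp up) (hε : 0 < P.ε) (x : ℝ) :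
    deriv (deriv P.φ) x = deriv P.v x * P.field x
      + P.v x * ((P.v x * Real.exp (P.φ x) - 1) / P.ε ^ 2) := by
  have h1 : deriv P.φ = fun x => P.v x * P.field x := funext h.deriv_φ
  rw [h1]
  exact ((smooth_hasDerivAt h.smooth_v x).mul (h.hasDerivAt_field hε x)).deriv

theorem tendsto_linGen (h : IsShockProfile P vm um vp up) (hs : 0 < P.s)
    (hν : 0 < P.ν) (hε : 0 < P.ε) (he : EndState P l v₀) :
    Tendsto P.linGen l (𝓝 (gen P.T P.ν P.ε (P.s, v₀, 1 / v₀, 0))) := by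
  refine (continuousAt_gen P.T hν.ne' hε.ne' hs.ne' he.2.1.ne').tendsto.comp
    (tendsto_const_nhds.prodMk_nhds (he.2.2.1.prodMk_nhds
      ((tendsto_exp he).prodMk_nhds (h.tendsto_field hε he))))

theorem continuous_linGen (h : IsShockProfile P vm um vp up) (hs : 0 < P.s)
    (hν : 0 < P.ν) (hε : 0 < P.ε) : Continuous P.linGen := by
  refine continuous_iff_continuousAt.2 fun x => ?_
  refine ContinuousAt.comp (f := fun x => (P.s, P.v x, Real.exp (P.φ x), P.field x))
    (continuousAt_gen P.T hν.ne' hε.ne' hs.ne' (h.v_pos x).ne') ?_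
  have h1 := h.smooth_v.continuous
  have h2 := h.smooth_φ.continuous
  have h3 := h.smooth_field.continuous
  fun_prop

theorem exists_norm_linGen_le (h : IsShockProfile P vm um vp up) (hvm : 0 < vm) (hvp : 0 < vp)
    (hs : 0 < P.s) (hν : 0 < P.ν) (hε : 0 < P.ε) : ∃ K, ∀ x, ‖P.linGen x‖ ≤ K := by
  obtain ⟨a, ha⟩ := eventually_atBot.1
    (((h.tendsto_linGen hs hν hε (h.endState_atBot hvm)).norm).eventually_le_const
      (lt_add_one _))
  obtain ⟨b, hb⟩ := eventually_atTop.1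
    (((h.tendsto_linGen hs hν hε (h.endState_atTop hvp)).norm).eventually_le_const
      (lt_add_one _))
  obtain ⟨C, hC⟩ := (isCompact_Icc (a := a) (b := b)).exists_bound_of_continuousOn
    (h.continuous_linGen hs hν hε).continuousOn
  refine ⟨max (max (‖gen P.T P.ν P.ε (P.s, vm, 1 / vm, 0)‖ + 1)
    (‖gen P.T P.ν P.ε (P.s, vp, 1 / vp, 0)‖ + 1)) C, fun x => ?_⟩
  rcases le_total x a with hx | hx
  · exact (ha x hx).trans ((le_max_left _ _).trans (le_max_left _ _))
  rcases le_total b x with hx' | hx'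
  · exact (hb x hx').trans ((le_max_right _ _).trans (le_max_left _ _))
  · exact (hC x ⟨hx, hx'⟩).trans (le_max_right _ _)

theorem profileMode_isBigO_one [l.NeBot] (h : IsShockProfile P vm um vp up) (hs : 0 < P.s)
    (hν : 0 < P.ν) (hε : 0 < P.ε) (he : EndState P l v₀) :
    P.profileMode =O[l] (fun _ => (1 : ℝ)) := by
  have h0 : Tendsto (fun x => deriv P.v x / P.v x) l (𝓝 0) := by
    have := (h.tendsto_deriv_v hs hν hε he).div he.2.2.1 he.2.1.ne'
    rw [zero_div] at this
    exact this
  have h1 := h.tendsto_deriv_φ hε he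
  have h2 := tendsto_poisson he
  have : Tendsto P.profileMode l (𝓝 0) := by
    rw [tendsto_pi_nhds]
    intro i
    refine ((Complex.continuous_ofReal.tendsto 0).comp ?_).trans_eq (by simp)
    fin_cases i
    · exact h0
    · exact h1
    · exact h2
  exact this.isBigO_one ℝ

/-- Smallness of the electric field of a weak profile. -/
theorem abs_field_le (h : IsShockProfile P vm um vp up) (hvm : 0 < vm) (hvp : vm < vp)
    (hs : 0 < P.s) (hε : 0 < P.ε) (x : ℝ) :
    |P.field x| ≤ (vp - vm) * (1 / vm ^ 2 + 1 / (vm * P.ε ^ 2)) := by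
  have hvp0 : 0 < vp := hvm.trans hvp
  have hd : ∀ x, |(P.v x * Real.exp (P.φ x) - 1) / P.ε ^ 2| ≤ (vp - vm) / (vm * P.ε ^ 2) := by
    intro x
    have h1 := h.v_mem hs x
    have h2 := h.exp_mem hvm hvp0 x
    rw [abs_div, abs_of_pos (show 0 < P.ε ^ 2 by positivity), ← div_div]
    gcongr
    have h3 : P.v x * Real.exp (P.φ x) ≤ vp * (1 / vm) :=
      mul_le_mul h1.2 h2.2 (Real.exp_pos _).le hvp0.le
    have h4 : vm * (1 / vp) ≤ P.v x * Real.exp (P.φ x) :=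
      mul_le_mul h1.1 h2.1 (by positivity) (h.v_pos x).le
    have h5 : vp * (1 / vm) - 1 = (vp - vm) / vm := by field_simp
    have h6 : vm * (1 / vp) - 1 = -((vp - vm) / vp) := by field_simp; ring
    have h7 : (vp - vm) / vp ≤ (vp - vm) / vm :=
      div_le_div_of_nonneg_left (by linarith) hvm hvp.le
    rw [abs_le]; constructor <;> linarith
  -- The total variation of `φ` bounds the field at some `ξ` within distance one of `x`; Poisson's
  -- law bounds its change between `x` and `ξ`.
  obtain ⟨ξ, hξ, h1⟩ := exists_hasDerivAt_eq_slope P.φ (deriv P.φ) (show x < x + 1 by linarith)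
    (fun y _ => (smooth_hasDerivAt h.smooth_φ y).continuousAt.continuousWithinAt)
    fun y _ => smooth_hasDerivAt h.smooth_φ y
  obtain ⟨ζ, hζ, h2⟩ := exists_hasDerivAt_eq_slope P.field _ hξ.1
    (fun y _ => (h.hasDerivAt_field hε y).continuousAt.continuousWithinAt)
    fun y _ => h.hasDerivAt_field hε y
  have h3 : |deriv P.φ ξ| ≤ (vp - vm) / vm := by
    have h4 := h.φ_mem x
    have h5 := h.φ_mem (x + 1)
    have h6 : Real.log vp - Real.log vm ≤ (vp - vm) / vm := by
      rw [← Real.log_div hvp0.ne' hvm.ne']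
      have := Real.log_le_sub_one_of_pos (show 0 < vp / vm by positivity)
      have h7 : vp / vm - 1 = (vp - vm) / vm := by field_simp
      linarith
    rw [h1]
    simp only [add_sub_cancel_left, div_one]
    rw [abs_le]; constructor <;> linarith
  have h4 : |P.field ξ| ≤ (vp - vm) / vm / vm := by
    rw [Wave.field, abs_div, abs_of_pos (h.v_pos ξ)]
    have h5 := (h.v_mem hs ξ).1
    gcongr
  have h5 : |P.field ξ - P.field x| ≤ (vp - vm) / (vm * P.ε ^ 2) := by
    have h6 : P.field ξ - P.field x = (P.v ζ * Real.exp (P.φ ζ) - 1) / P.ε ^ 2 * (ξ - x) := by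
      rw [h2, div_mul_cancel₀ _ (by linarith [hξ.1])]
    rw [h6, abs_mul]
    refine (mul_le_of_le_one_right (abs_nonneg _) ?_).trans (hd ζ)
    rw [abs_le]; constructor <;> linarith [hξ.1, hξ.2]
  have h6 : (vp - vm) * (1 / vm ^ 2 + 1 / (vm * P.ε ^ 2))
      = (vp - vm) / vm / vm + (vp - vm) / (vm * P.ε ^ 2) := by
    field_simp
  rw [h6]
  rw [abs_le] at h4 h5 ⊢
  constructor <;> linarith [h4.1, h4.2, h5.1, h5.2]

end IsShockProfile

end NSP

/-! ### Equivalence of the linearized profile equation with the reduced equation. -/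

namespace NSP

open LinODE

/-! ### Algebra of the reduced equation -/

theorem reduced_poisson_identity {s ε v v₁ y e : ℂ} (hs : s ≠ 0) (hε : ε ≠ 0) (hv : v ≠ 0)
    (m f Y m' Y' : ℂ) :
    (v₁ * Y + v * Y' + (v₁ * y + v * ((v * e - 1) / ε ^ 2)) * m + v * y * m')
      - (((v₁ * y + v * ((v * e - 1) / ε ^ 2)) / v - 2 * v₁ * (v * y) / v ^ 2 + v * e / ε ^ 2)
          * (-1 / s * (-(s * v) * m))
        + v * y / v * (-1 / s * (-(s * v₁) * m + -(s * v) * m'))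
        + v ^ 2 * e / ε ^ 2 * f + v₁ / v * (v * Y + v * y * m))
      = v * (Y' - (v * e / ε ^ 2 * m + v * e / ε ^ 2 * f)) := by
  field_simp
  ring

/-- Together with `reduced_poisson_identity` this expresses the residuals of the reduced equation
through those of the linearized profile equation by an invertible triangular matrix: the Poisson
residual is `v` times the third one, and the momentum residual is `s ν` times the first plus `ε² /
v` times the third. -/
theorem reduced_momentum_identity {T ν s ε v v₁ y e : ℂ} (hs : s ≠ 0) (hε : ε ≠ 0) (hv : v ≠ 0)
    (hν : ν ≠ 0) (m f Y m' Y' : ℂ) :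
    -((T + 1) / v ^ 2 - ν * (-s * v₁) / v ^ 2 - ε ^ 2 * (v * y) ^ 2 / v ^ 3
        + ε ^ 2 / v * ((v₁ * y + v * ((v * e - 1) / ε ^ 2)) / v ^ 2 - 2 * (v * y) * v₁ / v ^ 3)
        + ε ^ 2 / v ^ 2 * ((v * e - 1) / ε ^ 2)) * (-1 / s * (-(s * v) * m))
      - s * (-(s * v) * m)
      - (ε ^ 2 * (v * y) / v ^ 2 + ε ^ 2 * v₁ / v ^ 3) * (v * Y + v * y * m)
      - -ε ^ 2 / v ^ 2 *
        (v₁ * Y + v * Y' + (v₁ * y + v * ((v * e - 1) / ε ^ 2)) * m + v * y * m')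
      - ε ^ 2 * (v * y) / v ^ 3 * (-1 / s * (-(s * v₁) * m + -(s * v) * m'))
      - ν / v * (-(s * v₁) * m + -(s * v) * m')
      = s * ν * (m' - ((T / v - s ^ 2 * v) / (s * ν) * m + -e / (s * ν) * f
          + ε ^ 2 * y / (s * ν) * Y))
        + ε ^ 2 / v * (Y' - (v * e / ε ^ 2 * m + v * e / ε ^ 2 * f)) := by
  field_simp
  ring

namespace Wave

variable (P : Wave)

theorem b1_eq (x : ℝ) : P.b1 x = P.ε ^ 2 * deriv P.φ x / P.v x ^ 3 := rfl

theorem b2_eq (x : ℝ) : P.b2 x = P.ν / P.v x := rfl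

theorem D21_eq (x : ℝ) :
    P.D21 x = P.ε ^ 2 * deriv P.φ x / P.v x ^ 2 + P.ε ^ 2 * deriv P.v x / P.v x ^ 3 := rfl

theorem E21_eq (x : ℝ) : P.E21 x = -P.ε ^ 2 / P.v x ^ 2 := rfl

/-- The coefficient `g` for which `b₁ v + b₂ u = g (v / v̄)` when `u = -s v`. -/
def slip (x : ℝ) : ℝ := P.ε ^ 2 * deriv P.φ x / P.v x ^ 2 - P.s * P.ν

/-- Passage from the variables of the linearized profile equation to `(u, φ, φ')`. -/
def toReduced : (ℝ → Phase) →ₗ[ℂ] (ℝ → Fin 3 → ℂ) where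
  toFun Z x := ![-((P.s : ℂ) * P.v x) * Z x 0, Z x 1, P.v x * Z x 2 + (deriv P.φ x : ℝ) * Z x 0]
  map_add' Y Z := by
    ext x i
    fin_cases i <;> simp <;> ring
  map_smul' c Z := by
    ext x i
    fin_cases i <;> simp <;> ring

/-- Passage from the variables of the linearized profile equation to `(v, u, ũ', φ, φ')`. -/
def toMode : (ℝ → Phase) →ₗ[ℂ] (ℝ → Fin 5 → ℂ) where
  toFun Z x := ![(P.v x : ℂ) * Z x 0, -((P.s : ℂ) * P.v x) * Z x 0,
    (deriv P.slip x : ℝ) * Z x 0 + P.slip x * P.linGen x (Z x) 0, Z x 1,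
    P.v x * Z x 2 + (deriv P.φ x : ℝ) * Z x 0]
  map_add' Y Z := by
    ext x i
    fin_cases i <;> simp <;> ring
  map_smul' c Z := by
    ext x i
    fin_cases i <;> simp <;> ring

/-- The inverse of `toReduced`. -/
def ofReduced (V : ℝ → Fin 3 → ℂ) (x : ℝ) : Phase :=
  ![-V x 0 / (P.s * P.v x), V x 1,
    (V x 2 - (deriv P.φ x : ℝ) * (-V x 0 / (P.s * P.v x))) / P.v x]

theorem toReduced_apply (Z : ℝ → Phase) (x : ℝ) : P.toReduced Z x =
    ![-((P.s : ℂ) * P.v x) * Z x 0, Z x 1, P.v x * Z x 2 + (deriv P.φ x : ℝ) * Z x 0] := rfl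

theorem toMode_apply (Z : ℝ → Phase) (x : ℝ) : P.toMode Z x =
    ![(P.v x : ℂ) * Z x 0, -((P.s : ℂ) * P.v x) * Z x 0,
      (deriv P.slip x : ℝ) * Z x 0 + P.slip x * P.linGen x (Z x) 0, Z x 1,
      P.v x * Z x 2 + (deriv P.φ x : ℝ) * Z x 0] := rfl

theorem linGen_apply (x : ℝ) (Z : Phase) : P.linGen x Z =
    ![((P.T / P.v x - P.s ^ 2 * P.v x) / (P.s * P.ν) : ℝ) * Z 0
        + (-Real.exp (P.φ x) / (P.s * P.ν) : ℝ) * Z 1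
        + (P.ε ^ 2 * P.field x / (P.s * P.ν) : ℝ) * Z 2,
      (P.v x * P.field x : ℝ) * Z 0 + (P.v x : ℝ) * Z 2,
      (P.v x * Real.exp (P.φ x) / P.ε ^ 2 : ℝ) * Z 0
        + (P.v x * Real.exp (P.φ x) / P.ε ^ 2 : ℝ) * Z 1] := gen_apply _ _ _ _ _ _ _ _

end Wave

namespace IsShockProfile

variable {P : Wave} {vm um vp up : ℝ}

theorem A21_eq (h : IsShockProfile P vm um vp up) (hε : 0 < P.ε) (x : ℝ) :
    P.A21 x = (P.T + 1) / P.v x ^ 2 - P.ν * (-P.s * deriv P.v x) / P.v x ^ 2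
        - P.ε ^ 2 * (P.v x * P.field x) ^ 2 / P.v x ^ 3
        + P.ε ^ 2 / P.v x * ((deriv P.v x * P.field x
            + P.v x * ((P.v x * Real.exp (P.φ x) - 1) / P.ε ^ 2)) / P.v x ^ 2
          - 2 * (P.v x * P.field x) * deriv P.v x / P.v x ^ 3)
        + P.ε ^ 2 / P.v x ^ 2 * ((P.v x * Real.exp (P.φ x) - 1) / P.ε ^ 2) := by
  have hv0 := (h.v_pos x).ne'
  have h1 : deriv (fun y => deriv P.φ y / P.v y ^ 2) x = deriv (deriv P.φ) x / P.v x ^ 2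
      - 2 * deriv P.φ x * deriv P.v x / P.v x ^ 3 := by
    have h2 := (smooth_hasDerivAt (smooth_deriv h.smooth_φ) x).div
      ((smooth_hasDerivAt h.smooth_v x).pow 2) (pow_ne_zero 2 hv0)
    refine (h2.deriv).trans ?_
    simp only [Pi.pow_apply, Nat.cast_ofNat]
    field_simp
    ring
  have h3 : P.A21 x = (P.T + 1) / P.v x ^ 2 - P.ν * deriv P.u x / P.v x ^ 2
        - P.ε ^ 2 * deriv P.φ x ^ 2 / P.v x ^ 3
        + P.ε ^ 2 / P.v x * deriv (fun y => deriv P.φ y / P.v y ^ 2) x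
        + P.ε ^ 2 / P.v x ^ 2 * deriv P.field x := rfl
  rw [h3, h1, h.deriv_field hε, h.deriv_deriv_φ hε, h.deriv_u, h.deriv_φ]

theorem hasDerivAt_toReduced (h : IsShockProfile P vm um vp up) {Z : ℝ → Phase} {Z' : Phase}
    {x : ℝ} (hZ : HasDerivAt Z Z' x) : HasDerivAt (P.toReduced Z)
      ![-((P.s : ℂ) * (deriv P.v x : ℝ)) * Z x 0 + -((P.s : ℂ) * P.v x) * Z' 0, Z' 1,
        (deriv P.v x : ℝ) * Z x 2 + P.v x * Z' 2
          + (deriv (deriv P.φ) x : ℝ) * Z x 0 + (deriv P.φ x : ℝ) * Z' 0] x := by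
  have hc := hasDerivAt_pi.1 hZ
  have hv := (smooth_hasDerivAt h.smooth_v x).ofReal_comp
  have hp := (smooth_hasDerivAt (smooth_deriv h.smooth_φ) x).ofReal_comp
  rw [hasDerivAt_pi]
  intro i
  fin_cases i
  · exact ((hv.const_mul (P.s : ℂ)).neg.mul (hc 0))
  · exact hc 1
  · refine ((hv.mul (hc 2)).add (hp.mul (hc 0))).congr_deriv ?_
    simp; ring

theorem toReduced_ofReduced (h : IsShockProfile P vm um vp up) (hs : 0 < P.s)
    (V : ℝ → Fin 3 → ℂ) : P.toReduced (P.ofReduced V) = V := by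
  have hs0 : (P.s : ℂ) ≠ 0 := Complex.ofReal_ne_zero.2 hs.ne'
  funext x i
  have hv0 : (P.v x : ℂ) ≠ 0 := Complex.ofReal_ne_zero.2 (h.v_pos x).ne'
  rw [Wave.toReduced_apply]
  fin_cases i <;> simp [Wave.ofReduced] <;> field_simp
  ring

theorem ofReduced_toReduced (h : IsShockProfile P vm um vp up) (hs : 0 < P.s)
    (Z : ℝ → Phase) : P.ofReduced (P.toReduced Z) = Z := by
  have hs0 : (P.s : ℂ) ≠ 0 := Complex.ofReal_ne_zero.2 hs.ne'
  funext x i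
  have hv0 : (P.v x : ℂ) ≠ 0 := Complex.ofReal_ne_zero.2 (h.v_pos x).ne'
  fin_cases i <;> simp [Wave.ofReduced, Wave.toReduced_apply] <;> field_simp
  ring

theorem differentiable_ofReduced (h : IsShockProfile P vm um vp up) (hs : 0 < P.s)
    {V : ℝ → Fin 3 → ℂ} (hV : Differentiable ℝ V) : Differentiable ℝ (P.ofReduced V) := by
  have hs0 : (P.s : ℂ) ≠ 0 := Complex.ofReal_ne_zero.2 hs.ne'
  have hv0 : ∀ x, (P.v x : ℂ) ≠ 0 := fun x => Complex.ofReal_ne_zero.2 (h.v_pos x).ne'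
  have hc := differentiable_pi.1 hV
  have h0 := hc 0
  have h1 := hc 1
  have h2 := hc 2
  have hv : Differentiable ℝ fun x => (P.v x : ℂ) := fun x =>
    ((smooth_hasDerivAt h.smooth_v x).ofReal_comp).differentiableAt
  have hp : Differentiable ℝ fun x => ((deriv P.φ x : ℝ) : ℂ) := fun x =>
    ((smooth_hasDerivAt (smooth_deriv h.smooth_φ) x).ofReal_comp).differentiableAt
  have hm : Differentiable ℝ fun x => -V x 0 / (P.s * P.v x) :=
    h0.neg.div (hv.const_mul _) fun x => mul_ne_zero hs0 (hv0 x)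
  rw [differentiable_pi]
  intro i
  fin_cases i
  · exact hm
  · exact h1
  · exact (h2.sub (hp.mul hm)).div hv hv0

/-- The reduced variational equation is the linearized profile equation. -/
theorem isReducedSolution_toReduced_iff (h : IsShockProfile P vm um vp up) (hs : 0 < P.s)
    (hν : 0 < P.ν) (hε : 0 < P.ε) {Z : ℝ → Phase} (hZ : Differentiable ℝ Z) :
    P.IsReducedSolution (P.toReduced Z) ↔ IsSol P.linGen Z := by
  have hs0 : (P.s : ℂ) ≠ 0 := Complex.ofReal_ne_zero.2 hs.ne'
  have hν0 : (P.ν : ℂ) ≠ 0 := Complex.ofReal_ne_zero.2 hν.ne'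
  have hε0 : (P.ε : ℂ) ≠ 0 := Complex.ofReal_ne_zero.2 hε.ne'
  have hv0 : ∀ x, (P.v x : ℂ) ≠ 0 := fun x => Complex.ofReal_ne_zero.2 (h.v_pos x).ne'
  have hd : ∀ x, HasDerivAt Z (deriv Z x) x := fun x => (hZ x).hasDerivAt
  have hR : ∀ x, deriv (P.toReduced Z) x = _ := fun x => (h.hasDerivAt_toReduced (hd x)).deriv
  have hφ' : ∀ x, ((deriv P.φ x : ℝ) : ℂ) = P.v x * P.field x := fun x => by
    rw [h.deriv_φ]; push_cast; rfl
  have hφ'' : ∀ x, ((deriv (deriv P.φ) x : ℝ) : ℂ) = (deriv P.v x : ℝ) * P.field x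
      + P.v x * ((P.v x * (Real.exp (P.φ x) : ℝ) - 1) / P.ε ^ 2) := fun x => by
    rw [h.deriv_deriv_φ hε]; push_cast; rfl
  have hpc : ∀ x, (P.poissonCoeff x : ℂ) =
      ((deriv P.v x : ℝ) * P.field x
        + P.v x * ((P.v x * (Real.exp (P.φ x) : ℝ) - 1) / P.ε ^ 2)) / P.v x
      - 2 * (deriv P.v x : ℝ) * (P.v x * P.field x) / P.v x ^ 2
      + P.v x * (Real.exp (P.φ x) : ℝ) / P.ε ^ 2 := fun x => by
    rw [← hφ'', ← hφ', Wave.poissonCoeff]; push_cast; rfl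
  have hsplit : ∀ x, deriv Z x = P.linGen x (Z x) ↔
      (deriv Z x 0 - ((P.T / P.v x - P.s ^ 2 * P.v x) / (P.s * P.ν) * Z x 0
          + -(Real.exp (P.φ x) : ℝ) / (P.s * P.ν) * Z x 1
          + P.ε ^ 2 * P.field x / (P.s * P.ν) * Z x 2) = 0) ∧
      (deriv Z x 1 = P.v x * Z x 2 + P.v x * P.field x * Z x 0) ∧
      (deriv Z x 2 - (P.v x * (Real.exp (P.φ x) : ℝ) / P.ε ^ 2 * Z x 0
          + P.v x * (Real.exp (P.φ x) : ℝ) / P.ε ^ 2 * Z x 1) = 0) := by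
    intro x
    rw [Wave.linGen_apply]
    constructor
    · intro hx
      refine ⟨?_, ?_, ?_⟩
      · rw [hx]; simp
      · rw [hx]; simp; ring
      · rw [hx]; simp
    · rintro ⟨h0, h1, h2⟩
      ext i
      fin_cases i
      · refine (sub_eq_zero.1 h0).trans ?_
        simp
      · refine h1.trans ?_
        simp; ring
      · refine (sub_eq_zero.1 h2).trans ?_
        simp
  have hpois : ∀ x, deriv (P.toReduced Z) x 2 - (P.poissonCoeff x * (-1 / P.s * P.toReduced Z x 0)
      + ((deriv P.φ x / P.v x : ℝ) : ℂ) * (-1 / P.s * deriv (P.toReduced Z) x 0)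
      + ((P.v x ^ 2 * Real.exp (P.φ x) / P.ε ^ 2 : ℝ) : ℂ) * P.toReduced Z x 1
      + ((deriv P.v x / P.v x : ℝ) : ℂ) * P.toReduced Z x 2)
      = P.v x * (deriv Z x 2 - (P.v x * (Real.exp (P.φ x) : ℝ) / P.ε ^ 2 * Z x 0
          + P.v x * (Real.exp (P.φ x) : ℝ) / P.ε ^ 2 * Z x 1)) := by
    intro x
    rw [hR, Wave.toReduced_apply, hpc, ← reduced_poisson_identity (v₁ := (deriv P.v x : ℝ))
      (y := P.field x) hs0 hε0 (hv0 x) _ _ (Z x 2) (deriv Z x 0)]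
    simp only [Matrix.cons_val, Complex.ofReal_div, Complex.ofReal_mul, Complex.ofReal_pow, hφ',
      hφ'']
  have hmom : ∀ x, -(P.A21 x : ℂ) * (-1 / P.s * P.toReduced Z x 0)
      - P.s * P.toReduced Z x 0 - P.D21 x * P.toReduced Z x 2
      - P.E21 x * deriv (P.toReduced Z) x 2
      - P.b1 x * (-1 / P.s * deriv (P.toReduced Z) x 0)
      - P.b2 x * deriv (P.toReduced Z) x 0
      = P.s * P.ν * (deriv Z x 0 - ((P.T / P.v x - P.s ^ 2 * P.v x) / (P.s * P.ν) * Z x 0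
          + -(Real.exp (P.φ x) : ℝ) / (P.s * P.ν) * Z x 1
          + P.ε ^ 2 * P.field x / (P.s * P.ν) * Z x 2))
        + P.ε ^ 2 / P.v x *
          (deriv Z x 2 - (P.v x * (Real.exp (P.φ x) : ℝ) / P.ε ^ 2 * Z x 0
          + P.v x * (Real.exp (P.φ x) : ℝ) / P.ε ^ 2 * Z x 1)) := by
    intro x
    rw [hR, Wave.toReduced_apply, h.A21_eq hε, P.D21_eq, P.E21_eq, P.b1_eq, P.b2_eq,
      
      ← reduced_momentum_identity (v₁ := (deriv P.v x : ℝ)) hs0 hε0 (hv0 x) hν0]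
    simp only [Matrix.cons_val, hφ', hφ'', Complex.ofReal_div, Complex.ofReal_mul,
      Complex.ofReal_pow, Complex.ofReal_add, Complex.ofReal_sub, Complex.ofReal_neg,
      Complex.ofReal_one, Complex.ofReal_ofNat]
  have hb2 : ∀ x, (P.b2 x : ℂ) ≠ 0 := fun x => Complex.ofReal_ne_zero.2
    (div_pos hν (h.v_pos x)).ne'
  constructor
  · intro hV x
    have h1 := hV.eq_u x
    have h2 := hV.eq_φ x
    have h3 := hpois x
    -- Triangularity fixes the order: the Poisson residual is removed before the momentum relation
    -- can be read.
    rw [sub_eq_zero.2 (hV.eq_φ' x), eq_comm, mul_eq_zero, or_iff_right (hv0 x)] at h3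
    have h4 := hmom x
    rw [h3, mul_zero, add_zero] at h4
    have h5 : (P.s : ℂ) * P.ν * (deriv Z x 0 - ((P.T / P.v x - P.s ^ 2 * P.v x) / (P.s * P.ν)
        * Z x 0 + -(Real.exp (P.φ x) : ℝ) / (P.s * P.ν) * Z x 1
        + P.ε ^ 2 * P.field x / (P.s * P.ν) * Z x 2)) = 0 := by
      rw [← h4]
      rw [one_div, ← div_eq_inv_mul, eq_div_iff (hb2 x)] at h1
      push_cast at h1 ⊢
      linear_combination -h1
    rw [mul_eq_zero, or_iff_right (mul_ne_zero hs0 hν0)] at h5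
    refine (hd x).congr_deriv ((hsplit x).2 ⟨h5, ?_, h3⟩)
    rw [hR, Wave.toReduced_apply] at h2
    simp only [Matrix.cons_val] at h2
    rw [h2, hφ']
  · intro hS
    have hs' : ∀ x, deriv Z x = P.linGen x (Z x) := fun x => (hS x).deriv
    refine ⟨fun x => (h.hasDerivAt_toReduced (hd x)).differentiableAt, fun x => ?_, fun x => ?_,
      fun x => ?_⟩
    · obtain ⟨h0, -, h2⟩ := (hsplit x).1 (hs' x)
      have h4 := hmom x
      rw [h0, h2, mul_zero, mul_zero, add_zero] at h4
      rw [one_div, ← div_eq_inv_mul, eq_div_iff (hb2 x)]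
      push_cast at h4 ⊢
      linear_combination -h4
    · obtain ⟨-, h1, -⟩ := (hsplit x).1 (hs' x)
      rw [hR, Wave.toReduced_apply]
      simp only [Matrix.cons_val]
      rw [h1, hφ']
    · obtain ⟨-, -, h2⟩ := (hsplit x).1 (hs' x)
      have h3 := hpois x
      rw [h2, mul_zero] at h3
      exact sub_eq_zero.1 h3

end IsShockProfile

end NSP

/-! ### Passage to and from the five-dimensional eigenvalue system. -/

namespace NSP

open LinODE

theorem exists_bound_of_isBigO_atTop {E : Type*} [NormedAddCommGroup E] {f : ℝ → E} {g : ℝ → ℝ}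
    (hf : Continuous f) (hg : Continuous g) (hpos : ∀ x, 0 < g x) (h : f =O[atTop] g) (a : ℝ) :
    ∃ C, ∀ x, a ≤ x → ‖f x‖ ≤ C * g x := by
  obtain ⟨c, hc⟩ := h.bound
  obtain ⟨b, hb⟩ := eventually_atTop.1 hc
  obtain ⟨C, hC⟩ := (isCompact_Icc (a := a) (b := b)).exists_bound_of_continuousOn
    ((hf.norm.div hg fun x => (hpos x).ne').continuousOn)
  refine ⟨max c C, fun x hx => ?_⟩
  rcases le_total b x with h1 | h1
  · refine (hb x h1).trans ?_
    rw [Real.norm_of_nonneg (hpos x).le]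
    exact mul_le_mul_of_nonneg_right (le_max_left _ _) (hpos x).le
  · have h2 := (le_abs_self _).trans (hC x ⟨hx, h1⟩)
    rw [Pi.div_apply, div_le_iff₀ (hpos x)] at h2
    exact h2.trans (mul_le_mul_of_nonneg_right (le_max_right _ _) (hpos x).le)

theorem exists_bound_of_isBigO_atBot {E : Type*} [NormedAddCommGroup E] {f : ℝ → E} {g : ℝ → ℝ}
    (hf : Continuous f) (hg : Continuous g) (hpos : ∀ x, 0 < g x) (h : f =O[atBot] g) (a : ℝ) :
    ∃ C, ∀ x, x ≤ a → ‖f x‖ ≤ C * g x := by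
  obtain ⟨C, hC⟩ := exists_bound_of_isBigO_atTop (hf.comp continuous_neg)
    (hg.comp continuous_neg) (fun x => hpos (-x)) (h.comp_tendsto tendsto_neg_atTop_atBot) (-a)
  refine ⟨C, fun x hx => ?_⟩
  simpa using hC (-x) (by linarith)

namespace IsShockProfile

variable {P : Wave} {vm um vp up : ℝ} {l : Filter ℝ} {v₀ : ℝ}

/-- Continuous expressions in the profile have limits at the end states. -/
theorem tendsto_coeff [l.NeBot] (h : IsShockProfile P vm um vp up) (hs : 0 < P.s)
    (hν : 0 < P.ν) (hε : 0 < P.ε) (he : EndState P l v₀) {F : ℝ × ℝ × ℝ × ℝ → ℝ}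
    (hF : ContinuousAt F (v₀, 0, 0, 1 / v₀)) {f : ℝ → ℝ}
    (hf : ∀ x, f x = F (P.v x, deriv P.v x, P.field x, Real.exp (P.φ x))) :
    ∃ a, Tendsto (fun x => (f x : ℂ)) l (𝓝 a) := by
  rw [funext hf]
  exact ⟨_, (hF.tendsto.comp (he.2.2.1.prodMk_nhds ((h.tendsto_deriv_v hs hν hε he).prodMk_nhds
    ((h.tendsto_field hε he).prodMk_nhds (tendsto_exp he))))).ofReal⟩

theorem deriv_b1 (h : IsShockProfile P vm um vp up) (x : ℝ) :
    deriv P.b1 x = P.ε ^ 2 * deriv (deriv P.φ) x / P.v x ^ 3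
      - 3 * P.ε ^ 2 * deriv P.φ x * deriv P.v x / P.v x ^ 4 := by
  have hv0 := (h.v_pos x).ne'
  have h2 := ((smooth_hasDerivAt (smooth_deriv h.smooth_φ) x).const_mul (P.ε ^ 2)).div
    ((smooth_hasDerivAt h.smooth_v x).pow 3) (pow_ne_zero 3 hv0)
  refine (h2.deriv).trans ?_
  simp only [Pi.pow_apply, Nat.cast_ofNat]
  field_simp
  ring

theorem deriv_b2 (h : IsShockProfile P vm um vp up) (x : ℝ) :
    deriv P.b2 x = -P.ν * deriv P.v x / P.v x ^ 2 := by
  have hv0 := (h.v_pos x).ne'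
  have h2 := (hasDerivAt_const x P.ν).div (smooth_hasDerivAt h.smooth_v x) hv0
  refine (h2.deriv).trans ?_
  ring

theorem deriv_slip (h : IsShockProfile P vm um vp up) (x : ℝ) :
    deriv P.slip x = P.ε ^ 2 * deriv (deriv P.φ) x / P.v x ^ 2
      - 2 * P.ε ^ 2 * deriv P.φ x * deriv P.v x / P.v x ^ 3 := by
  have hv0 := (h.v_pos x).ne'
  have h2 := (((smooth_hasDerivAt (smooth_deriv h.smooth_φ) x).const_mul (P.ε ^ 2)).div
    ((smooth_hasDerivAt h.smooth_v x).pow 2) (pow_ne_zero 2 hv0)).sub_const (P.s * P.ν)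
  refine (h2.deriv).trans ?_
  simp only [Pi.pow_apply, Nat.cast_ofNat]
  field_simp
  ring

theorem smooth_b1 (h : IsShockProfile P vm um vp up) : ContDiff ℝ (⊤ : ℕ∞) P.b1 :=
  (contDiff_const.mul (smooth_deriv h.smooth_φ)).div (h.smooth_v.pow 3)
    fun x => pow_ne_zero 3 (h.v_pos x).ne'

theorem smooth_b2 (h : IsShockProfile P vm um vp up) : ContDiff ℝ (⊤ : ℕ∞) P.b2 :=
  contDiff_const.div h.smooth_v fun x => (h.v_pos x).ne'

theorem smooth_slip (h : IsShockProfile P vm um vp up) : ContDiff ℝ (⊤ : ℕ∞) P.slip :=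
  ((contDiff_const.mul (smooth_deriv h.smooth_φ)).div (h.smooth_v.pow 2)
    fun x => pow_ne_zero 2 (h.v_pos x).ne').sub contDiff_const

theorem slip_neg (h : IsShockProfile P vm um vp up) (hs : 0 < P.s) (hν : 0 < P.ν) (x : ℝ) :
    P.slip x < 0 := by
  have h1 := h.deriv_φ_neg x
  have h2 := h.v_pos x
  have h3 : P.ε ^ 2 * deriv P.φ x / P.v x ^ 2 ≤ 0 :=
    div_nonpos_of_nonpos_of_nonneg (mul_nonpos_of_nonneg_of_nonpos (sq_nonneg _) h1.le)
      (sq_nonneg _)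
  have h4 := mul_pos hs hν
  rw [Wave.slip]
  linarith

theorem slip_eq (h : IsShockProfile P vm um vp up) (x : ℝ) :
    P.slip x = P.b1 x * P.v x - P.b2 x * (P.s * P.v x) := by
  have := (h.v_pos x).ne'
  rw [Wave.slip, P.b1_eq, P.b2_eq]
  field_simp

theorem differentiable_ofReal {f : ℝ → ℝ} (hf : ContDiff ℝ (⊤ : ℕ∞) f) :
    Differentiable ℝ fun x => (f x : ℂ) := fun x =>
  ((smooth_hasDerivAt hf x).ofReal_comp).differentiableAt

theorem toMode_eq (hs : 0 < P.s) (Z : ℝ → Phase) (x : ℝ) :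
    P.toMode Z x = ![-1 / P.s * P.toReduced Z x 0, P.toReduced Z x 0,
      (deriv P.slip x : ℝ) * Z x 0 + P.slip x * P.linGen x (Z x) 0,
      P.toReduced Z x 1, P.toReduced Z x 2] := by
  have hs0 : (P.s : ℂ) ≠ 0 := Complex.ofReal_ne_zero.2 hs.ne'
  rw [Wave.toMode_apply, Wave.toReduced_apply]
  ext i
  fin_cases i <;> simp
  field_simp

theorem differentiable_toMode_two (h : IsShockProfile P vm um vp up) {Z : ℝ → Phase} (hZ : IsSol P.linGen Z) :
    Differentiable ℝ fun x => (deriv P.slip x : ℝ) * Z x 0 + P.slip x * P.linGen x (Z x) 0 := by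
  have hc : ∀ i, Differentiable ℝ fun x => Z x i :=
    differentiable_pi.1 fun x => (hZ x).differentiableAt
  have h0 := hc 0
  have h1 := hc 1
  have h2 := hc 2
  have hg := differentiable_ofReal h.smooth_slip
  have hg' := differentiable_ofReal (smooth_deriv h.smooth_slip)
  have hv0 : ∀ x, P.v x ≠ 0 := fun x => (h.v_pos x).ne'
  have ha : Differentiable ℝ fun x =>
      (((P.T / P.v x - P.s ^ 2 * P.v x) / (P.s * P.ν) : ℝ) : ℂ) :=
    differentiable_ofReal (((contDiff_const.div h.smooth_v hv0).sub
      (contDiff_const.mul h.smooth_v)).div_const _)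
  have hb : Differentiable ℝ fun x => ((-Real.exp (P.φ x) / (P.s * P.ν) : ℝ) : ℂ) :=
    differentiable_ofReal (h.smooth_φ.exp.neg.div_const _)
  have hd : Differentiable ℝ fun x => ((P.ε ^ 2 * P.field x / (P.s * P.ν) : ℝ) : ℂ) :=
    differentiable_ofReal ((contDiff_const.mul h.smooth_field).div_const _)
  have he : (fun x => (deriv P.slip x : ℝ) * Z x 0 + P.slip x * P.linGen x (Z x) 0) = fun x =>
      (deriv P.slip x : ℝ) * Z x 0 + P.slip x *
        (((P.T / P.v x - P.s ^ 2 * P.v x) / (P.s * P.ν) : ℝ) * Z x 0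
        + (-Real.exp (P.φ x) / (P.s * P.ν) : ℝ) * Z x 1
        + (P.ε ^ 2 * P.field x / (P.s * P.ν) : ℝ) * Z x 2) := by
    funext x; rw [Wave.linGen_apply]; rfl
  rw [he]
  exact (hg'.mul h0).add (hg.mul (((ha.mul h0).add (hb.mul h1)).add (hd.mul h2)))

/-- The third component of `toMode Z` is the derivative of `b₁ v + b₂ u`. -/
theorem toMode_two_eq (h : IsShockProfile P vm um vp up) (hs : 0 < P.s)
    {Z : ℝ → Phase} (hZ : IsSol P.linGen Z) (x : ℝ) :
    (deriv P.slip x : ℝ) * Z x 0 + P.slip x * P.linGen x (Z x) 0 =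
      (deriv P.b1 x : ℝ) * (-1 / P.s * P.toReduced Z x 0)
        + P.b1 x * (-1 / P.s * deriv (P.toReduced Z) x 0)
        + (deriv P.b2 x : ℝ) * P.toReduced Z x 0 + P.b2 x * deriv (P.toReduced Z) x 0 := by
  have hs0 : (P.s : ℂ) ≠ 0 := Complex.ofReal_ne_zero.2 hs.ne'
  have hV := hasDerivAt_pi.1
    (h.hasDerivAt_toReduced (hZ x)).differentiableAt.hasDerivAt 0
  have h1 := ((smooth_hasDerivAt h.smooth_b1 x).ofReal_comp.mul (hV.const_mul (-1 / P.s : ℂ))).add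
    ((smooth_hasDerivAt h.smooth_b2 x).ofReal_comp.mul hV)
  have h2 := (smooth_hasDerivAt h.smooth_slip x).ofReal_comp.mul (hasDerivAt_pi.1 (hZ x) 0)
  have he : (fun x => (P.slip x : ℂ) * Z x 0) = fun x =>
      P.b1 x * (-1 / P.s * P.toReduced Z x 0) + P.b2 x * P.toReduced Z x 0 := by
    funext y
    rw [h.slip_eq, Wave.toReduced_apply]
    simp only [Matrix.cons_val]
    push_cast
    field_simp
    ring
  have h3 : HasDerivAt (fun x => (P.slip x : ℂ) * Z x 0) _ x := h2
  rw [he] at h3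
  refine (h3.unique h1).trans ?_
  ring

theorem isModeSolution_toMode (h : IsShockProfile P vm um vp up) (hs : 0 < P.s)
    (hν : 0 < P.ν) (hε : 0 < P.ε) {Z : ℝ → Phase} (hZ : IsSol P.linGen Z) :
    P.IsModeSolution 0 (P.toMode Z) := by
  have hs0 : (P.s : ℂ) ≠ 0 := Complex.ofReal_ne_zero.2 hs.ne'
  have hZd : Differentiable ℝ Z := fun x => (hZ x).differentiableAt
  have hR := (h.isReducedSolution_toReduced_iff hs hν hε hZd).2 hZ
  have hb2 : ∀ x, (P.b2 x : ℂ) ≠ 0 := fun x => Complex.ofReal_ne_zero.2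
    (div_pos hν (h.v_pos x)).ne'
  set V := P.toReduced Z with hVdef
  have hV : ∀ x i, HasDerivAt (fun x => V x i) (deriv V x i) x := fun x i =>
    hasDerivAt_pi.1 (hR.differentiable x).hasDerivAt i
  have hWi : ∀ i, (fun x => P.toMode Z x i) = fun x => (![-1 / P.s * V x 0, V x 0,
      (deriv P.slip x : ℝ) * Z x 0 + P.slip x * P.linGen x (Z x) 0, V x 1, V x 2] : Fin 5 → ℂ) i :=
    fun i => by funext x; rw [toMode_eq hs]
  have hW : ∀ x, HasDerivAt (P.toMode Z) ![-1 / P.s * deriv V x 0, deriv V x 0,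
      deriv (fun x => (deriv P.slip x : ℝ) * Z x 0 + P.slip x * P.linGen x (Z x) 0) x,
      deriv V x 1, deriv V x 2] x := by
    intro x
    rw [hasDerivAt_pi]
    intro i
    rw [hWi]
    fin_cases i
    · exact (hV x 0).const_mul _
    · exact hV x 0
    · exact (h.differentiable_toMode_two hZ x).hasDerivAt
    · exact hV x 1
    · exact hV x 2
  -- The reduced `u`-equation, multiplied by `b₂`, equates the integrated momentum flux with the
  -- derivative of `b₁ v + b₂ u`. The third equation of the system is then the derivative of an
  -- identity.
  have hexpr : ∀ y, ((deriv P.b1 y - P.A21 y : ℝ) : ℂ) * (-1 / P.s * V y 0)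
      + ((deriv P.b2 y - P.s : ℝ) : ℂ) * V y 0 - P.D21 y * V y 2 - P.E21 y * deriv V y 2
      = (deriv P.slip y : ℝ) * Z y 0 + P.slip y * P.linGen y (Z y) 0 := by
    intro y
    have h1 := hR.eq_u y
    rw [one_div, ← div_eq_inv_mul, eq_div_iff (hb2 y)] at h1
    rw [h.toMode_two_eq hs hZ]
    linear_combination -h1
  refine ⟨fun x => (hW x).differentiableAt, fun x => ?_, fun x => ?_, fun x => ?_, fun x => ?_,
    fun x => ?_⟩
  · rw [(hW x).deriv]
    simp only [Matrix.cons_val]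
    ring
  · rw [(hW x).deriv, toMode_eq hs, one_div, ← div_eq_inv_mul, eq_div_iff (hb2 x)]
    simp only [Matrix.cons_val]
    rw [h.toMode_two_eq hs hZ]
    ring
  · have he : (fun y => ((deriv P.b1 y - P.A21 y : ℝ) : ℂ) * P.toMode Z y 0
        + ((deriv P.b2 y - P.s : ℝ) : ℂ) * P.toMode Z y 1
        - P.D21 y * P.toMode Z y 4 - P.E21 y * deriv (P.toMode Z) y 4) = fun y =>
        (deriv P.slip y : ℝ) * Z y 0 + P.slip y * P.linGen y (Z y) 0 := by
      funext y
      rw [(hW y).deriv, toMode_eq hs, ← hexpr]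
      simp only [Matrix.cons_val, hVdef]
    rw [he, (hW x).deriv]
    simp only [Matrix.cons_val, zero_mul, sub_zero]
    exact (h.differentiable_toMode_two hZ x).hasDerivAt
  · rw [(hW x).deriv, toMode_eq hs]
    simp only [Matrix.cons_val]
    exact hR.eq_φ x
  · rw [(hW x).deriv, toMode_eq hs]
    simp only [Matrix.cons_val]
    exact hR.eq_φ' x

theorem eq_zero_of_deriv_eq_zero_of_tendsto [l.NeBot] {f : ℝ → ℂ}
    (hf : ∀ x, HasDerivAt f 0 x) (hl : Tendsto f l (𝓝 0)) (x : ℝ) : f x = 0 := by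
  have h1 : ∀ y, f y = f x := fun y =>
    is_const_of_deriv_eq_zero (fun z => (hf z).differentiableAt) (fun z => (hf z).deriv) y x
  rw [funext h1] at hl
  exact tendsto_nhds_unique tendsto_const_nhds hl

theorem tendsto_mul_zero {f g : ℝ → ℂ} (hf : ∃ a, Tendsto f l (𝓝 a)) (hg : Tendsto g l (𝓝 0)) :
    Tendsto (fun x => f x * g x) l (𝓝 0) := by
  obtain ⟨a, ha⟩ := hf
  simpa using ha.mul hg

/-- Solutions of the eigenvalue equation at `0` vanishing at an end state come from the
linearized profile equation. -/
theorem exists_isSol_of_isModeSolution [l.NeBot] (h : IsShockProfile P vm um vp up) (hs : 0 < P.s)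
    (hν : 0 < P.ν) (hε : 0 < P.ε) (he : EndState P l v₀) {W : ℝ → Fin 5 → ℂ}
    (hW : P.IsModeSolution 0 W) (hlim : Tendsto W l (𝓝 0)) :
    ∃ Z, IsSol P.linGen Z ∧ P.toMode Z = W := by
  have hs0 : (P.s : ℂ) ≠ 0 := Complex.ofReal_ne_zero.2 hs.ne'
  have hb2 : ∀ x, (P.b2 x : ℂ) ≠ 0 := fun x => Complex.ofReal_ne_zero.2
    (div_pos hν (h.v_pos x)).ne'
  have hv₀ : v₀ ≠ 0 := he.2.1.ne'
  have hWd : ∀ x i, HasDerivAt (fun x => W x i) (deriv W x i) x := fun x i =>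
    hasDerivAt_pi.1 (hW.differentiable x).hasDerivAt i
  have hl : ∀ i, Tendsto (fun x => W x i) l (𝓝 0) := fun i => by
    simpa using tendsto_pi_nhds.1 hlim i
  have hv' : ∀ x, deriv W x 0 = -1 / P.s * deriv W x 1 := fun x => by
    rw [hW.eq_v]; ring
  -- First integral from mass conservation; decay at the one end `l` fixes its constant.
  have hmass : ∀ x, P.s * W x 0 + W x 1 = 0 := by
    refine eq_zero_of_deriv_eq_zero_of_tendsto (l := l) (fun x => ?_) ?_
    · refine (((hWd x 0).const_mul (P.s : ℂ)).add (hWd x 1)).congr_deriv ?_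
      rw [hv']; field_simp; ring
    · simpa using ((hl 0).const_mul (P.s : ℂ)).add (hl 1)
  have hW0 : ∀ x, W x 0 = -1 / P.s * W x 1 := fun x => by
    have := hmass x
    field_simp
    linear_combination this
  -- The relations for `v'` and `u'` are implicit in each other; eliminating `v'` leaves the factor
  -- `slip / v`, which never vanishes.
  have hslip : ∀ x, (P.slip x : ℂ) / P.v x * deriv W x 1 = -P.s *
      (W x 2 - (deriv P.b1 x : ℝ) * W x 0 - (deriv P.b2 x : ℝ) * W x 1) := by
    intro x
    have hv0 : (P.v x : ℂ) ≠ 0 := Complex.ofReal_ne_zero.2 (h.v_pos x).ne'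
    have h1 := hW.eq_u x
    rw [one_div, ← div_eq_inv_mul, eq_div_iff (hb2 x), hv'] at h1
    rw [h.slip_eq]
    push_cast
    field_simp at h1 ⊢
    linear_combination -h1
  have cb1 : ∃ a, Tendsto (fun x => ((deriv P.b1 x : ℝ) : ℂ)) l (𝓝 a) :=
    h.tendsto_coeff hs hν hε he (F := fun q => P.ε ^ 2 * (q.2.1 * q.2.2.1
      + q.1 * ((q.1 * q.2.2.2 - 1) / P.ε ^ 2)) / q.1 ^ 3
      - 3 * P.ε ^ 2 * (q.1 * q.2.2.1) * q.2.1 / q.1 ^ 4)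
      (by fun_prop (disch := simp [hv₀, hε.ne'])) fun x => by
        rw [h.deriv_b1, h.deriv_deriv_φ hε, h.deriv_φ]
  have cb2 : ∃ a, Tendsto (fun x => ((deriv P.b2 x : ℝ) : ℂ)) l (𝓝 a) :=
    h.tendsto_coeff hs hν hε he (F := fun q => -P.ν * q.2.1 / q.1 ^ 2)
      (by fun_prop (disch := simp [hv₀])) h.deriv_b2
  have cslip : ∃ a, Tendsto (fun x => (((-P.s / (P.slip x / P.v x) : ℝ)) : ℂ)) l (𝓝 a) :=
    h.tendsto_coeff hs hν hε he
      (F := fun q => -P.s / ((P.ε ^ 2 * (q.1 * q.2.2.1) / q.1 ^ 2 - P.s * P.ν) / q.1))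
      (by fun_prop (disch := simp [hv₀, hs.ne', hν.ne'])) fun x => by
        rw [Wave.slip, h.deriv_φ]
  have lu' : Tendsto (fun x => deriv W x 1) l (𝓝 0) := by
    have h1 : (fun x => deriv W x 1) = fun x => (((-P.s / (P.slip x / P.v x) : ℝ)) : ℂ) *
        (W x 2 - (deriv P.b1 x : ℝ) * W x 0 - (deriv P.b2 x : ℝ) * W x 1) := by
      funext x
      have hv0 : (P.v x : ℂ) ≠ 0 := Complex.ofReal_ne_zero.2 (h.v_pos x).ne'
      have hg0 : (P.slip x : ℂ) ≠ 0 := Complex.ofReal_ne_zero.2 (h.slip_neg hs hν x).ne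
      have h2 := hslip x
      push_cast
      field_simp at h2 ⊢
      linear_combination h2
    rw [h1]
    refine tendsto_mul_zero cslip ?_
    simpa using ((hl 2).sub (tendsto_mul_zero cb1 (hl 0))).sub (tendsto_mul_zero cb2 (hl 1))
  have lv' : Tendsto (fun x => deriv W x 0) l (𝓝 0) := by
    rw [funext hv']
    simpa using lu'.const_mul (-1 / P.s : ℂ)
  have cpc : ∃ a, Tendsto (fun x => (P.poissonCoeff x : ℂ)) l (𝓝 a) :=
    h.tendsto_coeff hs hν hε he (F := fun q => (q.2.1 * q.2.2.1
      + q.1 * ((q.1 * q.2.2.2 - 1) / P.ε ^ 2)) / q.1 - 2 * q.2.1 * (q.1 * q.2.2.1) / q.1 ^ 2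
      + q.1 * q.2.2.2 / P.ε ^ 2)
      (by fun_prop (disch := simp [hv₀, hε.ne'])) fun x => by
        rw [Wave.poissonCoeff, h.deriv_deriv_φ hε, h.deriv_φ]
  have cf : ∃ a, Tendsto (fun x => ((deriv P.φ x / P.v x : ℝ) : ℂ)) l (𝓝 a) :=
    h.tendsto_coeff hs hν hε he (F := fun q => q.2.2.1) (by fun_prop) fun x => rfl
  have ce : ∃ a, Tendsto (fun x => ((P.v x ^ 2 * Real.exp (P.φ x) / P.ε ^ 2 : ℝ) : ℂ)) l (𝓝 a) :=
    h.tendsto_coeff hs hν hε he (F := fun q => q.1 ^ 2 * q.2.2.2 / P.ε ^ 2)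
      (by fun_prop (disch := simp [hε.ne'])) fun x => rfl
  have cvv : ∃ a, Tendsto (fun x => ((deriv P.v x / P.v x : ℝ) : ℂ)) l (𝓝 a) :=
    h.tendsto_coeff hs hν hε he (F := fun q => q.2.1 / q.1)
      (by fun_prop (disch := simp [hv₀])) fun x => rfl
  have lp' : Tendsto (fun x => deriv W x 4) l (𝓝 0) := by
    rw [funext hW.eq_φ']
    simpa using (((tendsto_mul_zero cpc (hl 0)).add (tendsto_mul_zero cf lv')).add
      (tendsto_mul_zero ce (hl 3))).add (tendsto_mul_zero cvv (hl 4))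
  have cA : ∃ a, Tendsto (fun x => ((deriv P.b1 x - P.A21 x : ℝ) : ℂ)) l (𝓝 a) := by
    obtain ⟨a, ha⟩ := cb1
    obtain ⟨b, hb⟩ := h.tendsto_coeff hs hν hε he (f := P.A21)
      (F := fun q => (P.T + 1) / q.1 ^ 2 - P.ν * (-P.s * q.2.1) / q.1 ^ 2
        - P.ε ^ 2 * (q.1 * q.2.2.1) ^ 2 / q.1 ^ 3
        + P.ε ^ 2 / q.1 * ((q.2.1 * q.2.2.1
            + q.1 * ((q.1 * q.2.2.2 - 1) / P.ε ^ 2)) / q.1 ^ 2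
          - 2 * (q.1 * q.2.2.1) * q.2.1 / q.1 ^ 3)
        + P.ε ^ 2 / q.1 ^ 2 * ((q.1 * q.2.2.2 - 1) / P.ε ^ 2))
      (by fun_prop (disch := simp [hv₀, hε.ne'])) (h.A21_eq hε)
    exact ⟨a - b, by simpa using ha.sub hb⟩
  have cB : ∃ a, Tendsto (fun x => ((deriv P.b2 x - P.s : ℝ) : ℂ)) l (𝓝 a) := by
    obtain ⟨a, ha⟩ := cb2
    exact ⟨a - P.s, by simpa using ha.sub_const (P.s : ℂ)⟩
  have cD : ∃ a, Tendsto (fun x => (P.D21 x : ℂ)) l (𝓝 a) :=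
    h.tendsto_coeff hs hν hε he (F := fun q => P.ε ^ 2 * (q.1 * q.2.2.1) / q.1 ^ 2
      + P.ε ^ 2 * q.2.1 / q.1 ^ 3) (by fun_prop (disch := simp [hv₀])) fun x => by
        rw [P.D21_eq, h.deriv_φ]
  have cE : ∃ a, Tendsto (fun x => (P.E21 x : ℂ)) l (𝓝 a) :=
    h.tendsto_coeff hs hν hε he (F := fun q => -P.ε ^ 2 / q.1 ^ 2)
      (by fun_prop (disch := simp [hv₀])) P.E21_eq
  -- First integral from momentum conservation. It involves `φ''`, so the derivatives of `W` had to
  -- be shown to vanish at the end state as well.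
  have hmom : ∀ x, ((deriv P.b1 x - P.A21 x : ℝ) : ℂ) * W x 0
      + ((deriv P.b2 x - P.s : ℝ) : ℂ) * W x 1 - P.D21 x * W x 4 - P.E21 x * deriv W x 4
      - W x 2 = 0 := by
    refine eq_zero_of_deriv_eq_zero_of_tendsto (l := l) (fun x => ?_) ?_
    · refine ((hW.eq_ut x).sub (hWd x 2)).congr_deriv ?_
      ring
    · simpa using ((((tendsto_mul_zero cA (hl 0)).add (tendsto_mul_zero cB (hl 1))).sub
        (tendsto_mul_zero cD (hl 4))).sub (tendsto_mul_zero cE lp')).sub (hl 2)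
  set V : ℝ → Fin 3 → ℂ := fun x => ![W x 1, W x 3, W x 4] with hV
  have hVd : ∀ x, HasDerivAt V ![deriv W x 1, deriv W x 3, deriv W x 4] x := by
    intro x
    rw [hasDerivAt_pi]
    intro i
    fin_cases i
    · exact hWd x 1
    · exact hWd x 3
    · exact hWd x 4
  have hVdiff : Differentiable ℝ V := fun x => (hVd x).differentiableAt
  have hVR : P.IsReducedSolution V := by
    refine ⟨hVdiff, fun x => ?_, fun x => ?_, fun x => ?_⟩
    · rw [(hVd x).deriv]
      have h1 := hW.eq_u x
      have h2 := hmom x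
      simp only [hV, Matrix.cons_val]
      rw [← hW0 x, ← hv' x, sub_eq_zero.1 h2]
      exact h1
    · rw [(hVd x).deriv]
      exact hW.eq_φ x
    · rw [(hVd x).deriv]
      simp only [hV, Matrix.cons_val]
      rw [← hW0 x, ← hv' x]
      exact hW.eq_φ' x
  have hZV := h.toReduced_ofReduced hs V
  have hZ : IsSol P.linGen (P.ofReduced V) := by
    rw [← h.isReducedSolution_toReduced_iff hs hν hε (h.differentiable_ofReduced hs hVdiff), hZV]
    exact hVR
  refine ⟨P.ofReduced V, hZ, ?_⟩
  funext x
  rw [toMode_eq hs, h.toMode_two_eq hs hZ, hZV, (hVd x).deriv]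
  ext i
  fin_cases i
  · exact (hW0 x).symm
  · rfl
  · have h1 := hW.eq_u x
    rw [one_div, ← div_eq_inv_mul, eq_div_iff (hb2 x)] at h1
    simp only [Fin.reduceFinMk, Matrix.cons_val, hV]
    rw [← hW0 x, ← hv' x]
    linear_combination h1
  · rfl
  · rfl

end IsShockProfile

end NSP

/-! ### Growth and decay classes under the change of variables. -/

namespace NSP

open LinODE

namespace IsShockProfile

variable {P : Wave} {vm um vp up : ℝ} {l : Filter ℝ} {v₀ : ℝ}

theorem isBigO_coeff_mul {c f : ℝ → ℂ} {g : ℝ → ℝ} (hc : ∃ a, Tendsto c l (𝓝 a))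
    (hf : f =O[l] g) : (fun x => c x * f x) =O[l] g := by
  obtain ⟨a, ha⟩ := hc
  simpa using (ha.isBigO_one ℝ).mul hf

theorem exists_tendsto_v (he : EndState P l v₀) : ∃ a, Tendsto (fun x => (P.v x : ℂ)) l (𝓝 a) :=
  ⟨_, he.2.2.1.ofReal⟩

theorem exists_tendsto_deriv_φ (h : IsShockProfile P vm um vp up) (hε : 0 < P.ε)
    (he : EndState P l v₀) : ∃ a, Tendsto (fun x => ((deriv P.φ x : ℝ) : ℂ)) l (𝓝 a) :=
  ⟨_, (h.tendsto_deriv_φ hε he).ofReal⟩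

theorem isBigO_toReduced (h : IsShockProfile P vm um vp up) (hε : 0 < P.ε)
    (he : EndState P l v₀) {Z : ℝ → Phase} {g : ℝ → ℝ} (hZ : Z =O[l] g) :
    P.toReduced Z =O[l] g := by
  have hc := isBigO_pi.1 hZ
  rw [isBigO_pi]
  intro i
  have h0 := isBigO_coeff_mul (exists_tendsto_v he) (hc 0)
  have h2 := isBigO_coeff_mul (exists_tendsto_v he) (hc 2)
  have h3 := isBigO_coeff_mul (h.exists_tendsto_deriv_φ hε he) (hc 0)
  fin_cases i
  · refine (h0.const_mul_left (-(P.s : ℂ))).congr_left fun x => ?_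
    rw [Wave.toReduced_apply]
    simp [mul_assoc]
  · exact hc 1
  · exact h2.add h3

theorem isBigO_of_toReduced (h : IsShockProfile P vm um vp up) (hs : 0 < P.s) (hε : 0 < P.ε)
    (he : EndState P l v₀) {Z : ℝ → Phase} {g : ℝ → ℝ} (hZ : P.toReduced Z =O[l] g) :
    Z =O[l] g := by
  have hs0 : (P.s : ℂ) ≠ 0 := Complex.ofReal_ne_zero.2 hs.ne'
  have hv₀ : (v₀ : ℂ) ≠ 0 := Complex.ofReal_ne_zero.2 he.2.1.ne'
  have hc := isBigO_pi.1 hZ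
  have hinv : ∃ a, Tendsto (fun x => (P.v x : ℂ)⁻¹) l (𝓝 a) := ⟨_, he.2.2.1.ofReal.inv₀ hv₀⟩
  have h0 : (fun x => -P.toReduced Z x 0 / (P.s * P.v x)) =O[l] g := by
    refine ((isBigO_coeff_mul hinv (hc 0)).const_mul_left (-(P.s : ℂ)⁻¹)).congr_left fun x => ?_
    have hv0 : (P.v x : ℂ) ≠ 0 := Complex.ofReal_ne_zero.2 (h.v_pos x).ne'
    field_simp
  have h2 := isBigO_coeff_mul hinv
    ((hc 2).sub (isBigO_coeff_mul (h.exists_tendsto_deriv_φ hε he) h0))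
  rw [← h.ofReduced_toReduced hs Z, isBigO_pi]
  intro i
  fin_cases i
  · exact h0
  · exact hc 1
  · exact h2.congr_left fun x => by
      simp only [Fin.reduceFinMk, Wave.ofReduced, Matrix.cons_val]
      ring

theorem isBigO_toMode [l.NeBot] (h : IsShockProfile P vm um vp up) (hs : 0 < P.s)
    (hν : 0 < P.ν) (hε : 0 < P.ε) (he : EndState P l v₀) {K : ℝ} (hK : ∀ x, ‖P.linGen x‖ ≤ K)
    {Z : ℝ → Phase} {g : ℝ → ℝ} (hZ : Z =O[l] g) : P.toMode Z =O[l] g := by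
  have hv₀ : v₀ ≠ 0 := he.2.1.ne'
  have hR := isBigO_pi.1 (h.isBigO_toReduced hε he hZ)
  have hc := isBigO_pi.1 hZ
  have hM : (fun x => P.linGen x (Z x)) =O[l] g :=
    IsBigO.trans (IsBigO.of_bound K (Eventually.of_forall fun x =>
      (P.linGen x).le_of_opNorm_le (hK x) _)) hZ
  have cg : ∃ a, Tendsto (fun x => (P.slip x : ℂ)) l (𝓝 a) :=
    h.tendsto_coeff hs hν hε he
      (F := fun q => P.ε ^ 2 * (q.1 * q.2.2.1) / q.1 ^ 2 - P.s * P.ν)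
      (by fun_prop (disch := simp [hv₀])) fun x => by rw [Wave.slip, h.deriv_φ]
  have cg' : ∃ a, Tendsto (fun x => ((deriv P.slip x : ℝ) : ℂ)) l (𝓝 a) :=
    h.tendsto_coeff hs hν hε he
      (F := fun q => P.ε ^ 2 * (q.2.1 * q.2.2.1
        + q.1 * ((q.1 * q.2.2.2 - 1) / P.ε ^ 2)) / q.1 ^ 2
        - 2 * P.ε ^ 2 * (q.1 * q.2.2.1) * q.2.1 / q.1 ^ 3)
      (by fun_prop (disch := simp [hv₀, hε.ne'])) fun x => by
        rw [h.deriv_slip, h.deriv_deriv_φ hε, h.deriv_φ]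
  rw [isBigO_pi]
  intro i
  have he : (fun x => P.toMode Z x i) = fun x => (![-1 / P.s * P.toReduced Z x 0,
      P.toReduced Z x 0, (deriv P.slip x : ℝ) * Z x 0 + P.slip x * P.linGen x (Z x) 0,
      P.toReduced Z x 1, P.toReduced Z x 2] : Fin 5 → ℂ) i := by
    funext x; rw [toMode_eq hs]
  rw [he]
  fin_cases i
  · exact (hR 0).const_mul_left _
  · exact hR 0
  · exact (isBigO_coeff_mul cg' (hc 0)).add (isBigO_coeff_mul cg (isBigO_pi.1 hM 0))
  · exact hR 1
  · exact hR 2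

theorem toReduced_injective (h : IsShockProfile P vm um vp up) (hs : 0 < P.s) :
    Function.Injective P.toReduced := fun Y Z hYZ => by
  rw [← h.ofReduced_toReduced hs Y, hYZ, h.ofReduced_toReduced hs Z]

theorem toMode_components (hs : 0 < P.s) (Z : ℝ → Phase) (x : ℝ) :
    P.toReduced Z x = ![P.toMode Z x 1, P.toMode Z x 3, P.toMode Z x 4] := by
  rw [toMode_eq hs]
  ext i
  fin_cases i <;> rfl

theorem toMode_injective (h : IsShockProfile P vm um vp up) (hs : 0 < P.s) :
    Function.Injective P.toMode := fun Y Z hYZ => by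
  refine h.toReduced_injective hs (funext fun x => ?_)
  rw [toMode_components hs, toMode_components hs, hYZ]

/-- Modes vanishing at an end state come from solutions of the linearized profile equation which
are bounded there. -/
theorem exists_mem_boundedAlong [l.NeBot] (h : IsShockProfile P vm um vp up) (hs : 0 < P.s)
    (hν : 0 < P.ν) (hε : 0 < P.ε) (he : EndState P l v₀) {W : ℝ → Fin 5 → ℂ}
    (hW : P.IsModeSolution 0 W) (hlim : Tendsto W l (𝓝 0)) :
    ∃ Z ∈ boundedAlong l P.linGen, P.toMode Z = W := by
  obtain ⟨Z, hZ, rfl⟩ := h.exists_isSol_of_isModeSolution hs hν hε he hW hlim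
  refine ⟨Z, ⟨hZ, h.isBigO_of_toReduced hs hε he ?_⟩, rfl⟩
  have hO := isBigO_pi.1 (hlim.isBigO_one ℝ)
  rw [isBigO_pi]
  intro i
  have hc : (fun x => P.toReduced Z x i) = fun x =>
      (![P.toMode Z x 1, P.toMode Z x 3, P.toMode Z x 4] : Fin 3 → ℂ) i := by
    funext x; rw [toMode_components hs]
  rw [hc]
  fin_cases i
  · exact hO 1
  · exact hO 3
  · exact hO 4

/-- An exponentially decaying mode tends to `0`, hence comes from the linearized profile equation,
where boundedness and exponential decay coincide by `hdec`. The change of variables has convergent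
coefficients and preserves the decay rate. -/
theorem fastPlus_eq (h : IsShockProfile P vm um vp up) (hs : 0 < P.s) (hν : 0 < P.ν)
    (hε : 0 < P.ε) (hvp : 0 < vp) {K : ℝ} (hK : ∀ x, ‖P.linGen x‖ ≤ K)
    (hdec : ∃ θ > 0, ∀ Z ∈ boundedAlong atTop P.linGen,
      Z =O[atTop] (fun x => Real.exp (-θ * x))) :
    P.fastPlus = ((boundedAlong atTop P.linGen).map P.toMode : Submodule ℂ (ℝ → Fin 5 → ℂ)) := by
  have he := h.endState_atTop hvp
  ext W
  constructor
  · rintro ⟨hW, C, θ, hθ, hC⟩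
    refine h.exists_mem_boundedAlong hs hν hε he hW ?_
    have h1 : Tendsto (fun x => C * Real.exp (-θ * x)) atTop (𝓝 0) := by
      have h2 : Tendsto (fun x : ℝ => -θ * x) atTop atBot :=
        tendsto_id.const_mul_atTop_of_neg (by linarith)
      simpa using (Real.tendsto_exp_atBot.comp h2).const_mul C
    exact squeeze_zero_norm' (eventually_atTop.2 ⟨0, hC⟩) h1
  · rintro ⟨Z, hZ, rfl⟩
    obtain ⟨θ, hθ, hd⟩ := hdec
    have hm := h.isModeSolution_toMode hs hν hε hZ.1
    obtain ⟨C, hC⟩ := exists_bound_of_isBigO_atTop hm.differentiable.continuous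
      (by fun_prop) (fun x => Real.exp_pos _) (h.isBigO_toMode hs hν hε he hK (hd Z hZ)) 0
    exact ⟨hm, C, θ, hθ, hC⟩

theorem fastMinus_eq (h : IsShockProfile P vm um vp up) (hs : 0 < P.s) (hν : 0 < P.ν)
    (hε : 0 < P.ε) (hvm : 0 < vm) {K : ℝ} (hK : ∀ x, ‖P.linGen x‖ ≤ K)
    (hdec : ∃ θ > 0, ∀ Z ∈ boundedAlong atBot P.linGen,
      Z =O[atBot] (fun x => Real.exp (θ * x))) :
    P.fastMinus = ((boundedAlong atBot P.linGen).map P.toMode : Submodule ℂ (ℝ → Fin 5 → ℂ)) := by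
  have he := h.endState_atBot hvm
  ext W
  constructor
  · rintro ⟨hW, C, θ, hθ, hC⟩
    refine h.exists_mem_boundedAlong hs hν hε he hW ?_
    have h1 : Tendsto (fun x => C * Real.exp (θ * x)) atBot (𝓝 0) := by
      have h2 : Tendsto (fun x : ℝ => θ * x) atBot atBot := tendsto_id.const_mul_atBot hθ
      simpa using (Real.tendsto_exp_atBot.comp h2).const_mul C
    exact squeeze_zero_norm' (eventually_atBot.2 ⟨0, hC⟩) h1
  · rintro ⟨Z, hZ, rfl⟩
    obtain ⟨θ, hθ, hd⟩ := hdec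
    have hm := h.isModeSolution_toMode hs hν hε hZ.1
    obtain ⟨C, hC⟩ := exists_bound_of_isBigO_atBot hm.differentiable.continuous
      (by fun_prop) (fun x => Real.exp_pos _) (h.isBigO_toMode hs hν hε he hK (hd Z hZ)) 0
    exact ⟨hm, C, θ, hθ, hC⟩

theorem boundedReduced_eq (h : IsShockProfile P vm um vp up) (hs : 0 < P.s) (hν : 0 < P.ν)
    (hε : 0 < P.ε) (hvm : 0 < vm) (hvp : 0 < vp) :
    P.boundedReduced = ((boundedAlong atTop P.linGen ⊓ boundedAlong atBot P.linGen).map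
      P.toReduced : Submodule ℂ (ℝ → Fin 3 → ℂ)) := by
  have ht := h.endState_atTop hvp
  have hb := h.endState_atBot hvm
  ext V
  constructor
  · rintro ⟨hV, C, hC⟩
    have hZV := h.toReduced_ofReduced hs V
    have hZ : IsSol P.linGen (P.ofReduced V) := by
      rw [← h.isReducedSolution_toReduced_iff hs hν hε
        (h.differentiable_ofReduced hs hV.differentiable), hZV]
      exact hV
    have hO : ∀ l : Filter ℝ, P.toReduced (P.ofReduced V) =O[l] (fun _ => (1 : ℝ)) := fun l => by
      rw [hZV]
      exact IsBigO.of_bound C (Eventually.of_forall fun x => by simpa using hC x)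
    exact ⟨P.ofReduced V, ⟨⟨hZ, h.isBigO_of_toReduced hs hε ht (hO _)⟩,
      ⟨hZ, h.isBigO_of_toReduced hs hε hb (hO _)⟩⟩, hZV⟩
  · rintro ⟨Z, ⟨hZt, hZb⟩, rfl⟩
    have hd : Differentiable ℝ Z := fun x => (hZt.1 x).differentiableAt
    have hR := (h.isReducedSolution_toReduced_iff hs hν hε hd).2 hZt.1
    obtain ⟨C, hC⟩ := exists_bound_of_isBigO_atTop hR.differentiable.continuous continuous_const
      (fun _ => one_pos) (h.isBigO_toReduced hε ht hZt.2) 0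
    obtain ⟨C', hC'⟩ := exists_bound_of_isBigO_atBot hR.differentiable.continuous continuous_const
      (fun _ => one_pos) (h.isBigO_toReduced hε hb hZb.2) 0
    refine ⟨hR, max C C', fun x => ?_⟩
    rcases le_total 0 x with hx | hx
    · exact (hC x hx).trans (by simp)
    · exact (hC' x hx).trans (by simp)

theorem toReduced_profileMode (h : IsShockProfile P vm um vp up) (hε : 0 < P.ε) :
    P.toReduced P.profileMode = P.V0 := by
  funext x i
  have hv0 : (P.v x : ℂ) ≠ 0 := Complex.ofReal_ne_zero.2 (h.v_pos x).ne'
  rw [Wave.toReduced_apply]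
  fin_cases i
  · simp only [Fin.zero_eta, Matrix.cons_val, Wave.profileMode, Wave.V0]
    rw [h.deriv_u]
    push_cast
    field_simp
  · rfl
  · simp only [Fin.reduceFinMk, Matrix.cons_val, Wave.profileMode, Wave.V0]
    rw [h.deriv_deriv_φ hε, h.deriv_φ]
    push_cast
    field_simp
    ring

theorem toMode_profileMode (h : IsShockProfile P vm um vp up) (hs : 0 < P.s) (hν : 0 < P.ν)
    (hε : 0 < P.ε) : P.toMode P.profileMode = P.W0 := by
  have hs0 : (P.s : ℂ) ≠ 0 := Complex.ofReal_ne_zero.2 hs.ne'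
  have hsol := h.isSol_profileMode hs hν hε
  funext x
  rw [toMode_eq hs, h.toReduced_profileMode hε]
  ext i
  fin_cases i
  · simp only [Fin.zero_eta, Matrix.cons_val, Wave.V0, Wave.W0]
    rw [h.deriv_u]
    push_cast
    field_simp
  · rfl
  · have hc := (smooth_hasDerivAt h.smooth_slip x).ofReal_comp.mul
      (hasDerivAt_pi.1 (hsol x) 0)
    have he : (fun y => (P.slip y : ℂ) * P.profileMode y 0) = fun y =>
        ((P.b1 y * deriv P.v y + P.b2 y * deriv P.u y : ℝ) : ℂ) := by
      funext y
      have hv0 : (P.v y : ℂ) ≠ 0 := Complex.ofReal_ne_zero.2 (h.v_pos y).ne'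
      simp only [Wave.profileMode, Matrix.cons_val]
      rw [h.slip_eq, h.deriv_u]
      push_cast
      field_simp
      ring
    have hd : HasDerivAt (fun y => P.b1 y * deriv P.v y + P.b2 y * deriv P.u y)
        (deriv (fun y => P.b1 y * deriv P.v y + P.b2 y * deriv P.u y) x) x :=
      smooth_hasDerivAt ((h.smooth_b1.mul (smooth_deriv h.smooth_v)).add
        (h.smooth_b2.mul (smooth_deriv h.smooth_u))) x
    have hc' : HasDerivAt (fun y => (P.slip y : ℂ) * P.profileMode y 0) _ x := hc
    rw [he] at hc'
    exact hc'.unique hd.ofReal_comp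
  · rfl
  · rfl

theorem V0_ne_zero (h : IsShockProfile P vm um vp up) : P.V0 ≠ 0 := fun h0 => by
  have h1 := congrFun (congrFun h0 0) 0
  simp only [Wave.V0, Matrix.cons_val, Pi.zero_apply, Complex.ofReal_eq_zero] at h1
  exact (h.deriv_u_neg 0).ne h1

theorem profileMode_ne_zero (h : IsShockProfile P vm um vp up) (hε : 0 < P.ε) :
    P.profileMode ≠ 0 := fun h0 => by
  apply h.V0_ne_zero
  rw [← h.toReduced_profileMode hε, h0, map_zero]

end IsShockProfile

end NSP

namespace LinODE

/-! ### Bases of planes -/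

theorem exists_span_pair_eq {V : Type*} [AddCommGroup V] [Module ℂ V] {A : Submodule ℂ V}
    (hA : Module.finrank ℂ A = 2) {z : V} (hz : z ≠ 0) (hzA : z ∈ A) :
    ∃ a, LinearIndependent ℂ ![z, a] ∧ Submodule.span ℂ {z, a} = A := by
  have : FiniteDimensional ℂ A := Module.finite_of_finrank_pos (by omega)
  obtain ⟨a, haA, ha⟩ : ∃ a ∈ A, a ∉ Submodule.span ℂ {z} := by
    by_contra! hc
    have h1 : Module.finrank ℂ A ≤ Module.finrank ℂ (Submodule.span ℂ {z}) :=
      Submodule.finrank_mono hc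
    rw [finrank_span_singleton hz] at h1
    omega
  have hli : LinearIndependent ℂ ![z, a] := by
    rw [LinearIndependent.pair_iff' hz]
    intro c hc
    exact ha (Submodule.mem_span_singleton.2 ⟨c, hc⟩)
  refine ⟨a, hli, ?_⟩
  refine Submodule.eq_of_le_of_finrank_le (Submodule.span_le.2 ?_) ?_
  · rintro x (rfl | rfl)
    · exact hzA
    · exact haA
  · have := finrank_span_eq_card hli
    rw [Matrix.range_cons, Matrix.range_cons, Matrix.range_empty, Set.union_empty,
      Set.singleton_union] at this
    rw [this, hA]; simp

/-- Three vectors spanning a space that contains `A ⊔ B`, of dimension three, cannot be dependent.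
-/
theorem linearIndependent_of_span_pairs {V : Type*} [AddCommGroup V] [Module ℂ V]
    {A B : Submodule ℂ V} {z a b : V} (ha : Submodule.span ℂ {z, a} = A)
    (hb : Submodule.span ℂ {z, b} = B) (h : Module.finrank ℂ (A ⊔ B : Submodule ℂ V) = 3) :
    LinearIndependent ℂ ![a, z, b] := by
  rw [linearIndependent_iff_card_le_finrank_span]
  have h1 : A ⊔ B ≤ Submodule.span ℂ (Set.range ![a, z, b]) := by
    rw [← ha, ← hb, ← Submodule.span_union]
    refine Submodule.span_mono ?_
    simp only [Matrix.range_cons, Matrix.range_empty]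
    intro x hx
    simp only [Set.mem_union, Set.mem_insert_iff, Set.mem_singleton_iff] at hx ⊢
    tauto
  have : FiniteDimensional ℂ (Submodule.span ℂ (Set.range ![a, z, b])) :=
    FiniteDimensional.span_of_finite ℂ (Set.finite_range _)
  have h2 := Submodule.finrank_mono h1
  simp only [Fintype.card_fin, Set.finrank]
  omega

theorem map_span_pair {V W : Type*} [AddCommGroup V] [Module ℂ V] [AddCommGroup W]
    [Module ℂ W] (f : V →ₗ[ℂ] W) (z a : V) :
    (Submodule.span ℂ {z, a}).map f = Submodule.span ℂ {f z, f a} := by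
  rw [Submodule.map_span, Set.image_pair]

end LinODE

/-! ### The transversality coefficient and the bounded solutions. -/

namespace NSP

open LinODE

namespace IsShockProfile

variable {P : Wave} {vm um vp up : ℝ}

theorem det_R (P : Wave) (x : ℝ) : (P.R x).det = P.b1 x - P.b2 x * P.s := by
  have h0 : P.A x 0 0 = P.s := rfl
  have h1 : P.A x 0 1 = 1 := rfl
  rw [Wave.R, h0, h1]
  simp [Matrix.det_succ_row_zero, Fin.sum_univ_succ, Fin.succAbove]
  ring

theorem det_R_ne_zero (h : IsShockProfile P vm um vp up) (hs : 0 < P.s) (hν : 0 < P.ν) (x : ℝ) :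
    (P.R x).det ≠ 0 := by
  rw [det_R]
  intro h0
  have h1 := h.slip_eq x
  have h2 := h.slip_neg hs hν x
  have h3 : P.slip x = (P.b1 x - P.b2 x * P.s) * P.v x := by rw [h1]; ring
  rw [h0, zero_mul] at h3
  linarith

theorem zeta_eq (P : Wave) (W : ℝ → Fin 5 → ℂ) :
    P.zeta W 0 = P.b1 0 * W 0 0 + P.b2 0 * W 0 1 ∧ P.zeta W 3 = W 0 3 ∧ P.zeta W 4 = W 0 4 := by
  refine ⟨?_, ?_, ?_⟩ <;>
    simp [Wave.zeta, Wave.R, Matrix.mulVec, dotProduct, Fin.sum_univ_succ]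

theorem zeta_toMode (h : IsShockProfile P vm um vp up) (Z : ℝ → Phase) :
    P.zeta (P.toMode Z) 0 = P.slip 0 * Z 0 0 ∧ P.zeta (P.toMode Z) 3 = Z 0 1 ∧
      P.zeta (P.toMode Z) 4 = P.v 0 * Z 0 2 + (deriv P.φ 0 : ℝ) * Z 0 0 := by
  obtain ⟨h0, h3, h4⟩ := zeta_eq P (P.toMode Z)
  rw [h0, h3, h4, h.slip_eq, Wave.toMode_apply]
  refine ⟨?_, rfl, rfl⟩
  simp only [Matrix.cons_val]
  push_cast
  ring

/-- The determinant of the transversality coefficient vanishes only for dependent modes. -/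
theorem Gam_toMode_ne_zero (h : IsShockProfile P vm um vp up) (hs : 0 < P.s) (hν : 0 < P.ν)
    (hε : 0 < P.ε) {K : ℝ} (hK : ∀ x, ‖P.linGen x‖ ≤ K) {a b : ℝ → Phase}
    (ha : IsSol P.linGen a) (hb : IsSol P.linGen b)
    (hli : LinearIndependent ℂ ![a, P.profileMode, b]) :
    P.Gam vm (P.toMode a) (P.toMode b) ≠ 0 := by
  rw [Wave.Gam, ← h.toMode_profileMode hs hν hε]
  refine mul_ne_zero (div_ne_zero ?_ ?_) ?_
  · rw [Complex.ofReal_ne_zero]; positivity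
  · rw [Complex.ofReal_ne_zero]; exact h.det_R_ne_zero hs hν 0
  intro hdet
  -- A kernel vector is a combination of the three solutions whose selected components vanish at
  -- `0`. These are `slip · m`, `f` and `v Y + φ̄' m`, which determine the full value at `0`, so
  -- uniqueness annihilates the combination.
  obtain ⟨c, hc0, hc⟩ := Matrix.exists_mulVec_eq_zero_iff.2 hdet
  apply hc0
  set z := P.profileMode with hz
  have hzs : IsSol P.linGen z := h.isSol_profileMode hs hν hε
  have hg0 : (P.slip 0 : ℂ) ≠ 0 := Complex.ofReal_ne_zero.2 (h.slip_neg hs hν 0).ne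
  have hv0 : (P.v 0 : ℂ) ≠ 0 := Complex.ofReal_ne_zero.2 (h.v_pos 0).ne'
  have e0 := congrFun hc 0
  have e1 := congrFun hc 1
  have e2 := congrFun hc 2
  simp only [Matrix.mulVec, dotProduct, Fin.sum_univ_three, Matrix.of_apply, Matrix.cons_val,
    (h.zeta_toMode a).1, (h.zeta_toMode a).2.1, (h.zeta_toMode a).2.2,
    (h.zeta_toMode b).1, (h.zeta_toMode b).2.1, (h.zeta_toMode b).2.2,
    (h.zeta_toMode z).1, (h.zeta_toMode z).2.1, (h.zeta_toMode z).2.2, Pi.zero_apply]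
    at e0 e1 e2
  have f0 : c 0 * a 0 0 + c 1 * z 0 0 + c 2 * b 0 0 = 0 := by
    have : (P.slip 0 : ℂ) * (c 0 * a 0 0 + c 1 * z 0 0 + c 2 * b 0 0) = 0 := by
      linear_combination e0
    exact (mul_eq_zero.1 this).resolve_left hg0
  have f1 : c 0 * a 0 1 + c 1 * z 0 1 + c 2 * b 0 1 = 0 := by linear_combination e1
  have f2 : c 0 * a 0 2 + c 1 * z 0 2 + c 2 * b 0 2 = 0 := by
    have : (P.v 0 : ℂ) * (c 0 * a 0 2 + c 1 * z 0 2 + c 2 * b 0 2) = 0 := by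
      linear_combination e2 - (deriv P.φ 0 : ℝ) * f0
    exact (mul_eq_zero.1 this).resolve_left hv0
  have hY : IsSol P.linGen (c 0 • a + c 1 • z + c 2 • b) :=
    (Sol P.linGen).add_mem ((Sol P.linGen).add_mem ((Sol P.linGen).smul_mem _ ha)
      ((Sol P.linGen).smul_mem _ hzs)) ((Sol P.linGen).smul_mem _ hb)
  have hY0 : c 0 • a + c 1 • z + c 2 • b = 0 := by
    refine IsSol.ext hK hY (Sol P.linGen).zero_mem (t := 0) ?_
    ext i
    fin_cases i
    · exact f0
    · exact f1
    · exact f2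
  rw [Fintype.linearIndependent_iff] at hli
  have := hli c (by rw [Fin.sum_univ_three]; exact hY0)
  exact funext this

/-- The conclusions about a profile, from the dimensions of the spaces of bounded solutions. -/
theorem transversality (h : IsShockProfile P vm um vp up) (hs : 0 < P.s) (hν : 0 < P.ν)
    (hε : 0 < P.ε) (hvm : 0 < vm) (hvp : 0 < vp) {K η : ℝ} (hK : ∀ x, ‖P.linGen x‖ ≤ K)
    (hη : 0 ≤ η)
    (hA : Module.finrank ℂ (boundedAlong atTop P.linGen) = 2 ∧ ∃ θ > 0,
      ∀ Z ∈ boundedAlong atTop P.linGen, Z =O[atTop] (fun x => Real.exp (-θ * x)))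
    (hB : Module.finrank ℂ (boundedAlong atBot P.linGen) = 2 ∧ ∃ θ > 0,
      ∀ Z ∈ boundedAlong atBot P.linGen, Z =O[atBot] (fun x => Real.exp (θ * x)))
    (hC : Module.finrank ℂ (fastAtBot η P.linGen) = 1)
    (hdis : Disjoint (boundedAlong atTop P.linGen) (fastAtBot η P.linGen)) :
    (∃ φ2 φ4 : ℝ → Fin 5 → ℂ,
        P.CompletesBasis P.fastPlus φ2 ∧ P.CompletesBasis P.fastMinus φ4) ∧
      (∀ φ2 φ4 : ℝ → Fin 5 → ℂ,
        P.CompletesBasis P.fastPlus φ2 → P.CompletesBasis P.fastMinus φ4 →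
          P.Gam vm φ2 φ4 ≠ 0) ∧
      P.V0 ≠ 0 ∧
      P.boundedReduced = (Submodule.span ℂ {P.V0} : Set (ℝ → Fin 3 → ℂ)) := by
  have hz := h.isSol_profileMode hs hν hε
  have hz0 := h.profileMode_ne_zero hε
  have hzA : P.profileMode ∈ boundedAlong atTop P.linGen :=
    ⟨hz, h.profileMode_isBigO_one hs hν hε (h.endState_atTop hvp)⟩
  have hzB : P.profileMode ∈ boundedAlong atBot P.linGen :=
    ⟨hz, h.profileMode_isBigO_one hs hν hε (h.endState_atBot hvm)⟩
  obtain ⟨hinf, hsup⟩ := inf_eq_span_and_finrank_sup hA.1 hB.1 hC (fastAtBot_le hη _) hdis hz0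
    hzA hzB
  have hW0 := h.toMode_profileMode hs hν hε
  have hinj := h.toMode_injective hs
  have hker : LinearMap.ker P.toMode = ⊥ := LinearMap.ker_eq_bot.2 hinj
  have hbasis : ∀ {A : Submodule ℂ (ℝ → Phase)} {S : Set (ℝ → Fin 5 → ℂ)},
      S = (A.map P.toMode : Submodule ℂ (ℝ → Fin 5 → ℂ)) → Module.finrank ℂ A = 2 →
      P.profileMode ∈ A → ∃ w, P.CompletesBasis S w := by
    rintro A S rfl hd hm
    obtain ⟨a, hli, hsp⟩ := exists_span_pair_eq hd hz0 hm
    refine ⟨P.toMode a, ?_, ?_⟩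
    · have := hli.map' P.toMode hker
      have hcomp : ⇑P.toMode ∘ ![P.profileMode, a] = ![P.W0, P.toMode a] := by
        rw [← hW0]
        ext i
        fin_cases i <;> rfl
      rwa [hcomp] at this
    · rw [← hW0, ← map_span_pair, hsp]
  have hspan : ∀ {A : Submodule ℂ (ℝ → Phase)} {S : Set (ℝ → Fin 5 → ℂ)} {w : ℝ → Fin 5 → ℂ},
      S = (A.map P.toMode : Submodule ℂ (ℝ → Fin 5 → ℂ)) → P.CompletesBasis S w →
      ∃ a ∈ A, P.toMode a = w ∧ Submodule.span ℂ {P.profileMode, a} = A := by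
    rintro A S w rfl ⟨-, hw⟩
    have hmem : w ∈ Submodule.span ℂ {P.W0, w} := Submodule.subset_span (by simp)
    rw [SetLike.coe_set_eq] at hw
    rw [hw] at hmem
    obtain ⟨a, ha, rfl⟩ := hmem
    refine ⟨a, ha, rfl, Submodule.map_injective_of_injective hinj ?_⟩
    rw [map_span_pair, hW0, hw]
  have hP := h.fastPlus_eq hs hν hε hvp hK hA.2
  have hM := h.fastMinus_eq hs hν hε hvm hK hB.2
  refine ⟨?_, ?_, h.V0_ne_zero, ?_⟩
  · obtain ⟨φ2, h2⟩ := hbasis hP hA.1 hzA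
    obtain ⟨φ4, h4⟩ := hbasis hM hB.1 hzB
    exact ⟨φ2, φ4, h2, h4⟩
  · intro φ2 φ4 h2 h4
    obtain ⟨a, ha, rfl, hsa⟩ := hspan hP h2
    obtain ⟨b, hb, rfl, hsb⟩ := hspan hM h4
    exact h.Gam_toMode_ne_zero hs hν hε hK ha.1 hb.1 (linearIndependent_of_span_pairs hsa hsb hsup)
  · rw [h.boundedReduced_eq hs hν hε hvm hvp, hinf, Submodule.map_span, Set.image_singleton,
      h.toReduced_profileMode hε]

/-! ### Small amplitude -/

/-- The rate `γ` of the slow mode at the state `v`, for the wave speed `s`. -/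
def slowRate (T ν s v : ℝ) : ℝ := (T + 1 - s ^ 2 * v ^ 2) / (v * s * ν)

/-- The wave parameters near the sonic state at which the estimates are available. -/
theorem exists_radius {T ν ε vm : ℝ} (hT : 0 < T) (hν : 0 < ν) (hε : 0 < ε) (hvm : 0 < vm) :
    ∃ r > (0 : ℝ), ∃ c > (0 : ℝ), ∃ η > (0 : ℝ), ∃ b > (0 : ℝ), ∀ s v e y : ℝ,
      |s - Real.sqrt ((T + 1) / (vm * vm))| < r → |v - vm| < r → |e - 1 / vm| < r → |y| < r →
      (∀ V : Phase, c * ‖V‖ ^ 2 ≤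
        form ε b 1 V ((gen T ν ε (s, v, e, y) - (η : ℂ) • ContinuousLinearMap.id ℂ Phase) V)) ∧
      |slowRate T ν s v| * ((1 + 2 * (1 / (v * s * ν) * ε ^ 2)) ^ 2
        + 8 * (1 / (v * s * ν) * ε ^ 2)) < 8 * v := by
  set s₀ := Real.sqrt ((T + 1) / (vm * vm)) with hs₀
  have hs₀pos : 0 < s₀ := Real.sqrt_pos.2 (by positivity)
  have hsv : s₀ ^ 2 * vm ^ 2 = T + 1 := by
    rw [hs₀, Real.sq_sqrt (by positivity)]; field_simp
  set b := 1 / (vm * s₀ * ν) with hb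
  have hb0 : 0 < b := by positivity
  -- Any `η > 0` with `η b ε² + η² ε² < vm` serves; this one is at most `1`, so `η²` may be replaced
  -- by `η`. It depends on the left state only, not on the amplitude.
  set η := vm / (b * ε ^ 2 + ε ^ 2 + vm) with hη
  have hη0 : 0 < η := by positivity
  have hη1 : η ≤ 1 := by
    rw [hη, div_le_one (by positivity)]
    have : 0 < b * ε ^ 2 + ε ^ 2 := by positivity
    linarith
  have hηv : η * (b * ε ^ 2) + η ^ 2 * ε ^ 2 < vm := by
    have h1 : η * (b * ε ^ 2 + ε ^ 2 + vm) = vm := by rw [hη]; field_simp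
    have h2 : η ^ 2 * ε ^ 2 ≤ η * ε ^ 2 := by
      have : η ^ 2 ≤ η := by nlinarith
      gcongr
    have h3 : 0 < η * vm := by positivity
    linarith
  obtain ⟨c, hc, hev⟩ := exists_eventually_form_ge
    (form_weight_gen_pos hν hε hs₀pos hvm hb hsv hη0 hηv)
  have hcont := (continuousAt_gen T (e := 1 / vm) (y := 0) hν.ne' hε.ne' hs₀pos.ne' hvm.ne').sub
    (continuousAt_const (y := (η : ℂ) • ContinuousLinearMap.id ℂ Phase))
  have h1 := hcont.tendsto.eventually hev
  have hcont2 : ContinuousAt (fun q : ℝ × ℝ × ℝ × ℝ => |slowRate T ν q.1 q.2.1| *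
      ((1 + 2 * (1 / (q.2.1 * q.1 * ν) * ε ^ 2)) ^ 2
        + 8 * (1 / (q.2.1 * q.1 * ν) * ε ^ 2)) - 8 * q.2.1) (s₀, vm, 1 / vm, 0) := by
    unfold slowRate
    fun_prop (disch := simp [hν.ne', hs₀pos.ne', hvm.ne'])
  -- The slow rate vanishes at the sonic state, so the discriminant condition holds nearby with
  -- strict inequality.
  have h2 := hcont2.tendsto.eventually_lt_const (u := 0) (by
    have : slowRate T ν s₀ vm = 0 := by rw [slowRate, hsv]; simp
    simp [this, hvm])
  obtain ⟨r, hr, hball⟩ := Metric.eventually_nhds_iff.1 (h1.and h2)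
  refine ⟨r, hr, c, hc, η, hη0, b, hb0, fun s v e y h3 h4 h5 h6 => ?_⟩
  have h7 := hball (y := (s, v, e, y)) (by
    simp only [Prod.dist_eq, Real.dist_eq, sub_zero, max_lt_iff]
    exact ⟨h3, h4, h5, h6⟩)
  exact ⟨h7.1, by simpa using h7.2⟩

/-- The four quantities control the wave speed, `exp φ`, `v` and the field, in the form in which the
jump conditions and the profile bounds provide them. -/
theorem exists_amplitude (T ε : ℝ) {vm r : ℝ} (hvm : 0 < vm) (hr : 0 < r) :
    ∃ δ > 0, ∀ vp, |vp - vm| < δ →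
      |Real.sqrt ((T + 1) / (vm * vp)) - Real.sqrt ((T + 1) / (vm * vm))| < r ∧
      |1 / vp - 1 / vm| < r ∧ |vp - vm| < r ∧
      |(vp - vm) * (1 / vm ^ 2 + 1 / (vm * ε ^ 2))| < r := by
  have hc1 : ContinuousAt (fun vp => Real.sqrt ((T + 1) / (vm * vp))
      - Real.sqrt ((T + 1) / (vm * vm))) vm := by
    fun_prop (disch := simp [hvm.ne'])
  have hc2 : ContinuousAt (fun vp => 1 / vp - 1 / vm) vm := by
    fun_prop (disch := simp [hvm.ne'])
  have hc3 : ContinuousAt (fun vp => vp - vm) vm := by fun_prop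
  have hc4 : ContinuousAt (fun vp => (vp - vm) * (1 / vm ^ 2 + 1 / (vm * ε ^ 2))) vm := by
    fun_prop
  have h1 := hc1.abs.tendsto.eventually_lt_const (u := r) (by simpa using hr)
  have h2 := hc2.abs.tendsto.eventually_lt_const (u := r) (by simpa using hr)
  have h3 := hc3.abs.tendsto.eventually_lt_const (u := r) (by simpa using hr)
  have h4 := hc4.abs.tendsto.eventually_lt_const (u := r) (by simpa using hr)
  obtain ⟨δ, hδ, hball⟩ := Metric.eventually_nhds_iff.1 (h1.and (h2.and (h3.and h4)))
  exact ⟨δ, hδ, fun vp hvp => hball hvp⟩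

end IsShockProfile

end NSP

end

/-! ### Weak profiles. -/

theorem lemma5p6 (T ν ε vm um : ℝ) (hT : 0 < T) (hν : 0 < ν) (hε : 0 < ε) (hvm : 0 < vm) :
    ∃ δ₁ : ℝ, 0 < δ₁ ∧
      ∀ (vp up : ℝ) (P : NSP.Wave),
        P.T = T → P.ν = ν → P.ε = ε → 0 < P.s →
        -P.s * (vp - vm) - (up - um) = 0 →
        -P.s * (up - um) + (T + 1) * (1 / vp - 1 / vm) = 0 →
        vm < vp →
        |vp - vm| < δ₁ →
        NSP.IsShockProfile P vm um vp up →
        (∃ φ2 φ4 : ℝ → Fin 5 → ℂ,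
            P.CompletesBasis P.fastPlus φ2 ∧ P.CompletesBasis P.fastMinus φ4) ∧
        (∀ φ2 φ4 : ℝ → Fin 5 → ℂ,
            P.CompletesBasis P.fastPlus φ2 → P.CompletesBasis P.fastMinus φ4 →
              P.Gam vm φ2 φ4 ≠ 0) ∧
        P.V0 ≠ 0 ∧
        P.boundedReduced = (Submodule.span ℂ {P.V0} : Set (ℝ → Fin 3 → ℂ)) := by
  obtain ⟨r, hr, c, hc, η, hη, b, hb, hsmall⟩ := NSP.IsShockProfile.exists_radius hT hν hε hvm
  obtain ⟨δ, hδ, hamp⟩ := NSP.IsShockProfile.exists_amplitude T ε hvm hr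
  refine ⟨δ, hδ, fun vp up P hPT hPν hPε hs hRH1 hRH2 hlt hd h => ?_⟩
  subst hPT hPν hPε
  have hvp : 0 < vp := hvm.trans hlt
  obtain ⟨a1, a2, a3, a4⟩ := hamp vp hd
  -- Eliminating `up - um` from the jump conditions and dividing by `vp - vm` gives the speed, which
  -- tends to the sonic speed at `vm` as the amplitude vanishes.
  have hs2 : P.s ^ 2 = (P.T + 1) / (vm * vp) := by
    have h1 : 1 / vp - 1 / vm = -((vp - vm) / (vm * vp)) := by field_simp; ring
    have h2 : (P.s ^ 2 - (P.T + 1) / (vm * vp)) * (vp - vm) = 0 := by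
      rw [h1] at hRH2
      linear_combination hRH2 - P.s * hRH1
    rcases mul_eq_zero.1 h2 with h3 | h3
    · linarith
    · linarith
  rw [← hs2, Real.sqrt_sq hs.le] at a1
  have hT1 : 0 < P.T + 1 := by linarith
  obtain ⟨K, hK⟩ := h.exists_norm_linGen_le hvm hvp hs hν hε
  have hM := h.continuous_linGen hs hν hε
  have hr0 : |(0 : ℝ)| < r := by simpa using hr
  -- All coefficients along the profile stay within `r` of the sonic state, so the weighted form
  -- expands on the whole line, with `b` frozen at that state.
  have hform : ∀ x V, c * ‖V‖ ^ 2 ≤ LinODE.form P.ε b 1 V (LinODE.weight η P.linGen x V) := by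
    intro x
    have h1 := h.v_mem hs x
    have h2 := h.exp_mem hvm hvp x
    have h3 := h.abs_field_le hvm hlt hs hε x
    refine (hsmall P.s (P.v x) (Real.exp (P.φ x)) (P.field x) a1 ?_ ?_ ?_).1
    · rw [abs_lt] at a3 ⊢; constructor <;> linarith
    · rw [abs_lt] at a2 ⊢; constructor <;> linarith
    · exact h3.trans_lt ((le_abs_self _).trans_lt a4)
  have hplus := (hsmall P.s vp (1 / vp) 0 a1 a3 a2 hr0).2
  have hminus := (hsmall P.s vm (1 / vm) 0 a1 (by simpa using hr) (by simpa using hr) hr0).2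
  -- The Lax condition: since `s² = (T + 1) / (vm vp)`, the slow rate is negative at `vp` and
  -- positive at `vm`. This is what allows `σ = 1` at `+∞` and `σ = -1` at `-∞`.
  have hγp : NSP.IsShockProfile.slowRate P.T P.ν P.s vp < 0 := by
    refine div_neg_of_neg_of_pos ?_ (by positivity)
    have h1 : P.s ^ 2 * vp ^ 2 = (P.T + 1) + (P.T + 1) * ((vp - vm) / vm) := by
      rw [hs2]; field_simp; ring
    have h2 : 0 < (P.T + 1) * ((vp - vm) / vm) := mul_pos hT1 (div_pos (by linarith) hvm)
    linarith
  have hγm : 0 < NSP.IsShockProfile.slowRate P.T P.ν P.s vm := by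
    refine div_pos ?_ (by positivity)
    have h1 : P.s ^ 2 * vm ^ 2 = (P.T + 1) - (P.T + 1) * ((vp - vm) / vp) := by
      rw [hs2]; field_simp; ring
    have h2 : 0 < (P.T + 1) * ((vp - vm) / vp) := mul_pos hT1 (div_pos (by linarith) hvp)
    linarith
  refine h.transversality hs hν hε hvm hvp hK hη.le
    (LinODE.finrank_boundedAlong_atTop hM hK (h.tendsto_linGen hs hν hε (h.endState_atTop hvp))
      (b := 1 / (vp * P.s * P.ν)) (by positivity) hε
      (LinODE.form_gen_end_pos hν hε hs hvp rfl rfl (by norm_num) (by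
        change 1 * NSP.IsShockProfile.slowRate P.T P.ν P.s vp < 0; linarith) ?_))
    (LinODE.finrank_boundedAlong_atBot hM hK (h.tendsto_linGen hs hν hε (h.endState_atBot hvm))
      (b := 1 / (vm * P.s * P.ν)) (by positivity) hε
      (LinODE.form_gen_end_pos hν hε hs hvm rfl rfl (by norm_num) (by
        change -1 * NSP.IsShockProfile.slowRate P.T P.ν P.s vm < 0; linarith) ?_))
    (LinODE.finrank_fastAtBot_eq_one hM hK hb hε hc hform)
    (LinODE.disjoint_fastAtBot hη.le hform hc (LinODE.form_symm P.ε b 1))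
  · change -(1 * NSP.IsShockProfile.slowRate P.T P.ν P.s vp) * _ < _
    rwa [one_mul, ← abs_of_neg hγp]
  · change -(-1 * NSP.IsShockProfile.slowRate P.T P.ν P.s vm) * _ < _
    rwa [neg_one_mul, neg_neg, ← abs_of_pos hγm]
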